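/- Let $a>-1$, $\mathbb R^+=(0,\infty)$, $d\omega_a(x)=x^a\,dx$ on $\mathbb R^+$, $L^2_a=L^2(\mathbb R^+,d\omega_a)$ and $\mathcal B_a=\partial_{xx}+\frac ax\partial_x$. Let $\mathscr S^+$ be the set of all $\varphi\in C^\infty(\mathbb R^+;\mathbb C)$ with $$\sup_{x>0}\Big|x^m\big(\tfrac1x\partial_x\big)^k\varphi(x)\Big|<\infty\quad\text{for all } m,k\in\mathbb N_0,$$ and let $\mathbb S^+$ be the set of all $F\in C^\infty(\mathbb R^+\times\mathbb R;\mathbb C)$ with $$\sup_{k+\ell\le p}\ \sup_{x>0,\,t\in\mathbb R}(1+x^2+t^2)^{p/2}\Big|\big(\tfrac1x\partial_x\big)^k\partial_t^\ell F(x,t)\Big|<\infty\quad\text{for all } p\in\mathbb N_0.$$ Let $\varphi\in\mathscr S^+$ and $F\in\mathbb S^+$, and consider the Cauchy problem with Neumann condition $$\begin{cases}\partial_tu-i\mathcal B_au=F(x,t),& x\in\mathbb R^+,\ t\in\mathbb R,\\ \lim_{x\to0^+}x^a\partial_xu(x,t)=0,& t\in\mathbb R,\\ u(x,0)=\varphi(x),&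 x\in\mathbb R^+.\end{cases}\qquad(*)$$ A solution of $(*)$ is a function $u:\mathbb R^+\times\mathbb R\to\mathbb C$, of class $C^2$ in $x$ and differentiable in $t$, that satisfies the three equations pointwise and for which $t\mapsto u(\cdot,t)$ is a $C^1$ map from $\mathbb R$ to $L^2_a$. Then $(*)$ has a solution, it is unique, and for all $x>0$ and $t\ne0$ it is given by $$u(x,t)=\int_0^\infty S_a(x,y,t)\varphi(y)\,d\omega_a(y)+\int_0^t\int_0^\infty S_a(x,y,t-s)F(y,s)\,d\omega_a(y)\,ds,$$ where the integrals in $y$ (for $s\neq t$ in the second term) and then the integral in $s$ converge absolutely, and where for $x,y>0$ $$S_a(x,y,t)=\begin{cases}\dfrac{e^{i\frac{(a+1)\pi}4}}{(2|t|)^{\frac{a+1}2}}\Big(\dfrac{xy}{2|t|}\Big)^{\frac{1-a}2}J_{\frac{a-1}2}\Big(\dfrac{xy}{2|t|}\Big)e^{-i\frac{x^2+y^2}{4|t|}},& t<0,\\[2ex] \dfrac{e^{-i\frac{(a+1)\pi}4}}{(2|t|)^{\frac{a+1}2}}\Big(\dfrac{xy}{2|t|}\Big)^{\frac{1-a}2}J_{\frac{a-1}2}\Big(\dfrac{xy}{2|t|}\Big)e^{i\frac{x^2+y^2}{4|t|}},&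 t>0,\end{cases}$$ and $J_\nu(z)=\sum_{k=0}^\infty\frac{(-1)^k}{\Gamma(k+1)\Gamma(\nu+k+1)}\big(\frac z2\big)^{2k+\nu}$ is the Bessel function of the first kind of order $\nu$. -/

import Mathlib

open MeasureTheory Set Filter Topology
open scoped ContDiff

noncomputable section

namespace HalfLine

/-- The operator `(1/x) ∂ₓ`. -/
def radialDeriv (f : ℝ → ℂ) : ℝ → ℂ := fun x => ((1 / x : ℝ) : ℂ) * deriv f x

/-- The class `𝒮⁺` of smooth functions `φ` on `(0, ∞)` such that
`sup_{x > 0} |x ^ m ((1/x) ∂ₓ) ^ k φ(x)| < ∞` for all `m, k`. Only the values of `φ` on `(0, ∞)`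
matter. -/
structure IsSchwartzPlus (φ : ℝ → ℂ) : Prop where
  smooth : ContDiffOn ℝ ∞ φ (Ioi 0)
  bounded : ∀ m k : ℕ, ∃ C : ℝ, ∀ x : ℝ, 0 < x → ‖((x ^ m : ℝ) : ℂ) * (radialDeriv^[k] φ) x‖ ≤ C

/-- The class `𝕊⁺` of smooth functions `F` on `(0, ∞) × ℝ` such that for every `p`
`sup_{k + l ≤ p} sup_{x > 0, t} (1 + x² + t²) ^ (p/2) |((1/x) ∂ₓ) ^ k ∂ₜ ^ l F(x, t)| < ∞`.
Only the values of `F` on `(0, ∞) × ℝ` matter. -/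
structure IsSpaceTimeSchwartzPlus (F : ℝ → ℝ → ℂ) : Prop where
  smooth : ContDiffOn ℝ ∞ (fun q : ℝ × ℝ => F q.1 q.2) (Ioi 0 ×ˢ univ)
  bounded : ∀ p : ℕ, ∃ C : ℝ, ∀ k l : ℕ, k + l ≤ p → ∀ x : ℝ, 0 < x → ∀ t : ℝ,
    (1 + x ^ 2 + t ^ 2) ^ ((p : ℝ) / 2) *
      ‖(radialDeriv^[k] (fun z => iteratedDeriv l (fun s => F z s) t)) x‖ ≤ C

/-- The measure `dω_a(x) = x ^ a dx` on the half-line `(0, ∞)`. -/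
def omega (a : ℝ) : Measure ℝ :=
  (volume.restrict (Ioi 0)).withDensity (fun x => ENNReal.ofReal (x ^ a))

/-- The Bessel operator `ℬ_a f = f'' + (a/x) f'`. -/
def besselOp (a : ℝ) (f : ℝ → ℂ) (x : ℝ) : ℂ :=
  deriv (deriv f) x + ((a / x : ℝ) : ℂ) * deriv f x

/-- The Bessel function of the first kind of real order `ν`, at positive real argument `z`. -/
def besselJ (ν z : ℝ) : ℝ :=
  ∑' k : ℕ, (-1 : ℝ) ^ k / (Real.Gamma ((k : ℝ) + 1) * Real.Gamma (ν + (k : ℝ) + 1)) *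
    (z / 2) ^ (2 * (k : ℝ) + ν)

/-- The kernel `S_a(x, y, t)` for `x, y > 0` and `t ≠ 0`; its value at `t = 0` is set to `0`. -/
def kernelS (a x y t : ℝ) : ℂ :=
  if t < 0 then
    Complex.exp (Complex.I * (((a + 1) * Real.pi / 4 : ℝ) : ℂ)) /
        (((2 * |t|) ^ ((a + 1) / 2) : ℝ) : ℂ) *
      (((x * y / (2 * |t|)) ^ ((1 - a) / 2) * besselJ ((a - 1) / 2) (x * y / (2 * |t|)) : ℝ) : ℂ) *
      Complex.exp (-(Complex.I * (((x ^ 2 + y ^ 2) / (4 * |t|) : ℝ) : ℂ)))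
  else if 0 < t then
    Complex.exp (-(Complex.I * (((a + 1) * Real.pi / 4 : ℝ) : ℂ))) /
        (((2 * |t|) ^ ((a + 1) / 2) : ℝ) : ℂ) *
      (((x * y / (2 * |t|)) ^ ((1 - a) / 2) * besselJ ((a - 1) / 2) (x * y / (2 * |t|)) : ℝ) : ℂ) *
      Complex.exp (Complex.I * (((x ^ 2 + y ^ 2) / (4 * |t|) : ℝ) : ℂ))
  else 0

/-- `u` (of which only the values on `(0, ∞) × ℝ` matter) is a solution, in `L²_a = L²(ω_a)`, of
the Cauchy problem
`∂ₜ u - i ℬ_a u = F` on `(0, ∞) × ℝ`, `lim_{x → 0+} x ^ a ∂ₓ u(x, t) = 0`, `u(x, 0) = φ(x)`: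
it solves all three equations pointwise, and `t ↦ u(·, t)` is of class `C¹` from `ℝ` to `L²_a`. -/
structure IsSolution (a : ℝ) (φ : ℝ → ℂ) (F : ℝ → ℝ → ℂ) (u : ℝ → ℝ → ℂ) : Prop where
  contDiff_space : ∀ t : ℝ, ContDiffOn ℝ 2 (fun x => u x t) (Ioi 0)
  differentiable_time : ∀ x : ℝ, 0 < x → Differentiable ℝ (fun t => u x t)
  contDiff_L2 : ∃ U : ℝ → Lp ℂ 2 (omega a), ContDiff ℝ 1 U ∧
    ∀ t : ℝ, (U t : ℝ → ℂ) =ᵐ[omega a] fun x => u x t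
  equation : ∀ x : ℝ, 0 < x → ∀ t : ℝ,
    deriv (fun s => u x s) t - Complex.I * besselOp a (fun z => u z t) x = F x t
  neumann : ∀ t : ℝ,
    Tendsto (fun x : ℝ => ((x ^ a : ℝ) : ℂ) * deriv (fun z => u z t) x) (𝓝[>] 0) (𝓝 0)
  initial : ∀ x : ℝ, 0 < x → u x 0 = φ x

end HalfLine

end

namespace HalfLine

noncomputable section

/-! ### The weighted measure -/

/-! Put `ν = (a - 1) / 2` and `E_a(z) = z ^ (-ν) J_ν(z)` (`besselE`), an even entire function. The
rules `E_a' = -z E_{a+2}` and `E_a = (1 + a) E_{a+2} - z ^ 2 E_{a+4}` together are Bessel's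
equation. The Hankel transform with kernel `E_a(ξ y)` therefore diagonalises the Bessel operator
into multiplication by `-ξ ^ 2` (`Chain.exists_hankel_eq`, by Green's identity), and it preserves
the class `𝒮⁺` (`SchwartzFamily.hankel`). On the transform side the Cauchy problem is the scalar
equation `∂ₜ v = -i ξ ^ 2 v + G`, solved by Duhamel's formula; transforming back gives the solution.
All estimates are made for families of functions, so that uniformity in time comes for free, and
smoothness is expressed through chains of `(1/x) ∂ₓ`, for which the Leibniz rule and the rule `h_a'
= -ξ h_{a+2}` give immediate inductions.

Hankel inversion (`hankel_hankel`) and the kernel formula (`integral_kernelS_mul`) are obtained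
without regularising an oscillatory integral. The operators on both sides are symmetric for the
bilinear pairing `∫ f g dω_a`, and a continuous function orthogonal to all `exp (-n y ^ 2)`, `n ≥
1`, vanishes, by Weierstrass approximation in the variable `exp (-y ^ 2)`. So it is enough to check
both identities on Gaussians, whose transforms are explicit (`hankel_gauss`). The kernel factors as
a constant, a chirp in `x`, a dilated Hankel transform and a chirp in `y` (`kernelS_eq`), and on
Gaussians the matter comes down to an identity between principal powers (`kernel_const_eq`).

Existence (`isSolution_solution`) is differentiation under the integral sign. The curve is `C¹` in
`L²` because its second time derivative decays rapidly in `x`, locally uniformly in time.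

Uniqueness (`IsSolution.unique`) is a duality argument. If `w` is the difference of two solutions
and `Ψ` the free evolution of a test function `ψ`, then `⟨Ψ(t - τ), w(t)⟩` is constant in `t`; it
vanishes at `t = 0` and equals `⟨ψ, w(τ)⟩` at `t = τ`. Here `w` is only known to lie in `L²` with
its Bessel operator and to satisfy the Neumann condition, so Green's identity is needed on that
larger domain (`green_maximal`). -/

lemma omega_eq (a : ℝ) : omega a =
    (volume.restrict (Ioi 0)).withDensity (fun x => ENNReal.ofReal (x ^ a)) := rfl

lemma measurable_weight (a : ℝ) : Measurable (fun x : ℝ => ENNReal.ofReal (x ^ a)) := by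
  fun_prop

lemma omega_absolutelyContinuous (a : ℝ) : omega a ≪ volume.restrict (Ioi 0) :=
  withDensity_absolutelyContinuous _ _

instance sFinite_omega (a : ℝ) : SFinite (omega a) := by
  unfold omega; infer_instance

lemma ae_omega_pos (a : ℝ) : ∀ᵐ x ∂(omega a), 0 < x :=
  (omega_absolutelyContinuous a).ae_le (ae_restrict_mem measurableSet_Ioi)

lemma ae_omega_of_forall_pos (a : ℝ) {P : ℝ → Prop} (h : ∀ x, 0 < x → P x) :
    ∀ᵐ x ∂(omega a), P x := by
  filter_upwards [ae_omega_pos a] with x hx using h x hx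

lemma aestronglyMeasurable_omega {a : ℝ} {E : Type*} [NormedAddCommGroup E]
    [SecondCountableTopology E] {f : ℝ → E} (hf : ContinuousOn f (Ioi 0)) :
    AEStronglyMeasurable f (omega a) := by
  have : AEStronglyMeasurable f (volume.restrict (Ioi 0)) := by
    borelize E
    exact hf.aestronglyMeasurable measurableSet_Ioi
  exact this.mono_ac (omega_absolutelyContinuous a)

lemma integral_omega {E : Type*} [NormedAddCommGroup E] [NormedSpace ℝ E] (a : ℝ) (f : ℝ → E) :
    ∫ x, f x ∂(omega a) = ∫ x in Ioi 0, (x ^ a) • f x := by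
  rw [omega_eq, integral_withDensity_eq_integral_toReal_smul (measurable_weight a) (by simp)]
  refine setIntegral_congr_fun measurableSet_Ioi fun x hx => ?_
  simp only [ENNReal.toReal_ofReal (Real.rpow_nonneg (le_of_lt hx) a)]

lemma integrable_omega {E : Type*} [NormedAddCommGroup E] [NormedSpace ℝ E] {a : ℝ} {f : ℝ → E} :
    Integrable f (omega a) ↔ IntegrableOn (fun x => (x ^ a) • f x) (Ioi 0) := by
  rw [omega_eq, integrable_withDensity_iff_integrable_smul' (measurable_weight a) (by simp)]
  refine integrableOn_congr_fun (fun x hx => ?_) measurableSet_Ioi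
  simp only [ENNReal.toReal_ofReal (Real.rpow_nonneg (le_of_lt hx) a)]

lemma integral_omega_add_two (a : ℝ) (f : ℝ → ℂ) :
    ∫ x, f x ∂(omega (a + 2)) = ∫ x, ((x ^ 2 : ℝ) : ℂ) * f x ∂(omega a) := by
  rw [integral_omega, integral_omega]
  refine setIntegral_congr_fun measurableSet_Ioi fun x hx => ?_
  have hx : 0 < x := hx
  have : x ^ (a + 2) = x ^ a * x ^ 2 := by
    rw [Real.rpow_add hx]; norm_cast
  simp only [this, Complex.real_smul]
  push_cast; ring

/-- An exponent for which `(1 + x) ^ (-N)` is integrable against `ω_a`. -/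
def decayExp (a : ℝ) : ℕ := ⌈a⌉₊ + 2

lemma integrable_decay {a : ℝ} (ha : -1 < a) {N : ℕ} (hN : decayExp a ≤ N) :
    Integrable (fun x : ℝ => ((1 + x) ^ N)⁻¹) (omega a) := by
  rw [integrable_omega]
  have hNa : a + 2 ≤ N := by
    have h1 := Nat.le_ceil a
    have h2 : ((⌈a⌉₊ + 2 : ℕ) : ℝ) ≤ N := by exact_mod_cast hN
    push_cast at h2; linarith
  have hmeas : ∀ s ⊆ Ioi (0:ℝ), MeasurableSet s →
      AEStronglyMeasurable (fun x : ℝ => (x ^ a) • ((1 + x) ^ N)⁻¹) (volume.restrict s) := by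
    intro s _ _
    have : Measurable (fun x : ℝ => (x ^ a) • ((1 + x) ^ N)⁻¹) := by fun_prop
    exact this.aestronglyMeasurable
  rw [← Ioc_union_Ioi_eq_Ioi zero_le_one]
  refine IntegrableOn.union ?_ ?_
  · have h1 : IntegrableOn (fun x : ℝ => x ^ a) (Ioc 0 1) := by
      have := (intervalIntegral.intervalIntegrable_rpow' (a := 0) (b := 1) ha)
      rwa [intervalIntegrable_iff_integrableOn_Ioc_of_le zero_le_one] at this
    refine Integrable.mono' h1 (hmeas _ Ioc_subset_Ioi_self measurableSet_Ioc) ?_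
    filter_upwards [ae_restrict_mem measurableSet_Ioc] with x hx
    have hx0 : 0 < x := hx.1
    have : 0 ≤ x ^ a := Real.rpow_nonneg hx0.le a
    rw [smul_eq_mul, Real.norm_of_nonneg (by positivity)]
    have : ((1 + x) ^ N)⁻¹ ≤ 1 := inv_le_one_of_one_le₀ (one_le_pow₀ (by linarith))
    nlinarith
  · have h1 : IntegrableOn (fun x : ℝ => x ^ (-2 : ℝ)) (Ioi 1) :=
      integrableOn_Ioi_rpow_of_lt (by norm_num) one_pos
    refine Integrable.mono' h1 (hmeas _ (Ioi_subset_Ioi zero_le_one) measurableSet_Ioi) ?_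
    filter_upwards [ae_restrict_mem measurableSet_Ioi] with x hx
    have hx1 : 1 < x := hx
    have hx0 : 0 < x := by linarith
    have : 0 ≤ x ^ a := Real.rpow_nonneg hx0.le a
    rw [smul_eq_mul, Real.norm_of_nonneg (by positivity)]
    have h2 : ((1 + x) ^ N)⁻¹ ≤ (x ^ N)⁻¹ := by
      gcongr; linarith
    calc x ^ a * ((1 + x) ^ N)⁻¹ ≤ x ^ a * (x ^ N)⁻¹ := by gcongr
      _ = x ^ (a - N) := by rw [Real.rpow_sub hx0, Real.rpow_natCast]; rfl
      _ ≤ x ^ (-2 : ℝ) := Real.rpow_le_rpow_of_exponent_le hx1.le (by linarith)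

/-! ### The normalized Bessel function `z ^ (-ν) J_ν(z)`, `ν = (a - 1) / 2` -/

/-- Taylor coefficients of `z ^ (-ν) J_ν(z)` in `z ^ 2`. -/
def besselCoeff (a : ℝ) (k : ℕ) : ℝ :=
  (-1) ^ k * (1 / 4) ^ k / (k.factorial * Real.Gamma ((a + 1) / 2 + k)) * 2 ^ (-((a - 1) / 2))

/-- The entire function `z ^ (-ν) J_ν(z)`, `ν = (a - 1) / 2`. -/
def besselE (a z : ℝ) : ℝ := ∑' k : ℕ, besselCoeff a k * z ^ (2 * k)

/-- In `Γ(s + k + 1) = (s + k) Γ(s + k)` the factor is at least `1` as soon as `k ≥ 1`. Only the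
first step, with factor `s`, can decrease the value, so the minimum is taken at `k = 0` or `k = 1`.
-/
lemma exists_gamma_lower {s : ℝ} (hs : 0 < s) : ∃ δ > 0, ∀ k : ℕ, δ ≤ Real.Gamma (s + k) := by
  have hG := Real.Gamma_pos_of_pos hs
  refine ⟨min (Real.Gamma s) (s * Real.Gamma s), lt_min hG (mul_pos hs hG), fun k => ?_⟩
  induction k with
  | zero => simp
  | succ k ih =>
    have hpos : 0 < s + k := by positivity
    have : Real.Gamma (s + (k + 1 : ℕ)) = (s + k) * Real.Gamma (s + k) := by
      rw [← Real.Gamma_add_one hpos.ne']; push_cast; ring_nf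
    rw [this]
    rcases Nat.eq_zero_or_pos k with rfl | hk
    · simp
    · have h1 : (1 : ℝ) ≤ k := by exact_mod_cast hk
      have h2 := Real.Gamma_pos_of_pos hpos
      nlinarith

/-- This is Bessel's equation read on Taylor coefficients; `besselCoeff_add_two` is likewise the
rule `E_a' = -z E_{a+2}`, since `a + 2` corresponds to the order `ν + 1`. -/
lemma besselCoeff_succ {a : ℝ} (ha : -1 < a) (k : ℕ) :
    4 * (k + 1) * ((a + 1) / 2 + k) * besselCoeff a (k + 1) = -besselCoeff a k := by
  have hpos : 0 < (a + 1) / 2 + k := by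
    have : 0 < (a + 1) / 2 := by linarith
    positivity
  have hG : Real.Gamma ((a + 1) / 2 + (k + 1 : ℕ)) =
      ((a + 1) / 2 + k) * Real.Gamma ((a + 1) / 2 + k) := by
    rw [← Real.Gamma_add_one hpos.ne']; push_cast; ring_nf
  have h2 := (Real.Gamma_pos_of_pos hpos).ne'
  have h3 : (k.factorial : ℝ) ≠ 0 := by positivity
  unfold besselCoeff
  rw [hG, Nat.factorial_succ]
  push_cast
  have h4 : (k + 1 : ℝ) ≠ 0 := by positivity
  have h5 := hpos.ne'
  generalize Real.Gamma ((a + 1) / 2 + k) = G at *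
  generalize (a + 1) / 2 + (k : ℝ) = s at *
  field_simp
  ring

lemma besselCoeff_add_two {a : ℝ} (ha : -1 < a) (k : ℕ) :
    besselCoeff (a + 2) k = -(2 * (k + 1) * besselCoeff a (k + 1)) := by
  have hpos : 0 < (a + 1) / 2 + k + 1 := by
    have : 0 < (a + 1) / 2 := by linarith
    positivity
  have h2 := (Real.Gamma_pos_of_pos hpos).ne'
  have h3 : (k.factorial : ℝ) ≠ 0 := by positivity
  have h4 : (k + 1 : ℝ) ≠ 0 := by positivity
  unfold besselCoeff
  have e1 : (a + 2 + 1) / 2 + (k : ℝ) = (a + 1) / 2 + k + 1 := by ring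
  have e2 : (a + 1) / 2 + ((k + 1 : ℕ) : ℝ) = (a + 1) / 2 + k + 1 := by push_cast; ring
  have e3 : -((a + 2 - 1) / 2) = -((a - 1) / 2) - 1 := by ring
  rw [e1, e2, e3, Real.rpow_sub two_pos, Real.rpow_one, Nat.factorial_succ]
  push_cast
  field_simp
  ring

lemma exists_besselCoeff_bound {a : ℝ} (ha : -1 < a) :
    ∃ C > 0, ∀ k, |besselCoeff a k| ≤ C / k.factorial := by
  obtain ⟨δ, hδ, h⟩ := exists_gamma_lower (s := (a + 1) / 2) (by linarith)
  have h2 : (0:ℝ) < 2 ^ (-((a - 1) / 2)) := by positivity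
  refine ⟨2 ^ (-((a - 1) / 2)) / δ, by positivity, fun k => ?_⟩
  have hk := h k
  have hG : 0 < Real.Gamma ((a + 1) / 2 + k) := by linarith
  have h4 : ((1:ℝ) / 4) ^ k ≤ 1 := pow_le_one₀ (by norm_num) (by norm_num)
  have h3 : (0:ℝ) < k.factorial := by positivity
  unfold besselCoeff
  rw [abs_mul, abs_div, abs_mul, abs_pow, abs_neg, abs_one, one_pow, one_mul,
    abs_of_pos h2, abs_of_pos (mul_pos h3 hG), abs_of_pos (by positivity)]
  rw [div_mul_eq_mul_div, div_div]
  calc _ ≤ 1 * (2:ℝ) ^ (-((a - 1) / 2)) / (k.factorial * Real.Gamma ((a + 1) / 2 + k)) := by gcongr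
    _ ≤ 1 * (2:ℝ) ^ (-((a - 1) / 2)) / (k.factorial * δ) := by gcongr
    _ = _ := by rw [one_mul, mul_comm δ]

lemma summable_besselE {a : ℝ} (ha : -1 < a) (z : ℝ) :
    Summable (fun k => besselCoeff a k * z ^ (2 * k)) := by
  obtain ⟨C, hC, h⟩ := exists_besselCoeff_bound ha
  refine Summable.of_norm_bounded (g := fun k => C * ((z ^ 2) ^ k / k.factorial))
    ((Real.summable_pow_div_factorial _).mul_left C) fun k => ?_
  rw [norm_mul, Real.norm_eq_abs, pow_mul, Real.norm_of_nonneg (by positivity : 0 ≤ (z ^ 2) ^ k)]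
  calc _ ≤ C / k.factorial * (z ^ 2) ^ k := by gcongr; exact h k
    _ = _ := by ring

lemma hasDerivAt_besselE {a : ℝ} (ha : -1 < a) (z : ℝ) :
    HasDerivAt (besselE a) (-z * besselE (a + 2) z) z := by
  obtain ⟨C, hC, h⟩ := exists_besselCoeff_bound ha
  set R : ℝ := |z| + 1 with hR
  have hR1 : 1 ≤ R := by simp [hR]
  have hsum : Summable (fun k : ℕ => C * 2 * ((2 * R ^ 2) ^ k / k.factorial)) :=
    (Real.summable_pow_div_factorial _).mul_left _
  have key := hasDerivAt_tsum_of_isPreconnected (𝕜 := ℝ) (F := ℝ)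
    (g := fun k z => besselCoeff a k * z ^ (2 * k))
    (g' := fun k z => besselCoeff a k * ((2 * k : ℕ) * z ^ (2 * k - 1))) (t := Metric.ball 0 R)
    (y₀ := z) (y := z) hsum Metric.isOpen_ball (convex_ball 0 R).isPreconnected
    (fun k y _ => by simpa using (hasDerivAt_pow (2 * k) y).const_mul (besselCoeff a k))
    (fun k y hy => by
      have hy : |y| ≤ R := by simpa using (Metric.mem_ball.1 hy).le
      rw [norm_mul, norm_mul, norm_pow, Real.norm_eq_abs, Real.norm_eq_abs, Real.norm_eq_abs]
      have h1 : |y| ^ (2 * k - 1) ≤ R ^ (2 * k) :=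
        (pow_le_pow_left₀ (abs_nonneg y) hy _).trans (pow_le_pow_right₀ hR1 (by omega))
      -- The factor `2 k` produced by differentiation is absorbed into a geometric one, which leaves
      -- an exponential series in `2 R ^ 2`.
      have h2 : |((2 * k : ℕ) : ℝ)| ≤ 2 * 2 ^ k := by
        rw [abs_of_nonneg (by positivity)]
        have : k < 2 ^ k := Nat.lt_two_pow_self
        have : (k : ℝ) ≤ 2 ^ k := by exact_mod_cast this.le
        push_cast; linarith
      calc _ ≤ C / k.factorial * ((2 * 2 ^ k) * R ^ (2 * k)) := by
            gcongr; exact h k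
        _ = _ := by rw [mul_pow, pow_mul]; ring)
    (by simp [hR]) (summable_besselE ha z) (by simp [hR])
  have hval : (∑' k : ℕ, besselCoeff a k * ((2 * k : ℕ) * z ^ (2 * k - 1))) =
      -z * besselE (a + 2) z := by
    have hs : Summable (fun k : ℕ => besselCoeff a k * ((2 * k : ℕ) * z ^ (2 * k - 1))) := by
      rw [← summable_nat_add_iff 1]
      have := (summable_besselE (a := a + 2) (by linarith) z).mul_left (-z)
      refine this.congr fun k => ?_
      rw [besselCoeff_add_two ha]
      have : 2 * (k + 1) - 1 = 2 * k + 1 := by omega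
      rw [this]; push_cast; ring
    rw [hs.tsum_eq_zero_add, besselE, ← tsum_mul_left]
    simp only [Nat.cast_zero, mul_zero, zero_mul, zero_add, Nat.cast_mul]
    refine tsum_congr fun k => ?_
    rw [besselCoeff_add_two ha]
    have : 2 * (k + 1) - 1 = 2 * k + 1 := by omega
    rw [this]; push_cast; ring
  rw [← hval]
  exact key

lemma continuous_besselE {a : ℝ} (ha : -1 < a) : Continuous (besselE a) :=
  continuous_iff_continuousAt.2 fun z => (hasDerivAt_besselE ha z).continuousAt

lemma besselE_recurrence {a : ℝ} (ha : -1 < a) (z : ℝ) :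
    besselE a z = (1 + a) * besselE (a + 2) z - z ^ 2 * besselE (a + 2 + 2) z := by
  have h1 := (summable_besselE (a := a + 2) (by linarith) z)
  have h2 := (summable_besselE (a := a + 2 + 2) (by linarith) z)
  have h3 : Summable (fun k => (besselCoeff a k - (1 + a) * besselCoeff (a + 2) k) * z ^ (2 * k)) :=
    ((summable_besselE ha z).sub (h1.mul_left (1 + a))).congr fun k => by ring
  have e : ∑' k, (besselCoeff a k - (1 + a) * besselCoeff (a + 2) k) * z ^ (2 * k) =
      -(z ^ 2 * besselE (a + 2 + 2) z) := by
    rw [h3.tsum_eq_zero_add, besselE, ← tsum_mul_left, ← tsum_neg]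
    have h0 : besselCoeff a 0 - (1 + a) * besselCoeff (a + 2) 0 = 0 := by
      have := besselCoeff_succ ha 0
      rw [besselCoeff_add_two ha]; push_cast at *; linarith
    rw [h0, zero_mul, zero_add]
    refine tsum_congr fun k => ?_
    have r1 := besselCoeff_add_two (a := a + 2) (by linarith) k
    have r2 := besselCoeff_add_two ha (k + 1)
    have r3 := besselCoeff_succ ha (k + 1)
    rw [r1, r2]
    push_cast at *
    have : besselCoeff a (k + 1) =
      -(4 * ((k:ℝ) + 1 + 1) * ((a + 1) / 2 + (k + 1)) * besselCoeff a (k + 1 + 1)) := by linarith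
    rw [this]; ring
  have e' : ∑' k, (besselCoeff a k - (1 + a) * besselCoeff (a + 2) k) * z ^ (2 * k) =
      besselE a z - (1 + a) * besselE (a + 2) z := by
    rw [besselE, besselE, ← tsum_mul_left, ← (summable_besselE ha z).tsum_sub (h1.mul_left (1 + a))]
    exact tsum_congr fun k => by ring
  linarith

lemma besselE_neg (a z : ℝ) : besselE a (-z) = besselE a z := by
  simp [besselE, pow_mul]

/-- Energy method: since `E_a' = -z E_{a+2}`, the quantity `E_a ^ 2 + (z E_{a+2}) ^ 2` is `E_a ^ 2 +
E_a' ^ 2`. Bessel's equation makes it nonincreasing on `[0, ∞)` when the damping coefficient `a` is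
nonnegative, and at `0` it equals `E_a(0) ^ 2`. -/
lemma abs_besselE_le_of_nonneg {a : ℝ} (ha : 0 ≤ a) {z : ℝ} (hz : 0 ≤ z) :
    |besselE a z| ≤ |besselE a 0| := by
  have h0 : -1 < a := by linarith
  have h2 : -1 < a + 2 := by linarith
  have hd : ∀ z, HasDerivAt (fun z => besselE a z ^ 2 + (z * besselE (a + 2) z) ^ 2)
      (-(2 * a * z * besselE (a + 2) z ^ 2)) z := fun z => by
    have h := ((hasDerivAt_besselE h0 z).pow 2).add
      (((hasDerivAt_id z).mul (hasDerivAt_besselE h2 z)).pow 2)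
    refine h.congr_deriv ?_
    have := besselE_recurrence h0 z
    simp only [id, Pi.mul_apply]
    rw [this]; ring
  have hanti : AntitoneOn (fun z => besselE a z ^ 2 + (z * besselE (a + 2) z) ^ 2) (Ici 0) := by
    refine antitoneOn_of_deriv_nonpos (convex_Ici 0)
      (fun z _ => (hd z).continuousAt.continuousWithinAt)
      (fun z _ => (hd z).differentiableAt.differentiableWithinAt) fun z hz => ?_
    rw [(hd z).deriv]
    have : 0 ≤ z := by simpa using interior_subset hz
    have : 0 ≤ 2 * a * z * besselE (a + 2) z ^ 2 := by positivity
    linarith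
  have := hanti (mem_Ici.2 le_rfl) (mem_Ici.2 hz) hz
  simp only [zero_mul] at this
  rw [← sq_le_sq]
  nlinarith [sq_nonneg (z * besselE (a + 2) z)]

/-- For `-1 < a < 0` the energy argument is not available. The recurrence replaces `E_a` by
functions of parameters `a + 2` and `a + 4`, both nonnegative, at the price of a factor `z ^ 2`. -/
lemma exists_besselE_bound {a : ℝ} (ha : -1 < a) :
    ∃ C > 0, ∀ z, |besselE a z| ≤ C * (1 + |z|) ^ 2 := by
  have key : ∀ b : ℝ, 0 ≤ b → ∀ z, |besselE b z| ≤ |besselE b 0| := fun b hb z => by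
    rcases le_total 0 z with h | h
    · exact abs_besselE_le_of_nonneg hb h
    · rw [← besselE_neg]; exact abs_besselE_le_of_nonneg hb (by linarith)
  refine ⟨|1 + a| * |besselE (a + 2) 0| + |besselE (a + 2 + 2) 0| + 1, by positivity, fun z => ?_⟩
  have hz := abs_nonneg z
  rw [besselE_recurrence ha z]
  calc _ ≤ |1 + a| * |besselE (a + 2) z| + |z| ^ 2 * |besselE (a + 2 + 2) z| := by
        refine (abs_sub _ _).trans ?_
        rw [abs_mul, abs_mul, abs_pow]
    _ ≤ |1 + a| * |besselE (a + 2) 0| * (1 + |z|) ^ 2 +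
        (1 + |z|) ^ 2 * |besselE (a + 2 + 2) 0| := by
        have h1 := key (a + 2) (by linarith) z
        have h2 := key (a + 2 + 2) (by linarith) z
        have h3 : 1 ≤ (1 + |z|) ^ 2 := one_le_pow₀ (by linarith)
        have h4 : |z| ^ 2 ≤ (1 + |z|) ^ 2 := by gcongr; linarith
        have h5 : |1 + a| * |besselE (a + 2) z| ≤ |1 + a| * |besselE (a + 2) 0| * (1 + |z|) ^ 2 := by
          calc _ ≤ |1 + a| * |besselE (a + 2) 0| * 1 := by rw [mul_one]; gcongr
            _ ≤ _ := by gcongr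
        gcongr
    _ ≤ _ := by nlinarith [sq_nonneg (1 + |z|)]

lemma rpow_mul_besselJ {a z : ℝ} (hz : 0 < z) :
    z ^ ((1 - a) / 2) * besselJ ((a - 1) / 2) z = besselE a z := by
  rw [besselJ, besselE, ← tsum_mul_left]
  refine tsum_congr fun k => ?_
  have e1 : (a - 1) / 2 + (k:ℝ) + 1 = (a + 1) / 2 + k := by ring
  have e2 : (z / 2) ^ (2 * (k:ℝ) + (a - 1) / 2) =
      z ^ (2 * k) * (1 / 4) ^ k * z ^ ((a - 1) / 2) * 2 ^ (-((a - 1) / 2)) := by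
    have h2 : (0:ℝ) < z / 2 := by positivity
    rw [Real.rpow_add h2, Real.div_rpow hz.le two_pos.le ((a - 1) / 2), Real.rpow_neg two_pos.le]
    have : (z / 2) ^ (2 * (k:ℝ)) = z ^ (2 * k) * (1 / 4) ^ k := by
      rw [show (2 * (k:ℝ)) = ((2 * k : ℕ) : ℝ) by push_cast; ring, Real.rpow_natCast, pow_mul,
        pow_mul, ← mul_pow]
      congr 1; ring
    rw [this]; ring
  have e3 : z ^ ((1 - a) / 2) * z ^ ((a - 1) / 2) = 1 := by
    rw [← Real.rpow_add hz]; ring_nf; simp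
  rw [e1, e2, Real.Gamma_nat_eq_factorial, besselCoeff]
  calc _ = (z ^ ((1 - a) / 2) * z ^ ((a - 1) / 2)) * ((-1) ^ k * (1 / 4) ^ k /
      (k.factorial * Real.Gamma ((a + 1) / 2 + k)) * 2 ^ (-((a - 1) / 2)) * z ^ (2 * k)) := by ring
    _ = _ := by rw [e3, one_mul]

/-! ### Families of rapidly decreasing functions -/

variable {ι : Type*}

/-- Polynomial growth on the half-line, uniformly over a family. -/
def PolyBdd (φ : ι → ℝ → ℂ) : Prop :=
  ∃ (N : ℕ) (C : ℝ), ∀ i x, 0 < x → ‖φ i x‖ ≤ C * (1 + x) ^ N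

/-- Rapid decay on the half-line, uniformly over a family. -/
def RapidDecay (φ : ι → ℝ → ℂ) : Prop :=
  ∀ m : ℕ, ∃ C : ℝ, ∀ i x, 0 < x → (1 + x) ^ m * ‖φ i x‖ ≤ C

/-- `φ`, `(1/x) ∂ₓ φ`, …, `((1/x) ∂ₓ) ^ n φ` exist, are continuous on the half-line and satisfy
`P`. -/
def Chain (P : (ι → ℝ → ℂ) → Prop) : ℕ → (ι → ℝ → ℂ) → Prop
  | 0, φ => P φ ∧ ∀ i, ContinuousOn (φ i) (Ioi 0)
  | n + 1, φ => P φ ∧ ∃ ψ : ι → ℝ → ℂ, Chain P n ψ ∧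
      ∀ (i : ι) (x : ℝ), 0 < x → HasDerivAt (φ i) ((x : ℂ) * ψ i x) x

/-- A family of functions of the class `𝒮⁺` with uniform bounds. -/
def SchwartzFamily (φ : ι → ℝ → ℂ) : Prop := ∀ n, Chain RapidDecay n φ

lemma Chain.prop {P : (ι → ℝ → ℂ) → Prop} {n : ℕ} {φ : ι → ℝ → ℂ} (h : Chain P n φ) : P φ := by
  cases n <;> exact h.1

lemma Chain.continuousOn {P : (ι → ℝ → ℂ) → Prop} {n : ℕ} {φ : ι → ℝ → ℂ} (h : Chain P n φ)
    (i : ι) : ContinuousOn (φ i) (Ioi 0) := by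
  cases n with
  | zero => exact h.2 i
  | succ n =>
    obtain ⟨-, ψ, -, hd⟩ := h
    exact fun x hx => (hd i x hx).continuousAt.continuousWithinAt

lemma Chain.of_succ {P : (ι → ℝ → ℂ) → Prop} {n : ℕ} {φ : ι → ℝ → ℂ} (h : Chain P (n + 1) φ) :
    Chain P n φ := by
  induction n generalizing φ with
  | zero => exact ⟨h.prop, h.continuousOn⟩
  | succ n ih =>
    obtain ⟨h1, ψ, h2, hd⟩ := h
    exact ⟨h1, ψ, ih h2, hd⟩

lemma RapidDecay.exists_bound {φ : ι → ℝ → ℂ} (h : RapidDecay φ) (m : ℕ) :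
    ∃ C, 0 ≤ C ∧ ∀ i x, 0 < x → ‖φ i x‖ ≤ C * ((1 + x) ^ m)⁻¹ := by
  obtain ⟨C, hC⟩ := h m
  refine ⟨|C|, abs_nonneg C, fun i x hx => ?_⟩
  rw [← div_eq_mul_inv, le_div_iff₀ (by positivity), mul_comm]
  exact (hC i x hx).trans (le_abs_self C)

lemma RapidDecay.of_bound {φ : ι → ℝ → ℂ}
    (h : ∀ m : ℕ, ∃ C, ∀ i x, 0 < x → ‖φ i x‖ ≤ C * ((1 + x) ^ m)⁻¹) : RapidDecay φ := by
  intro m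
  obtain ⟨C, hC⟩ := h m
  refine ⟨C, fun i x hx => ?_⟩
  have := hC i x hx
  rwa [← div_eq_mul_inv, le_div_iff₀ (by positivity), mul_comm] at this

lemma RapidDecay.add {φ ψ : ι → ℝ → ℂ} (h : RapidDecay φ) (h' : RapidDecay ψ) :
    RapidDecay (fun i x => φ i x + ψ i x) := by
  intro m
  obtain ⟨C, hC⟩ := h m
  obtain ⟨C', hC'⟩ := h' m
  refine ⟨C + C', fun i x hx => ?_⟩
  calc _ ≤ (1 + x) ^ m * (‖φ i x‖ + ‖ψ i x‖) := by gcongr; exact norm_add_le _ _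
    _ ≤ _ := by rw [mul_add]; exact add_le_add (hC i x hx) (hC' i x hx)

lemma RapidDecay.mul {φ ψ : ι → ℝ → ℂ} (h : RapidDecay φ) (h' : PolyBdd ψ) :
    RapidDecay (fun i x => φ i x * ψ i x) := by
  intro m
  obtain ⟨N, C', hC'⟩ := h'
  obtain ⟨C, hC⟩ := h (m + N)
  refine ⟨C * |C'|, fun i x hx => ?_⟩
  have h1 := hC' i x hx
  rw [norm_mul]
  calc _ ≤ (1 + x) ^ m * (‖φ i x‖ * (|C'| * (1 + x) ^ N)) := by
        gcongr; exact h1.trans (by gcongr; exact le_abs_self C')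
    _ = ((1 + x) ^ (m + N) * ‖φ i x‖) * |C'| := by rw [pow_add]; ring
    _ ≤ _ := by gcongr; exact hC i x hx

lemma RapidDecay.polyBdd {φ : ι → ℝ → ℂ} (h : RapidDecay φ) : PolyBdd φ := by
  obtain ⟨C, hC⟩ := h 0
  exact ⟨0, C, fun i x hx => by simpa using hC i x hx⟩

lemma RapidDecay.comp {κ : Type*} {φ : ι → ℝ → ℂ} (h : RapidDecay φ) (r : κ → ι) :
    RapidDecay (fun k => φ (r k)) := fun m => by
  obtain ⟨C, hC⟩ := h m
  exact ⟨C, fun k => hC (r k)⟩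

lemma Chain.comp {κ : Type*} {n : ℕ} {φ : ι → ℝ → ℂ} (h : Chain RapidDecay n φ) (r : κ → ι) :
    Chain RapidDecay n (fun k => φ (r k)) := by
  induction n generalizing φ with
  | zero => exact ⟨h.1.comp r, fun k => h.2 (r k)⟩
  | succ n ih =>
    obtain ⟨h1, ψ, h2, hd⟩ := h
    exact ⟨h1.comp r, fun k => ψ (r k), ih h2, fun k => hd (r k)⟩

lemma Chain.add {n : ℕ} {φ ψ : ι → ℝ → ℂ} (h : Chain RapidDecay n φ) (h' : Chain RapidDecay n ψ) :
    Chain RapidDecay n (fun i x => φ i x + ψ i x) := by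
  induction n generalizing φ ψ with
  | zero => exact ⟨h.1.add h'.1, fun i => (h.2 i).add (h'.2 i)⟩
  | succ n ih =>
    obtain ⟨h1, φ', h2, hd⟩ := h
    obtain ⟨h1', ψ', h2', hd'⟩ := h'
    refine ⟨h1.add h1', _, ih h2 h2', fun i x hx => ?_⟩
    exact ((hd i x hx).add (hd' i x hx)).congr_deriv (by ring)

/-- `(1/x) ∂ₓ` is a derivation, so the Leibniz rule splits each level into two products. Polynomial
growth of one factor does not spoil the decay of the other. -/
lemma Chain.mul {n : ℕ} {φ ψ : ι → ℝ → ℂ} (h : Chain RapidDecay n φ) (h' : Chain PolyBdd n ψ) :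
    Chain RapidDecay n (fun i x => φ i x * ψ i x) := by
  induction n generalizing φ ψ with
  | zero => exact ⟨h.1.mul h'.1, fun i => (h.2 i).mul (h'.2 i)⟩
  | succ n ih =>
    have hc := h.of_succ
    have hc' := h'.of_succ
    obtain ⟨h1, φ', h2, hd⟩ := h
    obtain ⟨h1', ψ', h2', hd'⟩ := h'
    refine ⟨h1.mul h1', _, (ih h2 hc').add (ih hc h2'), fun i x hx => ?_⟩
    exact ((hd i x hx).mul (hd' i x hx)).congr_deriv (by ring)

/-- `(1/x) ∂ₓ` only multiplies the exponential by the constant `2 c`, so letting the prefactor `k`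
vary closes the induction. The case `c = 0` covers constants, imaginary `c` covers the phases of the
evolution. -/
lemma chain_exp {c k : ι → ℂ} {M K : ℝ} (hc : ∀ i, ‖c i‖ ≤ M) (hre : ∀ i, (c i).re ≤ 0)
    (hk : ∀ i, ‖k i‖ ≤ K) (n : ℕ) :
    Chain PolyBdd n (fun i (x : ℝ) => k i * Complex.exp (c i * (x : ℂ) ^ 2)) := by
  have hP : ∀ (k : ι → ℂ) (K : ℝ), (∀ i, ‖k i‖ ≤ K) →
      PolyBdd (fun i (x : ℝ) => k i * Complex.exp (c i * (x : ℂ) ^ 2)) := fun k K hk => by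
    refine ⟨0, K, fun i x hx => ?_⟩
    rw [norm_mul, Complex.norm_exp, pow_zero, mul_one]
    have h1 : (c i * (x : ℂ) ^ 2).re ≤ 0 := by
      rw [← Complex.ofReal_pow, Complex.re_mul_ofReal]
      exact mul_nonpos_of_nonpos_of_nonneg (hre i) (by positivity)
    calc _ ≤ ‖k i‖ * 1 := by gcongr; exact Real.exp_le_one_iff.2 h1
      _ ≤ K := by rw [mul_one]; exact hk i
  induction n generalizing k K with
  | zero =>
    exact ⟨hP k K hk, fun i => by fun_prop⟩
  | succ n ih =>
    refine ⟨hP k K hk, _, ih (k := fun i => k i * (2 * c i)) (K := K * (2 * M)) (fun i => ?_),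
      fun i x hx => ?_⟩
    · rw [norm_mul, norm_mul, Complex.norm_ofNat]
      have := hc i; have := hk i; have := (norm_nonneg _).trans (hk i)
      gcongr
    · have h1 : HasDerivAt (fun x : ℝ => (x : ℂ)) 1 x := Complex.ofRealCLM.hasDerivAt
      have h2 := (((h1.pow 2).const_mul (c i)).cexp).const_mul (k i)
      exact h2.congr_deriv (by simp; ring)

lemma chain_sq (n : ℕ) : Chain PolyBdd n (fun (_ : ι) (x : ℝ) => ((x ^ 2 : ℝ) : ℂ)) := by
  have hP : PolyBdd (fun (_ : ι) (x : ℝ) => ((x ^ 2 : ℝ) : ℂ)) :=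
    ⟨2, 1, fun i x hx => by
      rw [Complex.norm_real, Real.norm_of_nonneg (by positivity), one_mul]
      gcongr; linarith⟩
  cases n with
  | zero => exact ⟨hP, fun i => by fun_prop⟩
  | succ n =>
    refine ⟨hP, _, chain_exp (c := fun _ => 0) (k := fun _ => 2) (M := 0) (K := 2) (by simp)
      (by simp) (by simp) n, fun i x hx => ?_⟩
    have h2 : HasDerivAt (fun x : ℝ => x ^ 2) (2 * x) x := by simpa using hasDerivAt_pow 2 x
    refine h2.ofReal_comp.congr_deriv ?_
    simp; ring

lemma Chain.const_mul {n : ℕ} {φ : ι → ℝ → ℂ} (h : Chain RapidDecay n φ) (c : ℂ) :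
    Chain RapidDecay n (fun i x => c * φ i x) := by
  have := h.mul (chain_exp (ι := ι) (c := fun _ => 0) (k := fun _ => c) (M := 0) (K := ‖c‖)
    (by simp) (by simp) (by simp) n)
  simpa [mul_comm] using this

lemma Chain.sq_mul {n : ℕ} {φ : ι → ℝ → ℂ} (h : Chain RapidDecay n φ) :
    Chain RapidDecay n (fun i x => ((x ^ 2 : ℝ) : ℂ) * φ i x) := by
  simpa only [mul_comm] using h.mul (chain_sq n)

lemma RapidDecay.integrable {a : ℝ} (ha : -1 < a) {φ : ι → ℝ → ℂ} (h : RapidDecay φ) (i : ι)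
    (hc : ContinuousOn (φ i) (Ioi 0)) : Integrable (φ i) (omega a) := by
  obtain ⟨C, -, hC⟩ := h.exists_bound (decayExp a)
  exact Integrable.mono' ((integrable_decay ha le_rfl).const_mul C) (aestronglyMeasurable_omega hc)
    (ae_omega_of_forall_pos a fun x hx => hC i x hx)

lemma RapidDecay.tendsto_zero {a : ℝ} (ha : -1 < a) {k : ℝ → ℂ}
    (h : RapidDecay (fun _ : Unit => k)) :
    Tendsto (fun x : ℝ => ((x ^ (a + 1) : ℝ) : ℂ) * k x) (𝓝[>] 0) (𝓝 0) := by
  obtain ⟨C, hC0, hC⟩ := h.exists_bound 0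
  have h1 : Tendsto (fun x : ℝ => C * x ^ (a + 1)) (𝓝[>] 0) (𝓝 0) := by
    have : ContinuousAt (fun x : ℝ => C * x ^ (a + 1)) 0 := by
      have : ContinuousAt (fun x : ℝ => x ^ (a + 1)) 0 :=
        Real.continuousAt_rpow_const 0 (a + 1) (Or.inr (by linarith))
      fun_prop
    have h2 := this.tendsto
    rw [Real.zero_rpow (by linarith), mul_zero] at h2
    exact h2.mono_left nhdsWithin_le_nhds
  refine squeeze_zero_norm' ?_ h1
  filter_upwards [self_mem_nhdsWithin] with x hx
  have hx : 0 < x := hx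
  have := hC () x hx
  rw [norm_mul, Complex.norm_real, Real.norm_of_nonneg (Real.rpow_nonneg hx.le _), mul_comm]
  simp only [pow_zero, inv_one, mul_one] at this
  gcongr

lemma RapidDecay.tendsto_atTop {a : ℝ} (ha : 0 ≤ a) {k : ℝ → ℂ}
    (h : RapidDecay (fun _ : Unit => k)) :
    Tendsto (fun x : ℝ => ((x ^ a : ℝ) : ℂ) * k x) atTop (𝓝 0) := by
  obtain ⟨C, hC0, hC⟩ := h.exists_bound (⌈a⌉₊ + 1)
  have h1 : Tendsto (fun x : ℝ => C * (1 + x)⁻¹) atTop (𝓝 0) := by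
    have : Tendsto (fun x : ℝ => (1 + x)⁻¹) atTop (𝓝 0) :=
      tendsto_inv_atTop_zero.comp (tendsto_atTop_add_const_left _ 1 tendsto_id)
    simpa using this.const_mul C
  refine squeeze_zero_norm' ?_ h1
  filter_upwards [eventually_gt_atTop 0] with x hx
  rw [norm_mul, Complex.norm_real, Real.norm_of_nonneg (Real.rpow_nonneg hx.le _)]
  have h2 : x ^ a ≤ (1 + x) ^ ⌈a⌉₊ :=
    calc x ^ a ≤ (1 + x) ^ a := Real.rpow_le_rpow hx.le (by linarith) ha
      _ ≤ (1 + x) ^ (⌈a⌉₊ : ℝ) := Real.rpow_le_rpow_of_exponent_le (by linarith) (Nat.le_ceil a)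
      _ = _ := Real.rpow_natCast _ _
  calc _ ≤ (1 + x) ^ ⌈a⌉₊ * (C * ((1 + x) ^ (⌈a⌉₊ + 1))⁻¹) := by gcongr; exact hC () x hx
    _ = _ := by rw [pow_succ]; field_simp

/-! ### Green's identity for the Bessel operator -/

/-- The difference of the two integrands, weighted by `x ^ a`, is the derivative of `x ^ a` times
the Wronskian, whose limits at both ends are assumed to vanish. -/
lemma green {a : ℝ} {w w₁ w₂ ψ ψ₁ ψ₂ : ℝ → ℂ}
    (hw : ∀ x, 0 < x → HasDerivAt w (w₁ x) x) (hw₁ : ∀ x, 0 < x → HasDerivAt w₁ (w₂ x) x)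
    (hψ : ∀ x, 0 < x → HasDerivAt ψ (ψ₁ x) x) (hψ₁ : ∀ x, 0 < x → HasDerivAt ψ₁ (ψ₂ x) x)
    (hi : Integrable (fun x => (w₂ x + ((a / x : ℝ) : ℂ) * w₁ x) * ψ x) (omega a))
    (hi' : Integrable (fun x => w x * (ψ₂ x + ((a / x : ℝ) : ℂ) * ψ₁ x)) (omega a))
    (h0 : Tendsto (fun x : ℝ => ((x ^ a : ℝ) : ℂ) * (w₁ x * ψ x - w x * ψ₁ x)) (𝓝[>] 0) (𝓝 0))
    (hinf : Tendsto (fun x : ℝ => ((x ^ a : ℝ) : ℂ) * (w₁ x * ψ x - w x * ψ₁ x)) atTop (𝓝 0)) :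
    ∫ x, (w₂ x + ((a / x : ℝ) : ℂ) * w₁ x) * ψ x ∂(omega a) =
      ∫ x, w x * (ψ₂ x + ((a / x : ℝ) : ℂ) * ψ₁ x) ∂(omega a) := by
  rw [← sub_eq_zero, ← integral_sub hi hi', integral_omega]
  have hi2 := integrable_omega.1 (hi.sub hi')
  have hd : ∀ x ∈ Ioi (0:ℝ), HasDerivAt
      (fun x : ℝ => ((x ^ a : ℝ) : ℂ) * (w₁ x * ψ x - w x * ψ₁ x))
      ((x ^ a) • ((w₂ x + ((a / x : ℝ) : ℂ) * w₁ x) * ψ x -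
        w x * (ψ₂ x + ((a / x : ℝ) : ℂ) * ψ₁ x))) x := fun x hx => by
    have hx : 0 < x := hx
    have h1 := (Real.hasDerivAt_rpow_const (x := x) (p := a) (Or.inl hx.ne')).ofReal_comp
    have h2 := h1.mul (((hw₁ x hx).mul (hψ x hx)).sub ((hw x hx).mul (hψ₁ x hx)))
    refine h2.congr_deriv ?_
    have : x ^ (a - 1) = x ^ a / x := by rw [Real.rpow_sub hx, Real.rpow_one]
    rw [this, Complex.real_smul]
    have hx' : (x : ℂ) ≠ 0 := by exact_mod_cast hx.ne'
    simp only [Pi.mul_apply, Pi.sub_apply]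
    push_cast
    field_simp
    ring
  -- Integration by parts against the constant `1` serves as the fundamental theorem of calculus on
  -- `(0, ∞)`.
  have key := integral_Ioi_mul_deriv_eq_deriv_mul (a := (0:ℝ)) (A := ℂ) (u := fun _ => 1)
    (u' := fun _ => 0) (a' := 0) (b' := 0) (fun x _ => hasDerivAt_const x 1) hd
    (by simpa [Pi.mul_def] using hi2) (by simp [Pi.mul_def]) (by simpa [Pi.mul_def] using h0)
    (by simpa [Pi.mul_def] using hinf)
  simpa using key

/-- With `f' = x f₁` and `f₁' = x f₂` the Bessel operator becomes `x ^ 2 f₂ + (1 + a) f₁`, free of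
the singular coefficient `a / x`. The boundary term is `x ^ (a + 1) (f₁ g - f g₁)`: it vanishes at
`0` because `a + 1 > 0` and at infinity by rapid decay. -/
lemma green_rapidDecay {a : ℝ} (ha : -1 < a) {f f₁ f₂ g g₁ g₂ : ℝ → ℂ}
    (hf : ∀ x : ℝ, 0 < x → HasDerivAt f (x * f₁ x) x)
    (hf₁ : ∀ x : ℝ, 0 < x → HasDerivAt f₁ (x * f₂ x) x)
    (hg : ∀ x : ℝ, 0 < x → HasDerivAt g (x * g₁ x) x)
    (hg₁ : ∀ x : ℝ, 0 < x → HasDerivAt g₁ (x * g₂ x) x)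
    (hfd : RapidDecay fun _ : Unit => f) (hfd₁ : RapidDecay fun _ : Unit => f₁)
    (hfd₂ : RapidDecay fun _ : Unit => f₂) (hfc : ContinuousOn f₂ (Ioi 0))
    (hgd : PolyBdd fun _ : Unit => g) (hgd₁ : PolyBdd fun _ : Unit => g₁)
    (hgd₂ : PolyBdd fun _ : Unit => g₂) (hgc : ContinuousOn g₂ (Ioi 0)) :
    ∫ x : ℝ, (((x ^ 2 : ℝ) : ℂ) * f₂ x + (1 + a) * f₁ x) * g x ∂(omega a) =
      ∫ x : ℝ, f x * (((x ^ 2 : ℝ) : ℂ) * g₂ x + (1 + a) * g₁ x) ∂(omega a) := by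
  have cf : ContinuousOn f (Ioi 0) := fun x hx => (hf x hx).continuousAt.continuousWithinAt
  have cf₁ : ContinuousOn f₁ (Ioi 0) := fun x hx => (hf₁ x hx).continuousAt.continuousWithinAt
  have cg : ContinuousOn g (Ioi 0) := fun x hx => (hg x hx).continuousAt.continuousWithinAt
  have cg₁ : ContinuousOn g₁ (Ioi 0) := fun x hx => (hg₁ x hx).continuousAt.continuousWithinAt
  have csq : ContinuousOn (fun x : ℝ => ((x ^ 2 : ℝ) : ℂ)) (Ioi 0) := by fun_prop
  have e1 : ∀ {h₁ h₂ : ℝ → ℂ}, ∀ x : ℝ, 0 < x →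
      (h₁ x + (x : ℂ) * (x * h₂ x)) + ((a / x : ℝ) : ℂ) * (x * h₁ x) =
      ((x ^ 2 : ℝ) : ℂ) * h₂ x + (1 + a) * h₁ x := fun {h₁ h₂} x hx => by
    have hx' : (x : ℂ) ≠ 0 := by exact_mod_cast hx.ne'
    push_cast; field_simp; ring
  have hder : ∀ {h₁ h₂ : ℝ → ℂ}, (∀ x : ℝ, 0 < x → HasDerivAt h₁ (x * h₂ x) x) → ∀ x : ℝ, 0 < x →
      HasDerivAt (fun x : ℝ => (x : ℂ) * h₁ x) (h₁ x + (x : ℂ) * (x * h₂ x)) x :=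
    fun {h₁ h₂} h x hx => by
      have h1 : HasDerivAt (fun x : ℝ => (x : ℂ)) 1 x := Complex.ofRealCLM.hasDerivAt
      exact (h1.mul (h x hx)).congr_deriv (by ring)
  have hsq : PolyBdd fun (_ : Unit) (x : ℝ) => ((x ^ 2 : ℝ) : ℂ) := (chain_sq 0).prop
  have hconst : PolyBdd fun (_ : Unit) (_ : ℝ) => (1 + a : ℂ) :=
    ⟨0, ‖(1 + a : ℂ)‖, fun _ _ _ => by simp⟩
  have r1 : RapidDecay fun (_ : Unit) (x : ℝ) =>
      (((x ^ 2 : ℝ) : ℂ) * f₂ x + (1 + a) * f₁ x) * g x := by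
    have := ((hfd₂.mul hsq).add (hfd₁.mul hconst)).mul hgd
    simpa only [mul_comm] using this
  have r2 : RapidDecay fun (_ : Unit) (x : ℝ) =>
      f x * (((x ^ 2 : ℝ) : ℂ) * g₂ x + (1 + a) * g₁ x) := by
    have := ((hfd.mul hsq).mul hgd₂).add ((hfd.mul hconst).mul hgd₁)
    convert this using 3
    ring
  have r3 : RapidDecay fun (_ : Unit) (x : ℝ) => f₁ x * g x - f x * g₁ x := by
    have := (hfd₁.mul hgd).add ((hfd.mul hgd₁).mul
      (⟨0, 1, fun _ _ _ => by simp⟩ : PolyBdd fun (_ : Unit) (_ : ℝ) => (-1 : ℂ)))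
    convert this using 3
    ring
  have i1 := r1.integrable ha () (((csq.mul hfc).add (cf₁.const_mul _)).mul cg)
  have i2 := r2.integrable ha () (cf.mul ((csq.mul hgc).add (cg₁.const_mul _)))
  have hb : ∀ x : ℝ, 0 < x → ((x ^ (a + 1) : ℝ) : ℂ) * (f₁ x * g x - f x * g₁ x) =
      ((x ^ a : ℝ) : ℂ) * ((x * f₁ x) * g x - f x * (x * g₁ x)) := fun x hx => by
    rw [Real.rpow_add_one hx.ne']; push_cast; ring
  have c1 : ∀ᵐ x ∂(omega a), (((x ^ 2 : ℝ) : ℂ) * f₂ x + (1 + a) * f₁ x) * g x =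
      ((f₁ x + (x : ℂ) * (x * f₂ x)) + ((a / x : ℝ) : ℂ) * (x * f₁ x)) * g x :=
    ae_omega_of_forall_pos a fun x hx => by rw [e1 x hx]
  have c2 : ∀ᵐ x ∂(omega a), f x * (((x ^ 2 : ℝ) : ℂ) * g₂ x + (1 + a) * g₁ x) =
      f x * ((g₁ x + (x : ℂ) * (x * g₂ x)) + ((a / x : ℝ) : ℂ) * (x * g₁ x)) :=
    ae_omega_of_forall_pos a fun x hx => by rw [e1 x hx]
  rw [integral_congr_ae c1, integral_congr_ae c2]
  refine green hf (hder hf₁) hg (hder hg₁) (i1.congr c1) (i2.congr c2) ?_ ?_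
  · refine (r3.tendsto_zero ha).congr' ?_
    filter_upwards [self_mem_nhdsWithin] with x hx using hb x hx
  · refine (r3.tendsto_atTop (a := a + 1) (by linarith)).congr' ?_
    filter_upwards [eventually_gt_atTop 0] with x hx using hb x hx

/-! ### The Hankel transform -/

/-- The Hankel transform `∫ (ξ y) ^ (-ν) J_ν(ξ y) φ(y) dω_a(y)`, `ν = (a - 1) / 2`. -/
def hankel (a : ℝ) (φ : ℝ → ℂ) (ξ : ℝ) : ℂ := ∫ y, (besselE a (ξ * y) : ℂ) * φ y ∂(omega a)

lemma one_add_abs_mul_le {ξ y : ℝ} (hy : 0 < y) : 1 + |ξ * y| ≤ (1 + |ξ|) * (1 + y) := by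
  rw [abs_mul, abs_of_pos hy]; nlinarith [abs_nonneg ξ]

lemma RapidDecay.norm_besselE_mul_le {a : ℝ} (ha : -1 < a) {φ : ι → ℝ → ℂ} (h : RapidDecay φ)
    (m : ℕ) : ∃ C, 0 ≤ C ∧ ∀ i ξ y, 0 < y →
      ‖(besselE a (ξ * y) : ℂ) * φ i y‖ ≤ C * (1 + |ξ|) ^ 2 * ((1 + y) ^ m)⁻¹ := by
  obtain ⟨C, hC, hJ⟩ := exists_besselE_bound ha
  -- Two extra orders of decay pay for the quadratic growth of `besselE`.
  obtain ⟨C', hC', hφ⟩ := h.exists_bound (m + 2)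
  refine ⟨C * C', by positivity, fun i ξ y hy => ?_⟩
  have h1 := hJ (ξ * y)
  have h2 := hφ i y hy
  rw [norm_mul, Complex.norm_real, Real.norm_eq_abs]
  calc _ ≤ (C * ((1 + |ξ|) * (1 + y)) ^ 2) * (C' * ((1 + y) ^ (m + 2))⁻¹) := by
        gcongr
        exact h1.trans (by gcongr; exact one_add_abs_mul_le hy)
    _ = _ := by rw [pow_add]; field_simp

lemma continuousOn_besselE_mul {a : ℝ} (ha : -1 < a) {φ : ℝ → ℂ} (hc : ContinuousOn φ (Ioi 0))
    (ξ : ℝ) : ContinuousOn (fun y => (besselE a (ξ * y) : ℂ) * φ y) (Ioi 0) := by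
  have := continuous_besselE ha
  exact (Continuous.continuousOn (by fun_prop)).mul hc

lemma RapidDecay.integrable_hankel {a b : ℝ} (ha : -1 < a) (hb : -1 < b) {φ : ι → ℝ → ℂ}
    (h : RapidDecay φ) (i : ι) (hc : ContinuousOn (φ i) (Ioi 0)) (ξ : ℝ) :
    Integrable (fun y => (besselE b (ξ * y) : ℂ) * φ i y) (omega a) := by
  obtain ⟨C, -, hC⟩ := h.norm_besselE_mul_le hb (decayExp a)
  exact Integrable.mono' ((integrable_decay ha le_rfl).const_mul (C * (1 + |ξ|) ^ 2))
    (aestronglyMeasurable_omega (continuousOn_besselE_mul hb hc ξ))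
    (ae_omega_of_forall_pos a fun x hx => hC i ξ x hx)

lemma RapidDecay.norm_hankel_le {a : ℝ} (ha : -1 < a) {φ : ι → ℝ → ℂ} (h : RapidDecay φ) :
    ∃ C, 0 ≤ C ∧ ∀ i ξ, ‖hankel a (φ i) ξ‖ ≤ C * (1 + |ξ|) ^ 2 := by
  obtain ⟨C, hC0, hC⟩ := h.norm_besselE_mul_le ha (decayExp a)
  refine ⟨C * ∫ y : ℝ, ((1 + y) ^ decayExp a)⁻¹ ∂(omega a), ?_, fun i ξ => ?_⟩
  · refine mul_nonneg hC0 (integral_nonneg_of_ae ?_)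
    exact ae_omega_of_forall_pos a fun x hx => by simp only [Pi.zero_apply]; positivity
  · refine (norm_integral_le_of_norm_le
      ((integrable_decay ha le_rfl).const_mul (C * (1 + |ξ|) ^ 2))
      (ae_omega_of_forall_pos a fun x hx => hC i ξ x hx)).trans ?_
    rw [integral_const_mul]
    exact le_of_eq (by ring)

lemma RapidDecay.sq_mul {φ : ι → ℝ → ℂ} (h : RapidDecay φ) :
    RapidDecay (fun i x => ((x ^ 2 : ℝ) : ℂ) * φ i x) := by
  simpa only [mul_comm] using h.mul (chain_sq 0).prop

/-- The chain rule applied to `E_a(ξ y)` produces the factor `-ξ y ^ 2`; the `y ^ 2` turns `ω_a`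
into `ω_{a+2}`, so the derivative is again a Hankel transform, with parameter `a + 2`. -/
lemma RapidDecay.hasDerivAt_hankel {a : ℝ} (ha : -1 < a) {φ : ι → ℝ → ℂ} (h : RapidDecay φ) (i : ι)
    (hc : ContinuousOn (φ i) (Ioi 0)) (ξ : ℝ) :
    HasDerivAt (hankel a (φ i)) ((ξ : ℂ) * -hankel (a + 2) (φ i) ξ) ξ := by
  have ha2 : -1 < a + 2 := by linarith
  have hsqc : ContinuousOn (fun x : ℝ => ((x ^ 2 : ℝ) : ℂ) * φ i x) (Ioi 0) :=
    (Continuous.continuousOn (by fun_prop)).mul hc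
  obtain ⟨C, hC0, hC⟩ := h.sq_mul.norm_besselE_mul_le ha2 (decayExp a)
  have key := (hasDerivAt_integral_of_dominated_loc_of_deriv_le (μ := omega a) (𝕜 := ℝ)
    (F := fun ξ y => (besselE a (ξ * y) : ℂ) * φ i y)
    (F' := fun ξ y => -(ξ : ℂ) * ((besselE (a + 2) (ξ * y) : ℂ) * (((y ^ 2 : ℝ) : ℂ) * φ i y)))
    (bound := fun y => (|ξ| + 1) * (C * (1 + (|ξ| + 1)) ^ 2) * ((1 + y) ^ decayExp a)⁻¹)
    (x₀ := ξ) (Metric.ball_mem_nhds ξ one_pos)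
    (Eventually.of_forall fun ζ => aestronglyMeasurable_omega (continuousOn_besselE_mul ha hc ζ))
    (h.integrable_hankel ha ha i hc ξ)
    (aestronglyMeasurable_omega ((continuousOn_besselE_mul ha2 hsqc ξ).const_mul _))
    (ae_omega_of_forall_pos a fun y hy ζ hζ => ?_)
    ((integrable_decay ha le_rfl).const_mul _)
    (ae_omega_of_forall_pos a fun y hy ζ hζ => ?_)).2
  · refine key.congr_deriv ?_
    rw [integral_const_mul, hankel, integral_omega_add_two, neg_mul, mul_neg]
    congr 3
    ext y; ring
  · have h1 : |ζ| ≤ |ξ| + 1 := by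
      have : |ζ - ξ| < 1 := by simpa [Real.dist_eq] using hζ
      have := abs_sub_abs_le_abs_sub ζ ξ
      linarith
    rw [norm_mul, norm_neg, Complex.norm_real, Real.norm_eq_abs]
    calc _ ≤ (|ξ| + 1) * (C * (1 + |ζ|) ^ 2 * ((1 + y) ^ decayExp a)⁻¹) := by
          gcongr; exact hC i ζ y hy
      _ ≤ (|ξ| + 1) * (C * (1 + (|ξ| + 1)) ^ 2 * ((1 + y) ^ decayExp a)⁻¹) := by gcongr
      _ = _ := by ring
  · have h1 : HasDerivAt (fun ζ : ℝ => ζ * y) y ζ := by simpa using (hasDerivAt_id ζ).mul_const y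
    have h2 := ((hasDerivAt_besselE ha (ζ * y)).comp ζ h1).ofReal_comp.mul_const (φ i y)
    refine h2.congr_deriv ?_
    push_cast; ring

lemma hankel_sq_mul {a : ℝ} (ha : -1 < a) {φ : ι → ℝ → ℂ} (h : RapidDecay φ) (i : ι)
    (hc : ContinuousOn (φ i) (Ioi 0)) (ξ : ℝ) :
    hankel a (fun y => ((y ^ 2 : ℝ) : ℂ) * φ i y) ξ =
      (1 + a) * hankel (a + 2) (φ i) ξ - (ξ : ℂ) ^ 2 * hankel (a + 2 + 2) (φ i) ξ := by
  have hsqc : ContinuousOn (fun x : ℝ => ((x ^ 2 : ℝ) : ℂ) * φ i x) (Ioi 0) :=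
    (Continuous.continuousOn (by fun_prop)).mul hc
  have hsqc2 : ContinuousOn (fun x : ℝ => ((x ^ 2 : ℝ) : ℂ) * (((x ^ 2 : ℝ) : ℂ) * φ i x)) (Ioi 0) :=
    (Continuous.continuousOn (by fun_prop)).mul hsqc
  have ha2 : -1 < a + 2 := by linarith
  have ha4 : -1 < a + 2 + 2 := by linarith
  have i1 := (h.sq_mul.integrable_hankel ha ha2 i hsqc ξ).const_mul (1 + a : ℂ)
  have i2 := (h.sq_mul.sq_mul.integrable_hankel ha ha4 i hsqc2 ξ).const_mul ((ξ : ℂ) ^ 2)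
  have e1 : (1 + a) * hankel (a + 2) (φ i) ξ = ∫ y : ℝ, (1 + a : ℂ) *
      ((besselE (a + 2) (ξ * y) : ℂ) * (((y ^ 2 : ℝ) : ℂ) * φ i y)) ∂(omega a) := by
    rw [integral_const_mul, hankel, integral_omega_add_two]
    congr 2; ext y; ring
  have e2 : (ξ : ℂ) ^ 2 * hankel (a + 2 + 2) (φ i) ξ = ∫ y : ℝ, (ξ : ℂ) ^ 2 *
      ((besselE (a + 2 + 2) (ξ * y) : ℂ) * (((y ^ 2 : ℝ) : ℂ) * (((y ^ 2 : ℝ) : ℂ) * φ i y)))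
      ∂(omega a) := by
    rw [integral_const_mul, hankel, integral_omega_add_two, integral_omega_add_two]
    congr 2; ext y; ring
  rw [e1, e2, ← integral_sub i1 i2, hankel]
  congr 1; ext y
  rw [besselE_recurrence ha (ξ * y)]
  push_cast; ring

lemma polyBdd_besselE {a : ℝ} (ha : -1 < a) (ξ : ℝ) (c : ℂ) :
    PolyBdd fun (_ : Unit) (y : ℝ) => c * (besselE a (ξ * y) : ℂ) := by
  obtain ⟨C, hC, hJ⟩ := exists_besselE_bound ha
  refine ⟨2, ‖c‖ * (C * (1 + |ξ|) ^ 2), fun _ y hy => ?_⟩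
  have h1 := hJ (ξ * y)
  rw [norm_mul, Complex.norm_real, Real.norm_eq_abs]
  calc _ ≤ ‖c‖ * (C * ((1 + |ξ|) * (1 + y)) ^ 2) := by
        gcongr
        exact h1.trans (by gcongr; exact one_add_abs_mul_le hy)
    _ = _ := by ring

lemma hasDerivAt_besselE_mul {a : ℝ} (ha : -1 < a) (ξ : ℝ) (c : ℂ) (y : ℝ) :
    HasDerivAt (fun y : ℝ => c * (besselE a (ξ * y) : ℂ))
      (y * ((c * -(ξ : ℂ) ^ 2) * (besselE (a + 2) (ξ * y) : ℂ))) y := by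
  have h1 : HasDerivAt (fun y : ℝ => ξ * y) ξ y := by simpa using (hasDerivAt_id y).const_mul ξ
  have h2 := ((hasDerivAt_besselE ha (ξ * y)).comp y h1).ofReal_comp.const_mul c
  refine h2.congr_deriv ?_
  push_cast; ring

/-- The Hankel transform turns the Bessel operator into multiplication by `-ξ ^ 2`. -/
lemma Chain.exists_hankel_eq {a : ℝ} (ha : -1 < a) {n : ℕ} {φ : ι → ℝ → ℂ}
    (h : Chain RapidDecay (n + 2) φ) : ∃ β : ι → ℝ → ℂ, Chain RapidDecay n β ∧
      ∀ i ξ, hankel a (β i) ξ = -(ξ : ℂ) ^ 2 * hankel a (φ i) ξ := by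
  have h0 := h
  obtain ⟨hφ, φ₁, h₁, hd⟩ := h
  obtain ⟨hφ₁, φ₂, h₂, hd₁⟩ := h₁
  have hc1 : Chain RapidDecay n φ₁ := Chain.of_succ ⟨hφ₁, φ₂, h₂, hd₁⟩
  refine ⟨fun i x => ((x ^ 2 : ℝ) : ℂ) * φ₂ i x + (1 + a) * φ₁ i x,
    h₂.sq_mul.add (hc1.const_mul _), fun i ξ => ?_⟩
  have ha2 : -1 < a + 2 := by linarith
  have ha4 : -1 < a + 2 + 2 := by linarith
  have := continuous_besselE ha4
  have key := green_rapidDecay ha (hd i) (hd₁ i)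
    (fun y _ => hasDerivAt_besselE_mul ha ξ 1 y) (fun y _ => hasDerivAt_besselE_mul ha2 ξ _ y)
    (hφ.comp fun _ => i) (hφ₁.comp fun _ => i) (h₂.prop.comp fun _ => i) (h₂.continuousOn i)
    (polyBdd_besselE ha ξ 1) (polyBdd_besselE ha2 ξ _) (polyBdd_besselE ha4 ξ _)
    (by fun_prop)
  have e1 : hankel a (fun x => ((x ^ 2 : ℝ) : ℂ) * φ₂ i x + (1 + a) * φ₁ i x) ξ =
      ∫ x : ℝ, (((x ^ 2 : ℝ) : ℂ) * φ₂ i x + (1 + a) * φ₁ i x) * (1 * (besselE a (ξ * x) : ℂ))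
        ∂(omega a) := by
    rw [hankel]; congr 1; ext x; ring
  rw [e1, key, hankel, ← integral_const_mul]
  congr 1; ext x
  rw [besselE_recurrence ha (ξ * x)]
  push_cast; ring

/-- Each factor `-ξ ^ 2` costs one Bessel operator, that is two levels of the chain. -/
lemma Chain.exists_hankel_eq_pow {a : ℝ} (ha : -1 < a) (m : ℕ) {φ : ι → ℝ → ℂ}
    (h : Chain RapidDecay (2 * m) φ) : ∃ β : ι → ℝ → ℂ, Chain RapidDecay 0 β ∧
      ∀ i ξ, hankel a (β i) ξ = (-(ξ : ℂ) ^ 2) ^ m * hankel a (φ i) ξ := by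
  induction m generalizing φ with
  | zero => exact ⟨φ, h, fun i ξ => by simp⟩
  | succ m ih =>
    obtain ⟨β, hβ, e⟩ := Chain.exists_hankel_eq ha (n := 2 * m) h
    obtain ⟨β', hβ', e'⟩ := ih hβ
    exact ⟨β', hβ', fun i ξ => by rw [e', e, pow_succ]; ring⟩

lemma SchwartzFamily.rapidDecay {φ : ι → ℝ → ℂ} (h : SchwartzFamily φ) : RapidDecay φ := (h 0).1

lemma SchwartzFamily.continuousOn {φ : ι → ℝ → ℂ} (h : SchwartzFamily φ) (i : ι) :
    ContinuousOn (φ i) (Ioi 0) := (h 0).2 i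

lemma SchwartzFamily.sq_mul {φ : ι → ℝ → ℂ} (h : SchwartzFamily φ) :
    SchwartzFamily (fun i x => ((x ^ 2 : ℝ) : ℂ) * φ i x) := fun n => (h n).sq_mul

lemma SchwartzFamily.comp {κ : Type*} {φ : ι → ℝ → ℂ} (h : SchwartzFamily φ) (r : κ → ι) :
    SchwartzFamily (fun k => φ (r k)) := fun n => (h n).comp r

/-- Every `ξ ^ (2 m) h φ` is up to sign the transform of an iterated Bessel operator of `φ`, and any
transform of a rapidly decreasing function grows at most quadratically. -/
lemma SchwartzFamily.rapidDecay_hankel {a : ℝ} (ha : -1 < a) {φ : ι → ℝ → ℂ}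
    (h : SchwartzFamily φ) : RapidDecay (fun i => hankel a (φ i)) := by
  refine RapidDecay.of_bound fun m => ?_
  -- The surplus of `2` over `m` compensates the bound `(1 + |ξ|) ^ 2` of
  -- `RapidDecay.norm_hankel_le`.
  obtain ⟨β, hβ, e⟩ := Chain.exists_hankel_eq_pow ha (m + 2) (h _)
  obtain ⟨C₀, hC₀, h₀⟩ := h.rapidDecay.norm_hankel_le ha
  obtain ⟨C₁, hC₁, h₁⟩ := hβ.1.norm_hankel_le ha
  refine ⟨2 ^ (m + 2) * (C₀ + C₁), fun i x hx => ?_⟩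
  have hh₀ := h₀ i x
  have hh₁ := h₁ i x
  rw [e, norm_mul, norm_pow, norm_neg, norm_pow, Complex.norm_real, Real.norm_of_nonneg hx.le]
    at hh₁
  rw [abs_of_pos hx] at hh₀ hh₁
  have h2 : (1 + x) ^ (m + 2) ≤ 2 ^ (m + 2) * (1 + (x ^ 2) ^ (m + 2)) := by
    rcases le_total x 1 with hx1 | hx1
    · calc (1 + x) ^ (m + 2) ≤ 2 ^ (m + 2) := by gcongr; linarith
        _ ≤ _ := by
          have : 0 ≤ (x ^ 2) ^ (m + 2) := by positivity
          have : (0:ℝ) < 2 ^ (m + 2) := by positivity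
          nlinarith
    · calc (1 + x) ^ (m + 2) ≤ (2 * x ^ 2) ^ (m + 2) := by gcongr; nlinarith
        _ = 2 ^ (m + 2) * (x ^ 2) ^ (m + 2) := by rw [mul_pow]
        _ ≤ _ := by gcongr; linarith
  rw [← div_eq_mul_inv, le_div_iff₀ (by positivity)]
  have h3 : 0 < (1 + x) ^ 2 := by positivity
  refine le_of_mul_le_mul_right ?_ h3
  calc _ = (1 + x) ^ (m + 2) * ‖hankel a (φ i) x‖ := by rw [pow_add]; ring
    _ ≤ 2 ^ (m + 2) * (1 + (x ^ 2) ^ (m + 2)) * ‖hankel a (φ i) x‖ := by gcongr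
    _ = 2 ^ (m + 2) * (‖hankel a (φ i) x‖ + (x ^ 2) ^ (m + 2) * ‖hankel a (φ i) x‖) := by ring
    _ ≤ 2 ^ (m + 2) * (C₀ * (1 + x) ^ 2 + C₁ * (1 + x) ^ 2) := by gcongr
    _ = _ := by ring

/-- The Hankel transform preserves the Schwartz class. -/
lemma SchwartzFamily.hankel {a : ℝ} (ha : -1 < a) {φ : ι → ℝ → ℂ}
    (h : SchwartzFamily φ) : SchwartzFamily (fun i => hankel a (φ i)) := by
  intro n
  -- The parameter must vary, since the next function of the chain is a transform with parameter `a
  -- + 2`.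
  induction n generalizing a with
  | zero =>
    exact ⟨h.rapidDecay_hankel ha, fun i x _ =>
      (h.rapidDecay.hasDerivAt_hankel ha i (h.continuousOn i) x).continuousAt.continuousWithinAt⟩
  | succ n ih =>
    refine ⟨h.rapidDecay_hankel ha, _, (ih (a := a + 2) (by linarith)).const_mul (-1),
      fun i x hx => ?_⟩
    simpa using h.rapidDecay.hasDerivAt_hankel ha i (h.continuousOn i) x

lemma RapidDecay.continuous_hankel {a : ℝ} (ha : -1 < a) [TopologicalSpace ι]
    [FirstCountableTopology ι] {φ : ι → ℝ → ℂ} (h : RapidDecay φ)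
    (hc : ∀ i, ContinuousOn (φ i) (Ioi 0)) (hcont : ∀ y, 0 < y → Continuous fun i => φ i y) :
    Continuous (fun q : ℝ × ι => HalfLine.hankel a (φ q.2) q.1) := by
  obtain ⟨C, hC0, hC⟩ := h.norm_besselE_mul_le ha (decayExp a)
  refine continuous_iff_continuousAt.2 fun ⟨ξ, i⟩ => ?_
  refine continuousAt_of_dominated (F := fun (q : ℝ × ι) y => (besselE a (q.1 * y) : ℂ) * φ q.2 y)
    (bound := fun y => C * (1 + (|ξ| + 1)) ^ 2 * ((1 + y) ^ decayExp a)⁻¹)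
    (Eventually.of_forall fun q => aestronglyMeasurable_omega
      (continuousOn_besselE_mul ha (hc q.2) q.1)) ?_
    ((integrable_decay ha le_rfl).const_mul _) (ae_omega_of_forall_pos a fun y hy => ?_)
  · have : ∀ᶠ q : ℝ × ι in 𝓝 (ξ, i), |q.1| < |ξ| + 1 := by
      have h1 : ContinuousAt (fun q : ℝ × ι => |q.1|) (ξ, i) := by fun_prop
      exact h1.eventually_lt_const (by simp)
    filter_upwards [this] with q hq
    refine ae_omega_of_forall_pos a fun y hy => (hC q.2 q.1 y hy).trans ?_
    gcongr
  · have h1 := continuous_besselE ha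
    have h2 := hcont y hy
    fun_prop

lemma RapidDecay.continuous_hankel_single {a : ℝ} (ha : -1 < a) {φ : ι → ℝ → ℂ} (h : RapidDecay φ)
    (i : ι) (hc : ContinuousOn (φ i) (Ioi 0)) : Continuous (HalfLine.hankel a (φ i)) :=
  continuous_iff_continuousAt.2 fun x => (h.hasDerivAt_hankel ha i hc x).continuousAt

/-- The Hankel transform is symmetric. -/
lemma integral_hankel_mul {a : ℝ} (ha : -1 < a) (r : ℝ) {φ ψ : ℝ → ℂ}
    (h : RapidDecay fun _ : Unit => φ) (h' : RapidDecay fun _ : Unit => ψ)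
    (hc : ContinuousOn φ (Ioi 0)) (hc' : ContinuousOn ψ (Ioi 0)) :
    ∫ x, HalfLine.hankel a φ (r * x) * ψ x ∂(omega a) =
      ∫ x, φ x * HalfLine.hankel a ψ (r * x) ∂(omega a) := by
  have hsw := integral_integral_swap (μ := omega a) (ν := omega a)
    (f := fun x y => (besselE a (r * x * y) : ℂ) * φ y * ψ x) ?_
  · calc _ = ∫ x, ∫ y, (besselE a (r * x * y) : ℂ) * φ y * ψ x ∂(omega a) ∂(omega a) := by
          simp_rw [integral_mul_const]; rfl
      _ = _ := by
        rw [hsw]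
        congr 1; ext y
        rw [HalfLine.hankel, ← integral_const_mul]
        congr 1; ext x
        rw [show r * y * x = r * x * y by ring]; ring
  · obtain ⟨C, hC0, hC⟩ := h.norm_besselE_mul_le ha (decayExp a)
    -- The kernel grows like `(1 + |r x|) ^ 2` in the variable of `ψ`; the extra decay of `ψ` makes
    -- the double integrand absolutely integrable, so Fubini applies.
    obtain ⟨C', hC0', hC'⟩ := h'.exists_bound (decayExp a + 2)
    have hI := ((integrable_decay ha le_rfl).const_mul (C * (1 + |r|) ^ 2 * C')).mul_prod
      (integrable_decay ha le_rfl)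
    refine Integrable.mono' hI ?_ ?_
    · have hac : (omega a).prod (omega a) ≪
          (volume.restrict (Ioi 0)).prod (volume.restrict (Ioi 0)) :=
        (omega_absolutelyContinuous a).prod (omega_absolutelyContinuous a)
      refine AEStronglyMeasurable.mono_ac hac ?_
      rw [Measure.prod_restrict]
      refine ContinuousOn.aestronglyMeasurable ?_ (measurableSet_Ioi.prod measurableSet_Ioi)
      have h1 := continuous_besselE ha
      have h2 : ContinuousOn (fun q : ℝ × ℝ => φ q.2) (Ioi 0 ×ˢ Ioi 0) :=
        hc.comp continuousOn_snd fun q hq => hq.2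
      have h3 : ContinuousOn (fun q : ℝ × ℝ => ψ q.1) (Ioi 0 ×ˢ Ioi 0) :=
        hc'.comp continuousOn_fst fun q hq => hq.1
      have h4 : ContinuousOn (fun q : ℝ × ℝ => (besselE a (r * q.1 * q.2) : ℂ)) (Ioi 0 ×ˢ Ioi 0) :=
        Continuous.continuousOn (by fun_prop)
      exact (h4.mul h2).mul h3
    · have hp : ∀ᵐ q ∂((omega a).prod (omega a)), 0 < q.1 ∧ 0 < q.2 :=
        Measure.ae_prod_iff_ae_ae (p := fun q : ℝ × ℝ => 0 < q.1 ∧ 0 < q.2)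
          ((measurableSet_lt measurable_const measurable_fst).inter
            (measurableSet_lt measurable_const measurable_snd)) |>.2
          (ae_omega_of_forall_pos a fun x hx => ae_omega_of_forall_pos a fun y hy => ⟨hx, hy⟩)
      filter_upwards [hp] with q hq
      obtain ⟨h1, h2⟩ := hq
      simp only [Function.uncurry]
      rw [norm_mul]
      calc _ ≤ (C * (1 + |r * q.1|) ^ 2 * ((1 + q.2) ^ decayExp a)⁻¹) *
            (C' * ((1 + q.1) ^ (decayExp a + 2))⁻¹) := by
            gcongr
            · exact hC () _ _ h2
            · exact hC' () _ h1
        _ ≤ (C * ((1 + |r|) * (1 + q.1)) ^ 2 * ((1 + q.2) ^ decayExp a)⁻¹) *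
            (C' * ((1 + q.1) ^ (decayExp a + 2))⁻¹) := by
            gcongr; exact one_add_abs_mul_le h1
        _ = _ := by rw [pow_add]; field_simp

/-! ### Gaussians -/

/-- The Gaussian `exp (-z y ^ 2)`. -/
def gauss (z : ℂ) (y : ℝ) : ℂ := Complex.exp (-z * (y : ℂ) ^ 2)

lemma norm_gauss (z : ℂ) (y : ℝ) : ‖gauss z y‖ = Real.exp (-z.re * y ^ 2) := by
  rw [gauss, Complex.norm_exp, ← Complex.ofReal_pow, Complex.re_mul_ofReal, Complex.neg_re]

lemma continuous_gauss (z : ℂ) : Continuous (gauss z) := by unfold gauss; fun_prop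

lemma hasDerivAt_gauss (z : ℂ) (y : ℝ) : HasDerivAt (gauss z) (y * (-2 * z * gauss z y)) y := by
  have h1 : HasDerivAt (fun x : ℝ => (x : ℂ)) 1 y := Complex.ofRealCLM.hasDerivAt
  have h2 := ((h1.pow 2).const_mul (-z)).cexp
  exact h2.congr_deriv (by simp [gauss]; ring)

lemma rapidDecay_gauss {z : ℂ} (hz : 0 < z.re) : RapidDecay fun _ : Unit => gauss z := by
  intro m
  set r := z.re
  refine ⟨2 ^ m * (m.factorial * Real.exp r / r ^ m), fun _ x hx => ?_⟩
  have h1 : (1 + x) ^ m ≤ 2 ^ m * (1 + x ^ 2) ^ m := by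
    rw [← mul_pow]; gcongr; nlinarith [sq_nonneg (x - 1)]
  have h2 := Real.pow_div_factorial_le_exp (r * (1 + x ^ 2)) (by positivity) m
  rw [div_le_iff₀ (by positivity), mul_pow, mul_add, mul_one, Real.exp_add] at h2
  rw [norm_gauss, neg_mul, Real.exp_neg]
  calc _ ≤ 2 ^ m * (1 + x ^ 2) ^ m * (Real.exp (r * x ^ 2))⁻¹ := by gcongr
    _ ≤ 2 ^ m * (m.factorial * Real.exp r * Real.exp (r * x ^ 2) / r ^ m) *
        (Real.exp (r * x ^ 2))⁻¹ := by
        gcongr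
        rw [le_div_iff₀ (by positivity)]
        linarith
    _ = _ := by field_simp

lemma schwartzFamily_gauss {z : ℂ} (hz : 0 < z.re) : SchwartzFamily fun _ : Unit => gauss z := by
  intro n
  induction n with
  | zero => exact ⟨rapidDecay_gauss hz, fun _ => (continuous_gauss z).continuousOn⟩
  | succ n ih =>
    exact ⟨rapidDecay_gauss hz, _, ih.const_mul (-2 * z), fun _ x _ => hasDerivAt_gauss z x⟩

/-- Green's identity against the constant `1` says that the Bessel operator of a Gaussian has zero
integral; this is the resulting relation between two moments. -/
lemma integral_sq_mul_gauss {b : ℝ} (hb : -1 < b) {z : ℂ} (hz : 0 < z.re) :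
    2 * z * ∫ y : ℝ, ((y ^ 2 : ℝ) : ℂ) * gauss z y ∂(omega b) =
      (1 + b) * ∫ y, gauss z y ∂(omega b) := by
  have hz0 : z ≠ 0 := fun h => by simp [h] at hz
  have hS := schwartzFamily_gauss hz
  have hS1 : Chain RapidDecay 0 fun (_ : Unit) y => -2 * z * gauss z y := (hS 0).const_mul _
  have hS2 : Chain RapidDecay 0 fun (_ : Unit) y => -2 * z * (-2 * z * gauss z y) :=
    hS1.const_mul _
  have hP : ∀ c : ℂ, PolyBdd fun (_ : Unit) (_ : ℝ) => c :=
    fun c => ⟨0, ‖c‖, fun _ _ _ => by simp⟩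
  have key := green_rapidDecay hb (f := gauss z) (f₁ := fun y => -2 * z * gauss z y)
    (f₂ := fun y => -2 * z * (-2 * z * gauss z y)) (g := fun _ => 1) (g₁ := fun _ => 0)
    (g₂ := fun _ => 0) (fun x _ => hasDerivAt_gauss z x)
    (fun x _ => ((hasDerivAt_gauss z x).const_mul (-2 * z)).congr_deriv (by ring))
    (fun x _ => (hasDerivAt_const x 1).congr_deriv (by simp))
    (fun x _ => (hasDerivAt_const x 0).congr_deriv (by simp))
    hS.rapidDecay hS1.prop hS2.prop (hS2.continuousOn ()) (hP 1) (hP 0) (hP 0)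
    continuousOn_const
  simp only [mul_zero, add_zero, integral_zero, mul_one] at key
  have i1 := hS.sq_mul.rapidDecay.integrable hb () (hS.sq_mul.continuousOn ())
  have i2 := hS.rapidDecay.integrable hb () (hS.continuousOn ())
  have e : ∫ x : ℝ, ((x ^ 2 : ℝ) : ℂ) * (-2 * z * (-2 * z * gauss z x)) +
      (1 + b) * (-2 * z * gauss z x) ∂(omega b) =
      4 * z ^ 2 * (∫ y : ℝ, ((y ^ 2 : ℝ) : ℂ) * gauss z y ∂(omega b)) +
        -(2 * z * (1 + b)) * ∫ y, gauss z y ∂(omega b) := by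
    rw [← integral_const_mul, ← integral_const_mul, ← integral_add (i1.const_mul _) (i2.const_mul _)]
    congr 1; ext x; ring
  rw [e] at key
  refine mul_left_cancel₀ (mul_ne_zero two_ne_zero hz0) ?_
  linear_combination key

lemma hasDerivAt_integral_gauss {b : ℝ} (hb : -1 < b) {z : ℂ} (hz : 0 < z.re) :
    HasDerivAt (fun z => ∫ y, gauss z y ∂(omega b))
      (-∫ y : ℝ, ((y ^ 2 : ℝ) : ℂ) * gauss z y ∂(omega b)) z := by
  have hz2 : (0:ℝ) < (((z.re / 2 : ℝ)) : ℂ).re := by simpa using hz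
  have hS := schwartzFamily_gauss hz2
  have hI := hS.sq_mul.rapidDecay.integrable hb () (hS.sq_mul.continuousOn ())
  have key := (hasDerivAt_integral_of_dominated_loc_of_deriv_le (μ := omega b) (𝕜 := ℂ)
    (F := fun z y => gauss z y)
    (F' := fun z y => -(((y ^ 2 : ℝ) : ℂ) * gauss z y))
    -- On the disc of radius `Re z / 2` about `z` all real parts are at least `Re z / 2`, so this
    -- single Gaussian dominates.
    (bound := fun y => ‖((y ^ 2 : ℝ) : ℂ) * gauss ((z.re / 2 : ℝ) : ℂ) y‖)
    (x₀ := z) (Metric.ball_mem_nhds z (half_pos hz))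
    (Eventually.of_forall fun ζ => (continuous_gauss ζ).aestronglyMeasurable)
    ((schwartzFamily_gauss hz).rapidDecay.integrable hb () (continuous_gauss z).continuousOn)
    (by have := continuous_gauss z; exact Continuous.aestronglyMeasurable (by fun_prop))
    (Eventually.of_forall fun y ζ hζ => ?_) hI.norm
    (Eventually.of_forall fun y ζ hζ => ?_)).2
  · rwa [integral_neg] at key
  · rw [norm_neg, norm_mul, norm_mul, norm_gauss, norm_gauss]
    have h1 : |(ζ - z).re| < z.re / 2 := by
      refine (Complex.abs_re_le_norm _).trans_lt ?_
      simpa [Complex.dist_eq] using hζ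
    have h2 : z.re / 2 ≤ ζ.re := by
      rw [Complex.sub_re] at h1
      linarith [(abs_lt.1 h1).1]
    rw [Complex.ofReal_re]
    gcongr
  · have h1 : HasDerivAt (fun ζ : ℂ => -ζ * (y : ℂ) ^ 2) (-1 * (y : ℂ) ^ 2) ζ :=
      (hasDerivAt_id ζ).neg.mul_const _
    refine h1.cexp.congr_deriv ?_
    rw [gauss]; push_cast; ring

/-- By the moment relation, `z ^ s` times the integral has zero derivative on the right half-plane,
which is convex; the constant is found at `z = 1`, where the integral is a Gamma function. -/
lemma integral_gauss {b : ℝ} (hb : -1 < b) {z : ℂ} (hz : 0 < z.re) :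
    ∫ y, gauss z y ∂(omega b) =
      ((Real.Gamma ((b + 1) / 2) / 2 : ℝ) : ℂ) * z ^ (-(((b + 1) / 2 : ℝ) : ℂ)) := by
  set s : ℂ := (((b + 1) / 2 : ℝ) : ℂ) with hs
  have hopen : IsOpen {z : ℂ | 0 < z.re} := isOpen_lt continuous_const Complex.continuous_re
  have hconv : Convex ℝ {z : ℂ | 0 < z.re} := convex_halfSpace_re_gt 0
  have hd : ∀ z : ℂ, 0 < z.re →
      HasDerivAt (fun z => z ^ s * ∫ y, gauss z y ∂(omega b)) 0 z := fun z hz => by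
    have hz0 : z ≠ 0 := fun h => by simp [h] at hz
    have h1 := ((hasDerivAt_id z).cpow_const (c := s) (Or.inl hz)).mul
      (hasDerivAt_integral_gauss hb hz)
    refine h1.congr_deriv ?_
    have h2 := integral_sq_mul_gauss hb hz
    have h3 : z ^ s = z ^ (s - 1) * z := by
      rw [Complex.cpow_sub _ _ hz0, Complex.cpow_one, div_mul_cancel₀ _ hz0]
    have h4 : 2 * s = 1 + b := by rw [hs]; push_cast; ring
    simp only [id, mul_one]
    rw [h3]
    rw [← h4] at h2
    have h5 : z * ∫ y : ℝ, ((y ^ 2 : ℝ) : ℂ) * gauss z y ∂(omega b) =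
        s * ∫ y, gauss z y ∂(omega b) := by
      refine mul_left_cancel₀ (two_ne_zero (α := ℂ)) ?_
      linear_combination h2
    linear_combination -(z ^ (s - 1)) * h5
  have hconst := hopen.is_const_of_deriv_eq_zero hconv.isPreconnected
    (f := fun z => z ^ s * ∫ y, gauss z y ∂(omega b))
    (fun z hz => (hd z hz).differentiableAt.differentiableWithinAt)
    (fun z hz => (hd z hz).deriv) (x := z) (y := 1) hz (by simp)
  have h1 : ∫ y, gauss 1 y ∂(omega b) = ((Real.Gamma ((b + 1) / 2) / 2 : ℝ) : ℂ) := by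
    rw [integral_omega]
    have := integral_rpow_mul_exp_neg_rpow (p := 2) (q := b) two_pos hb
    rw [show Real.Gamma ((b + 1) / 2) / 2 = 1 / 2 * Real.Gamma ((b + 1) / 2) by ring, ← this,
      ← integral_complex_ofReal]
    congr 1; ext x
    rw [gauss, Complex.real_smul]
    push_cast
    norm_num
  simp only [Complex.one_cpow, one_mul, h1] at hconst
  have hz0 : z ≠ 0 := fun h => by simp [h] at hz
  rw [Complex.cpow_neg, ← hconst]
  have : z ^ s ≠ 0 := by simp [Complex.cpow_eq_zero_iff, hz0]
  field_simp

lemma integral_omega_add_nat (a : ℝ) (k : ℕ) (f : ℝ → ℂ) :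
    ∫ x, f x ∂(omega (a + 2 * k)) = ∫ x, ((x ^ (2 * k) : ℝ) : ℂ) * f x ∂(omega a) := by
  induction k generalizing f with
  | zero => simp
  | succ k ih =>
    rw [show a + 2 * ((k + 1 : ℕ) : ℝ) = a + 2 * k + 2 by push_cast; ring, integral_omega_add_two,
      ih]
    congr 1; ext x
    push_cast; ring

lemma rapidDecay_pow_mul_gauss {z : ℂ} (hz : 0 < z.re) (k : ℕ) :
    RapidDecay fun (_ : Unit) y => ((y ^ (2 * k) : ℝ) : ℂ) * gauss z y := by
  induction k with
  | zero => simpa using rapidDecay_gauss hz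
  | succ k ih =>
    convert ih.sq_mul using 3
    push_cast; ring

lemma integral_norm_pow_mul_gauss {a : ℝ} (ha : -1 < a) {z : ℂ} (hz : 0 < z.re) (k : ℕ) :
    ∫ y, ‖((y ^ (2 * k) : ℝ) : ℂ) * gauss z y‖ ∂(omega a) =
      Real.Gamma ((a + 1) / 2 + k) / 2 * z.re ^ (-((a + 1) / 2 + k)) := by
  have hk : (0:ℝ) ≤ k := by positivity
  have h1 := integral_gauss (b := a + 2 * k) (by linarith) (z := (z.re : ℂ)) (by simpa using hz)
  have e1 : (a + 2 * k + 1) / 2 = (a + 1) / 2 + k := by ring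
  rw [integral_omega_add_nat, e1] at h1
  have h2 : ((∫ y, ‖((y ^ (2 * k) : ℝ) : ℂ) * gauss z y‖ ∂(omega a) : ℝ) : ℂ) =
      ∫ y, ((y ^ (2 * k) : ℝ) : ℂ) * gauss z.re y ∂(omega a) := by
    rw [← integral_complex_ofReal]
    refine integral_congr_ae (ae_omega_of_forall_pos a fun y hy => ?_)
    simp only [norm_mul, norm_gauss]
    rw [Complex.norm_real, Real.norm_of_nonneg (by positivity), gauss]
    push_cast
    ring_nf
  rw [← Complex.ofReal_inj, h2, h1, ← Complex.ofReal_neg, ← Complex.ofReal_cpow hz.le]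
  push_cast; ring

/-- The even moments of a Gaussian contain exactly the Gamma factor in the denominator of the Bessel
coefficients. What remains are the coefficients of an exponential, which is why a Gaussian
transforms into a Gaussian. -/
lemma besselCoeff_mul_gamma {a : ℝ} (ha : -1 < a) (k : ℕ) :
    besselCoeff a k * (Real.Gamma ((a + 1) / 2 + k) / 2) =
      2 ^ (-((a + 1) / 2)) * ((-1 / 4) ^ k / k.factorial) := by
  have hpos : 0 < (a + 1) / 2 + k := by
    have : 0 < (a + 1) / 2 := by linarith
    positivity
  have h2 := (Real.Gamma_pos_of_pos hpos).ne'
  have h3 : (k.factorial : ℝ) ≠ 0 := by positivity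
  have e : (2:ℝ) ^ (-((a - 1) / 2)) = 2 ^ (-((a + 1) / 2)) * 2 := by
    rw [← Real.rpow_add_one two_ne_zero]; ring_nf
  rw [besselCoeff, e, show (-1 / 4 : ℝ) = -1 * (1 / 4) by ring, mul_pow]
  generalize Real.Gamma ((a + 1) / 2 + k) = G at *
  field_simp

/-- The Hankel transform of a Gaussian. -/
lemma hankel_gauss {a : ℝ} (ha : -1 < a) {z : ℂ} (hz : 0 < z.re) (ξ : ℝ) :
    hankel a (gauss z) ξ = (((2:ℝ) ^ (-((a + 1) / 2)) : ℝ) : ℂ) * z ^ (-(((a + 1) / 2 : ℝ) : ℂ)) *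
      Complex.exp (-(ξ : ℂ) ^ 2 / (4 * z)) := by
  have hz0 : z ≠ 0 := fun h => by simp [h] at hz
  have hi : ∀ k : ℕ, Integrable (fun y : ℝ => ((besselCoeff a k * ξ ^ (2 * k) : ℝ) : ℂ) *
      (((y ^ (2 * k) : ℝ) : ℂ) * gauss z y)) (omega a) := fun k => by
    have := continuous_gauss z
    exact ((rapidDecay_pow_mul_gauss hz k).integrable ha ()
      (Continuous.continuousOn (by fun_prop))).const_mul _
  have hnorm : ∀ k : ℕ, ∫ y : ℝ, ‖((besselCoeff a k * ξ ^ (2 * k) : ℝ) : ℂ) *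
      (((y ^ (2 * k) : ℝ) : ℂ) * gauss z y)‖ ∂(omega a) =
      2 ^ (-((a + 1) / 2)) * z.re ^ (-((a + 1) / 2)) *
        ((ξ ^ 2 / (4 * z.re)) ^ k / k.factorial) := fun k => by
    simp_rw [norm_mul (((besselCoeff a k * ξ ^ (2 * k) : ℝ) : ℂ))]
    rw [integral_const_mul, integral_norm_pow_mul_gauss ha hz, Complex.norm_real, norm_mul,
      Real.norm_of_nonneg (by rw [pow_mul]; positivity : 0 ≤ ξ ^ (2 * k))]
    have hG : 0 < Real.Gamma ((a + 1) / 2 + k) / 2 := by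
      refine half_pos (Real.Gamma_pos_of_pos ?_)
      have : 0 < (a + 1) / 2 := by linarith
      positivity
    have h1 := congrArg norm (besselCoeff_mul_gamma ha k)
    rw [norm_mul, Real.norm_of_nonneg hG.le, norm_mul, norm_div, norm_pow,
      Real.norm_of_nonneg (by positivity : (0:ℝ) ≤ 2 ^ (-((a + 1) / 2))),
      Real.norm_of_nonneg (by positivity : (0:ℝ) ≤ k.factorial)] at h1
    have e2 : z.re ^ (-((a + 1) / 2 + k)) = z.re ^ (-((a + 1) / 2)) * (z.re⁻¹) ^ k := by
      rw [neg_add, Real.rpow_add hz, Real.rpow_neg hz.le (k : ℝ), Real.rpow_natCast, inv_pow]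
    rw [e2]
    calc _ = (‖besselCoeff a k‖ * (Real.Gamma ((a + 1) / 2 + k) / 2)) * ξ ^ (2 * k) *
        (z.re ^ (-((a + 1) / 2)) * (z.re⁻¹) ^ k) := by ring
      _ = _ := by
        rw [h1, show ‖(-1 / 4 : ℝ)‖ = 1 / 4 by norm_num, pow_mul,
          show ξ ^ 2 / (4 * z.re) = ξ ^ 2 * (1 / 4) * z.re⁻¹ by field_simp, mul_pow, mul_pow]
        ring
  -- The `L¹` norms of the terms form an exponential series in `ξ ^ 2 / (4 Re z)`, which justifies
  -- termwise integration.
  have hsum := hasSum_integral_of_summable_integral_norm hi (by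
    simp_rw [hnorm]
    exact (Real.summable_pow_div_factorial _).mul_left _)
  have e1 : ∫ y, ∑' k : ℕ, ((besselCoeff a k * ξ ^ (2 * k) : ℝ) : ℂ) *
      (((y ^ (2 * k) : ℝ) : ℂ) * gauss z y) ∂(omega a) = hankel a (gauss z) ξ := by
    rw [hankel]
    congr 1; ext y
    rw [besselE, Complex.ofReal_tsum, ← tsum_mul_right]
    refine tsum_congr fun k => ?_
    rw [mul_pow]; push_cast; ring
  rw [e1] at hsum
  have e2 : ∀ k : ℕ, ∫ y, ((besselCoeff a k * ξ ^ (2 * k) : ℝ) : ℂ) *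
      (((y ^ (2 * k) : ℝ) : ℂ) * gauss z y) ∂(omega a) =
      (((2:ℝ) ^ (-((a + 1) / 2)) : ℝ) : ℂ) * z ^ (-(((a + 1) / 2 : ℝ) : ℂ)) *
      ((-(ξ : ℂ) ^ 2 / (4 * z)) ^ k / k.factorial) := fun k => by
    have hk : (0:ℝ) ≤ k := by positivity
    have h1 := integral_gauss (b := a + 2 * k) (by linarith) hz
    have e1 : (a + 2 * k + 1) / 2 = (a + 1) / 2 + k := by ring
    rw [integral_omega_add_nat, e1] at h1
    rw [integral_const_mul, h1]
    have h2 := congrArg (fun r : ℝ => (r : ℂ)) (besselCoeff_mul_gamma ha k)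
    have e3 : z ^ (-(((a + 1) / 2 + k : ℝ) : ℂ)) = z ^ (-(((a + 1) / 2 : ℝ) : ℂ)) * (z⁻¹) ^ k := by
      rw [Complex.ofReal_add, neg_add, Complex.cpow_add _ _ hz0, Complex.ofReal_natCast,
        Complex.cpow_neg _ (k : ℂ), Complex.cpow_natCast, inv_pow]
    rw [e3]
    calc _ = ((besselCoeff a k * (Real.Gamma ((a + 1) / 2 + k) / 2) : ℝ) : ℂ) * (ξ : ℂ) ^ (2 * k) *
          (z ^ (-(((a + 1) / 2 : ℝ) : ℂ)) * (z⁻¹) ^ k) := by push_cast; ring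
      _ = _ := by
        rw [h2, show -(ξ : ℂ) ^ 2 / (4 * z) = (ξ : ℂ) ^ 2 * (-1 / 4) * z⁻¹ by field_simp,
          mul_pow, mul_pow, ← pow_mul]
        push_cast; ring
  simp_rw [e2] at hsum
  have hexp := (NormedSpace.expSeries_div_hasSum_exp (-(ξ : ℂ) ^ 2 / (4 * z))).mul_left
    ((((2:ℝ) ^ (-((a + 1) / 2)) : ℝ) : ℂ) * z ^ (-(((a + 1) / 2 : ℝ) : ℂ)))
  rw [← Complex.exp_eq_exp_ℂ] at hexp
  exact hsum.unique hexp

/-! ### Completeness of the Gaussians -/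

/-- In the variable `s = exp (-y ^ 2)` the hypothesis says that `d · exp (-y ^ 2)` is orthogonal to
every polynomial in `s`. Since `g` has compact support, `g(y) = exp (-y ^ 2) G(s)` with `G`
continuous on `[0, 1]`, and Weierstrass approximation of `G` concludes. -/
lemma integral_smul_eq_zero_of_gauss {a : ℝ} {d : ℝ → ℂ}
    (hi : Integrable (fun y => d y * gauss 1 y) (omega a))
    (h0 : ∀ n : ℕ, 1 ≤ n → ∫ y, d y * gauss n y ∂(omega a) = 0)
    {g : ℝ → ℝ} (hg : Continuous g) (hs : HasCompactSupport g) :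
    ∫ y, g y • d y ∂(omega a) = 0 := by
  set G : ℝ → ℝ := fun s => g (√(-Real.log s)) / s with hG
  have hgauss : ∀ (n : ℕ) (y : ℝ), gauss ((n + 1 : ℕ) : ℂ) y =
      gauss 1 y * ((Real.exp (-y ^ 2) ^ n : ℝ) : ℂ) := fun n y => by
    rw [gauss, gauss, ← Real.exp_nat_mul]
    push_cast
    rw [← Complex.exp_add]; ring_nf
  obtain ⟨R, hR⟩ : ∃ R : ℝ, ∀ y, R < y → g y = 0 := by
    obtain ⟨R, hR⟩ := hs.isCompact.isBounded.subset_closedBall 0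
    refine ⟨R, fun y hy => image_eq_zero_of_notMem_tsupport fun hmem => ?_⟩
    have := hR hmem
    rw [Metric.mem_closedBall, dist_zero_right, Real.norm_eq_abs] at this
    linarith [le_abs_self y]
  have hGc : ContinuousOn G (Icc 0 1) := by
    intro s hs
    refine ContinuousAt.continuousWithinAt ?_
    rcases eq_or_lt_of_le hs.1 with h | h
    · subst h
      -- Small `s` corresponds to large `y`, outside the support of `g`; the radius is chosen so
      -- that `y ^ 2 > R ^ 2 + 1`. Negative `s` are covered because `Real.log s = Real.log |s|`, and
      -- `s = 0` because division by zero gives `0`.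
      have hz : G =ᶠ[𝓝 0] fun _ => 0 := by
        filter_upwards [Metric.ball_mem_nhds (0:ℝ) (Real.exp_pos (-(R ^ 2 + 1)))] with s hs
        rcases eq_or_ne s 0 with rfl | hs0
        · simp [hG]
        · have h1 : Real.log s < -(R ^ 2 + 1) := by
            rw [← Real.log_abs, Real.log_lt_iff_lt_exp (abs_pos.2 hs0)]
            simpa using hs
          have h2 : R < √(-Real.log s) := by
            refine (le_abs_self R).trans_lt (Real.lt_sqrt_of_sq_lt ?_)
            rw [sq_abs]; linarith
          simp [hG, hR _ h2]
      exact continuousAt_const.congr hz.symm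
    · have h1 : ContinuousAt Real.log s := Real.continuousAt_log h.ne'
      have h2 := h1.neg.sqrt
      exact (hg.continuousAt.comp h2).div continuousAt_id h.ne'
  have hpoly : ∀ P : Polynomial ℝ,
      Integrable (fun y => d y * gauss 1 y * ((P.eval (Real.exp (-y ^ 2)) : ℝ) : ℂ)) (omega a) ∧
      ∫ y, d y * gauss 1 y * ((P.eval (Real.exp (-y ^ 2)) : ℝ) : ℂ) ∂(omega a) = 0 := by
    intro P
    induction P using Polynomial.induction_on' with
    | add p q hp hq =>
      simp only [Polynomial.eval_add, Complex.ofReal_add, mul_add]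
      refine ⟨hp.1.add hq.1, ?_⟩
      rw [integral_add hp.1 hq.1, hp.2, hq.2, add_zero]
    | monomial n c =>
      simp only [Polynomial.eval_monomial]
      have e : (fun y : ℝ => d y * gauss 1 y * ((c * Real.exp (-y ^ 2) ^ n : ℝ) : ℂ)) =
          fun y => (c : ℂ) * (d y * gauss ((n + 1 : ℕ) : ℂ) y) := by
        ext y; rw [hgauss]; push_cast; ring
      rw [e]
      constructor
      · refine Integrable.const_mul ?_ _
        have : (fun y => d y * gauss ((n + 1 : ℕ) : ℂ) y) =
            fun y => (d y * gauss 1 y) * ((Real.exp (-y ^ 2) ^ n : ℝ) : ℂ) := by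
          ext y; rw [hgauss]; ring
        rw [this]
        refine hi.mul_bdd (c := 1) (Continuous.aestronglyMeasurable (by fun_prop))
          (Eventually.of_forall fun y => ?_)
        rw [Complex.norm_real, Real.norm_of_nonneg (by positivity)]
        exact pow_le_one₀ (by positivity) (Real.exp_le_one_iff.2 (by nlinarith [sq_nonneg y]))
      · rw [integral_const_mul, h0 _ (by omega), mul_zero]
  have hrep : ∀ y : ℝ, 0 < y → g y • d y = d y * gauss 1 y * ((G (Real.exp (-y ^ 2)) : ℝ) : ℂ) := by
    intro y hy
    have : gauss 1 y = ((Real.exp (-y ^ 2) : ℝ) : ℂ) := by rw [gauss]; push_cast; ring_nf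
    rw [this, hG]
    simp only [Real.log_exp, neg_neg, Real.sqrt_sq hy.le, Complex.real_smul]
    have h2 : ((Real.exp (-y ^ 2) : ℝ) : ℂ) ≠ 0 := by exact_mod_cast (Real.exp_pos _).ne'
    rw [Complex.ofReal_div]
    field_simp
  rw [integral_congr_ae (ae_omega_of_forall_pos a hrep)]
  have hmem : ∀ y : ℝ, Real.exp (-y ^ 2) ∈ Icc (0:ℝ) 1 := fun y =>
    ⟨by positivity, Real.exp_le_one_iff.2 (by nlinarith [sq_nonneg y])⟩
  have hbound : ∀ ε > 0, ‖∫ y, d y * gauss 1 y * ((G (Real.exp (-y ^ 2)) : ℝ) : ℂ) ∂(omega a)‖ ≤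
      ε * ∫ y, ‖d y * gauss 1 y‖ ∂(omega a) := by
    intro ε hε
    obtain ⟨P, hP⟩ := exists_polynomial_near_of_continuousOn 0 1 G hGc ε hε
    have hGi : Integrable (fun y => d y * gauss 1 y * ((G (Real.exp (-y ^ 2)) : ℝ) : ℂ))
        (omega a) := by
      obtain ⟨C, hC⟩ := isCompact_Icc.exists_bound_of_continuousOn hGc
      have hcont : Continuous fun y : ℝ => ((G (Real.exp (-y ^ 2)) : ℝ) : ℂ) :=
        Complex.continuous_ofReal.comp (hGc.comp_continuous (by fun_prop) hmem)
      refine hi.mul_bdd (c := C) hcont.aestronglyMeasurable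
        (Eventually.of_forall fun y => ?_)
      rw [Complex.norm_real]
      exact hC _ (hmem y)
    rw [← sub_zero (∫ y, d y * gauss 1 y * ((G (Real.exp (-y ^ 2)) : ℝ) : ℂ) ∂(omega a)),
      ← (hpoly P).2, ← integral_sub hGi (hpoly P).1, ← integral_const_mul]
    refine norm_integral_le_of_norm_le (hi.norm.const_mul ε) (Eventually.of_forall fun y => ?_)
    rw [← mul_sub, norm_mul, mul_comm ε, ← Complex.ofReal_sub, Complex.norm_real, norm_sub_rev]
    gcongr
    exact (hP _ (hmem y)).le
  have hlim : Tendsto (fun ε : ℝ => ε * ∫ y, ‖d y * gauss 1 y‖ ∂(omega a)) (𝓝[>] 0) (𝓝 0) := by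
    have : Continuous (fun ε : ℝ => ε * ∫ y, ‖d y * gauss 1 y‖ ∂(omega a)) := by fun_prop
    have := this.tendsto 0
    rw [zero_mul] at this
    exact this.mono_left nhdsWithin_le_nhds
  rw [← norm_le_zero_iff]
  refine ge_of_tendsto hlim ?_
  filter_upwards [self_mem_nhdsWithin] with ε hε using hbound ε hε

/-- Fundamental lemma of the calculus of variations for the positive weight `x ^ a`; continuity
upgrades almost everywhere to everywhere. -/
lemma eq_zero_of_integral_smul_eq_zero {a : ℝ} {d : ℝ → ℂ} (hd : ContinuousOn d (Ioi 0))
    (h0 : ∀ g : ℝ → ℝ, ContDiff ℝ ∞ g → HasCompactSupport g → tsupport g ⊆ Ioi 0 →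
      ∫ y, g y • d y ∂(omega a) = 0) {x : ℝ} (hx : 0 < x) : d x = 0 := by
  have hw : ContinuousOn (fun y : ℝ => y ^ a) (Ioi 0) := fun y hy =>
    (Real.continuousAt_rpow_const y a (Or.inl (ne_of_gt hy))).continuousWithinAt
  have hcont : ContinuousOn (fun y : ℝ => (y ^ a) • d y) (Ioi 0) := hw.smul hd
  have key := isOpen_Ioi.ae_eq_zero_of_integral_contDiff_smul_eq_zero (μ := volume)
    (f := fun y : ℝ => (y ^ a) • d y) (U := Ioi (0:ℝ))
    (hcont.locallyIntegrableOn measurableSet_Ioi) fun g hg hs hsub => by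
      have h1 := h0 g hg hs hsub
      rw [integral_omega] at h1
      rw [← setIntegral_eq_integral_of_forall_compl_eq_zero (s := Ioi 0)]
      · rw [← h1]
        congr 1; ext y
        rw [smul_comm]
      · intro y hy
        rw [image_eq_zero_of_notMem_tsupport fun h => hy (hsub h), zero_smul]
  have h2 : (fun y : ℝ => (y ^ a) • d y) =ᵐ[volume.restrict (Ioi 0)] fun _ => 0 :=
    (ae_restrict_iff' measurableSet_Ioi).2 key
  have h3 := Measure.eqOn_open_of_ae_eq h2 isOpen_Ioi hcont continuousOn_const hx
  have h4 : x ^ a ≠ 0 := (Real.rpow_pos_of_pos hx a).ne'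
  exact (smul_eq_zero.1 h3).resolve_left h4

lemma eq_zero_of_integral_gauss_eq_zero {a : ℝ} {d : ℝ → ℂ} (hd : ContinuousOn d (Ioi 0))
    (hi : Integrable (fun y => d y * gauss 1 y) (omega a))
    (h0 : ∀ n : ℕ, 1 ≤ n → ∫ y, d y * gauss n y ∂(omega a) = 0) {x : ℝ} (hx : 0 < x) : d x = 0 :=
  eq_zero_of_integral_smul_eq_zero hd
    (fun _ hg hs _ => integral_smul_eq_zero_of_gauss hi h0 hg.continuous hs) hx

/-! ### The free evolution -/

/-- The factor `exp (-i t ξ ^ 2)`. -/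
def phase (t ξ : ℝ) : ℂ := Complex.exp (-(Complex.I * t) * (ξ : ℂ) ^ 2)

lemma norm_phase (t ξ : ℝ) : ‖phase t ξ‖ = 1 := by
  rw [phase, Complex.norm_exp]
  simp [← Complex.ofReal_pow]

lemma continuous_phase : Continuous fun q : ℝ × ℝ => phase q.1 q.2 := by
  unfold phase; fun_prop

lemma phase_mul_gauss (t : ℝ) (z : ℂ) (ξ : ℝ) :
    phase t ξ * gauss z ξ = gauss (z + Complex.I * t) ξ := by
  rw [phase, gauss, gauss, ← Complex.exp_add]; ring_nf

lemma chain_phase {r : ι → ℝ} {M : ℝ} (hr : ∀ i, |r i| ≤ M) (n : ℕ) :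
    Chain PolyBdd n (fun i => phase (r i)) := by
  have := chain_exp (c := fun i => -(Complex.I * r i)) (k := fun _ : ι => 1) (M := M) (K := 1)
    (fun i => by simpa using hr i) (fun i => by simp) (fun i => by simp) n
  have e : (fun i => phase (r i)) =
      fun i (x : ℝ) => 1 * Complex.exp (-(Complex.I * r i) * (x : ℂ) ^ 2) := by
    ext i x; rw [one_mul, phase]
  rwa [e]

lemma SchwartzFamily.phase_mul {φ : ι → ℝ → ℂ} (h : SchwartzFamily φ) {r : ι → ℝ} {M : ℝ}
    (hr : ∀ i, |r i| ≤ M) : SchwartzFamily (fun i x => phase (r i) x * φ i x) := fun n => by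
  simpa only [mul_comm] using (h n).mul (chain_phase hr n)

/-- The free evolution `h (exp (-i t ξ ^ 2) A)`, where `h` is the Hankel transform. -/
def evol (a t : ℝ) (A : ℝ → ℂ) : ℝ → ℂ := hankel a fun ξ => phase t ξ * A ξ

/-- The evolution is transform, multiplication, transform, and each factor is symmetric for the
bilinear pairing (no conjugation). This lets it be moved onto a Gaussian test function. -/
lemma integral_evol_mul {a : ℝ} (ha : -1 < a) (t : ℝ) {φ ψ : ℝ → ℂ}
    (h : SchwartzFamily fun _ : Unit => φ) (h' : SchwartzFamily fun _ : Unit => ψ) :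
    ∫ x, evol a t (hankel a φ) x * ψ x ∂(omega a) =
      ∫ x, φ x * evol a t (hankel a ψ) x ∂(omega a) := by
  have g := h.hankel ha
  have g' := h'.hankel ha
  have p := g.phase_mul (r := fun _ => t) (M := |t|) (fun _ => le_rfl)
  have p' := g'.phase_mul (r := fun _ => t) (M := |t|) (fun _ => le_rfl)
  have e1 := integral_hankel_mul ha 1 p.rapidDecay h'.rapidDecay (p.continuousOn ())
    (h'.continuousOn ())
  have e2 := integral_hankel_mul ha 1 h.rapidDecay p'.rapidDecay (h.continuousOn ())
    (p'.continuousOn ())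
  simp only [one_mul] at e1 e2
  rw [evol, evol, e1, ← e2]
  congr 1; ext x; ring

/-- The transform of a Gaussian is a Gaussian, the phase shifts its parameter by `i t` inside the
right half-plane, and a second transform applies. -/
lemma evol_gauss {a : ℝ} (ha : -1 < a) (t : ℝ) {r : ℝ} (hr : 0 < r) (x : ℝ) :
    evol a t (hankel a (gauss r)) x =
      (((2:ℝ) ^ (-((a + 1) / 2)) : ℝ) : ℂ) * ((r : ℂ)) ^ (-(((a + 1) / 2 : ℝ) : ℂ)) *
      ((((2:ℝ) ^ (-((a + 1) / 2)) : ℝ) : ℂ) *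
        (1 / (4 * r) + Complex.I * t) ^ (-(((a + 1) / 2 : ℝ) : ℂ)) *
      Complex.exp (-(x : ℂ) ^ 2 / (4 * (1 / (4 * r) + Complex.I * t)))) := by
  have e1 : (fun ξ => phase t ξ * hankel a (gauss r) ξ) = fun ξ =>
      (((2:ℝ) ^ (-((a + 1) / 2)) : ℝ) : ℂ) * ((r : ℂ)) ^ (-(((a + 1) / 2 : ℝ) : ℂ)) *
        gauss (1 / (4 * r) + Complex.I * t) ξ := by
    ext ξ
    rw [hankel_gauss ha (by simpa using hr), ← phase_mul_gauss]
    have : Complex.exp (-(ξ : ℂ) ^ 2 / (4 * r)) = gauss (1 / (4 * r)) ξ := by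
      rw [gauss]; ring_nf
    rw [this]; ring
  rw [evol, e1]
  have hre : 0 < (1 / (4 * (r : ℂ)) + Complex.I * t).re := by
    have : (1 / (4 * (r : ℂ))) = ((1 / (4 * r) : ℝ) : ℂ) := by push_cast; ring
    rw [this]; simp; positivity
  rw [← hankel_gauss ha hre x, hankel, hankel, ← integral_const_mul]
  congr 1; ext y; ring

lemma SchwartzFamily.integrable_mul_gauss {a : ℝ} (ha : -1 < a) {d : ℝ → ℂ}
    (h : SchwartzFamily fun _ : Unit => d) {z : ℂ} (hz : 0 < z.re) :
    Integrable (fun y => d y * gauss z y) (omega a) :=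
  (h.rapidDecay.mul (rapidDecay_gauss hz).polyBdd).integrable ha ()
    ((h.continuousOn ()).mul (continuous_gauss z).continuousOn)

/-- Hankel inversion. -/
lemma hankel_hankel {a : ℝ} (ha : -1 < a) {φ : ℝ → ℂ} (h : SchwartzFamily fun _ : Unit => φ)
    {x : ℝ} (hx : 0 < x) : hankel a (hankel a φ) x = φ x := by
  have hev : ∀ ψ, evol a 0 (hankel a ψ) = hankel a (hankel a ψ) := fun ψ => by
    simp [evol, phase]
  have hh := (h.hankel ha).hankel ha
  -- Tested against `exp (-n y ^ 2)`, symmetry moves the double transform onto the Gaussian, which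
  -- `evol_gauss` at time `0` returns unchanged.
  refine sub_eq_zero.1 (eq_zero_of_integral_gauss_eq_zero (a := a)
    (d := fun x => hankel a (hankel a φ) x - φ x) ((hh.continuousOn ()).sub (h.continuousOn ()))
    ?_ (fun n hn => ?_) hx)
  · simp only [sub_mul]
    exact (hh.integrable_mul_gauss ha (by simp)).sub (h.integrable_mul_gauss ha (by simp))
  · have hn : (0:ℝ) < n := by exact_mod_cast hn
    have hz : 0 < ((n : ℂ)).re := by simpa using hn
    simp only [sub_mul]
    rw [integral_sub (hh.integrable_mul_gauss ha hz) (h.integrable_mul_gauss ha hz), ← hev,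
      integral_evol_mul ha 0 h (schwartzFamily_gauss hz), sub_eq_zero]
    congr 1; ext y
    congr 1
    have := evol_gauss ha 0 hn y
    rw [Complex.ofReal_natCast] at this
    rw [this]
    have e1 : (1 / (4 * (n : ℂ)) + Complex.I * ((0:ℝ) : ℂ)) = ((1 / (4 * n) : ℝ) : ℂ) := by
      push_cast; ring
    rw [e1, ← Complex.ofReal_natCast, ← Complex.ofReal_neg,
      ← Complex.ofReal_cpow hn.le, ← Complex.ofReal_cpow (by positivity)]
    have e2 : (2:ℝ) ^ (-((a + 1) / 2)) * (n:ℝ) ^ (-((a + 1) / 2)) *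
        ((2:ℝ) ^ (-((a + 1) / 2)) * (1 / (4 * n)) ^ (-((a + 1) / 2))) = 1 := by
      rw [← Real.mul_rpow (by positivity) (by positivity),
        ← Real.mul_rpow (by positivity) (by positivity),
        ← Real.mul_rpow (by positivity) (by positivity)]
      have : (2 * (n:ℝ) * (2 * (1 / (4 * n)))) = 1 := by field_simp; norm_num
      rw [this, Real.one_rpow]
    have e3 : Complex.exp (-(y : ℂ) ^ 2 / (4 * ((1 / (4 * n) : ℝ) : ℂ))) = gauss (n : ℝ) y := by
      rw [gauss]
      congr 1
      have : (n : ℂ) ≠ 0 := by exact_mod_cast hn.ne'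
      push_cast
      field_simp
    rw [e3, ← mul_assoc]
    have e2' := congrArg (fun r : ℝ => (r : ℂ)) e2
    push_cast at e2' ⊢
    linear_combination gauss n y * e2'

/-! ### The kernel of the free evolution -/

/-- With the principal branch, `log (± i) = ± i π / 2`. So the two cases in the definition of
`kernelS` carry one and the same constant `(2 i t) ^ (-(a + 1) / 2)`. -/
lemma cpow_two_I_mul_of_pos {s t : ℝ} (ht : 0 < t) :
    (2 * Complex.I * t) ^ (-(s : ℂ)) =
      Complex.exp (-(Complex.I * ((s * Real.pi / 2 : ℝ) : ℂ))) / (((2 * |t|) ^ s : ℝ) : ℂ) := by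
  have h2 : 0 < 2 * t := by positivity
  have e : (2 * Complex.I * t : ℂ) = ((2 * t : ℝ) : ℂ) * Complex.I := by push_cast; ring
  rw [e, Complex.cpow_def_of_ne_zero (by simp [ht.ne']), Complex.log_ofReal_mul h2 Complex.I_ne_zero,
    Complex.log_I, abs_of_pos ht, Real.rpow_def_of_pos h2, Complex.ofReal_exp, ← Complex.exp_sub]
  congr 1
  push_cast; ring

lemma cpow_two_I_mul_of_neg {s t : ℝ} (ht : t < 0) :
    (2 * Complex.I * t) ^ (-(s : ℂ)) =
      Complex.exp (Complex.I * ((s * Real.pi / 2 : ℝ) : ℂ)) / (((2 * |t|) ^ s : ℝ) : ℂ) := by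
  have h2 : 0 < 2 * -t := by linarith
  have e : (2 * Complex.I * t : ℂ) = ((2 * -t : ℝ) : ℂ) * -Complex.I := by push_cast; ring
  rw [e, Complex.cpow_def_of_ne_zero (by simp [ht.ne]), Complex.log_ofReal_mul h2
    (neg_ne_zero.2 Complex.I_ne_zero),
    Complex.log_neg_I, abs_of_neg ht, Real.rpow_def_of_pos h2, Complex.ofReal_exp, ← Complex.exp_sub]
  congr 1
  push_cast; ring

/-- Here `phase (-(1 / (4 t))) x` is the chirp `exp (i x ^ 2 / (4 t))`. The factorisation treats
both signs of `t` at once and reduces integrals against the kernel to Hankel transforms. -/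
lemma kernelS_eq {a x y t : ℝ} (hx : 0 < x) (hy : 0 < y) (ht : t ≠ 0) :
    kernelS a x y t = (2 * Complex.I * t) ^ (-(((a + 1) / 2 : ℝ) : ℂ)) *
      phase (-(1 / (4 * t))) x * ((besselE a ((1 / (2 * |t|)) * x * y) : ℂ) *
        phase (-(1 / (4 * t))) y) := by
  have ht' : (t : ℂ) ≠ 0 := by exact_mod_cast ht
  have hpos : 0 < x * y / (2 * |t|) := by
    have := abs_pos.2 ht
    positivity
  have e0 : (1 / (2 * |t|)) * x * y = x * y / (2 * |t|) := by ring
  have e1 : (a + 1) / 2 * Real.pi / 2 = (a + 1) * Real.pi / 4 := by ring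
  rw [e0]
  rcases lt_or_gt_of_ne ht with h | h
  · rw [kernelS, if_pos h, rpow_mul_besselJ hpos, cpow_two_I_mul_of_neg h, e1, abs_of_neg h]
    have e2 : Complex.exp (-(Complex.I * (((x ^ 2 + y ^ 2) / (4 * -t) : ℝ) : ℂ))) =
        phase (-(1 / (4 * t))) x * phase (-(1 / (4 * t))) y := by
      rw [phase, phase, ← Complex.exp_add]
      congr 1
      push_cast
      field_simp
    rw [e2]; ring
  · rw [kernelS, if_neg (not_lt.2 h.le), if_pos h, rpow_mul_besselJ hpos, cpow_two_I_mul_of_pos h,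
      e1, abs_of_pos h]
    have e2 : Complex.exp (Complex.I * (((x ^ 2 + y ^ 2) / (4 * t) : ℝ) : ℂ)) =
        phase (-(1 / (4 * t))) x * phase (-(1 / (4 * t))) y := by
      rw [phase, phase, ← Complex.exp_add]
      congr 1
      push_cast
      field_simp
    rw [e2]; ring

lemma SchwartzFamily.phase_mul_single {φ : ℝ → ℂ} (h : SchwartzFamily fun _ : Unit => φ) (t : ℝ) :
    SchwartzFamily fun (_ : Unit) x => phase t x * φ x :=
  h.phase_mul (r := fun _ => t) (M := |t|) (fun _ => le_rfl)

lemma integrable_kernelS_mul {a : ℝ} (ha : -1 < a) {φ : ℝ → ℂ}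
    (h : SchwartzFamily fun _ : Unit => φ) {x t : ℝ} (hx : 0 < x) (ht : t ≠ 0) :
    Integrable (fun y => kernelS a x y t * φ y) (omega a) := by
  have p := h.phase_mul_single (-(1 / (4 * t)))
  have := ((p.rapidDecay.integrable_hankel ha ha () (p.continuousOn ())
    ((1 / (2 * |t|)) * x)).const_mul ((2 * Complex.I * t) ^ (-(((a + 1) / 2 : ℝ) : ℂ)) *
      phase (-(1 / (4 * t))) x))
  refine this.congr (ae_omega_of_forall_pos a fun y hy => ?_)
  simp only [kernelS_eq hx hy ht]
  ring

lemma integral_kernelS_mul_eq {a : ℝ} {φ : ℝ → ℂ} {x t : ℝ} (hx : 0 < x) (ht : t ≠ 0) :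
    ∫ y, kernelS a x y t * φ y ∂(omega a) = (2 * Complex.I * t) ^ (-(((a + 1) / 2 : ℝ) : ℂ)) *
      (phase (-(1 / (4 * t))) x *
        hankel a (fun y => phase (-(1 / (4 * t))) y * φ y) ((1 / (2 * |t|)) * x)) := by
  rw [hankel, ← mul_assoc, ← integral_const_mul]
  refine integral_congr_ae (ae_omega_of_forall_pos a fun y hy => ?_)
  simp only [kernelS_eq hx hy ht]
  ring

/-- The arguments are at most `π / 2` and strictly less than `π / 2` in absolute value, so their sum
does not cross the branch cut. -/
lemma log_mul_of_re_pos {t : ℝ} (ht : t ≠ 0) {w : ℂ} (hw : 0 < w.re) :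
    Complex.log (2 * Complex.I * t * w) = Complex.log (2 * Complex.I * t) + Complex.log w := by
  have hw0 : w ≠ 0 := fun h => by simp [h] at hw
  have h1 : 2 * Complex.I * (t : ℂ) ≠ 0 := by simp [ht]
  refine Complex.log_mul h1 hw0 ?_
  have h2 : |w.arg| < Real.pi / 2 := Complex.abs_arg_lt_pi_div_two_iff.2 (Or.inl hw)
  have h3 : |(2 * Complex.I * (t : ℂ)).arg| ≤ Real.pi / 2 :=
    Complex.abs_arg_le_pi_div_two_iff.2 (by simp)
  rw [abs_lt] at h2
  rw [abs_le] at h3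
  constructor <;> linarith [h2.1, h2.2, h3.1, h3.2]

/-- The identity `2 i t (r - i / (4 t)) = 2 r (1 / (4 r) + i t)` raised to the power `-s`. Passing
to logarithms is legitimate because both brackets have positive real part. -/
lemma kernel_const_eq (s : ℝ) {t r : ℝ} (ht : t ≠ 0) (hr : 0 < r) :
    (2 * Complex.I * t) ^ (-(s : ℂ)) *
      ((((2:ℝ) ^ (-s) : ℝ) : ℂ) * (r - Complex.I / (4 * t)) ^ (-(s : ℂ))) =
    (((2:ℝ) ^ (-s) : ℝ) : ℂ) * (r : ℂ) ^ (-(s : ℂ)) *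
      ((((2:ℝ) ^ (-s) : ℝ) : ℂ) * (1 / (4 * r) + Complex.I * t) ^ (-(s : ℂ))) := by
  have ht' : (t : ℂ) ≠ 0 := by exact_mod_cast ht
  have hr' : (r : ℂ) ≠ 0 := by exact_mod_cast hr.ne'
  have e1 : (r - Complex.I / (4 * t) : ℂ).re = r := by
    have : (Complex.I / (4 * t) : ℂ) = ((1 / (4 * t) : ℝ) : ℂ) * Complex.I := by
      push_cast; field_simp
    rw [this]; simp
  have e2 : (1 / (4 * r) + Complex.I * t : ℂ).re = 1 / (4 * r) := by
    have : (1 / (4 * (r : ℂ))) = ((1 / (4 * r) : ℝ) : ℂ) := by push_cast; ring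
    rw [this]; simp
  have h1 : (r - Complex.I / (4 * t) : ℂ) ≠ 0 := fun h => by
    rw [h] at e1; simp at e1; linarith
  have h2 : (1 / (4 * r) + Complex.I * t : ℂ) ≠ 0 := fun h => by
    rw [h] at e2; simp at e2; linarith
  have key := log_mul_of_re_pos ht (w := r - Complex.I / (4 * t)) (by rw [e1]; exact hr)
  have e3 : 2 * Complex.I * t * (r - Complex.I / (4 * t)) =
      ((2 * r : ℝ) : ℂ) * (1 / (4 * r) + Complex.I * t) := by
    push_cast
    field_simp
    ring_nf
    simp
    ring
  rw [e3, Complex.log_ofReal_mul (by positivity) h2, Real.log_mul two_ne_zero hr.ne'] at key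
  rw [Complex.cpow_def_of_ne_zero (by simp [ht]), Complex.cpow_def_of_ne_zero h1,
    Complex.cpow_def_of_ne_zero h2, Complex.cpow_def_of_ne_zero hr', Real.rpow_def_of_pos two_pos,
    Complex.ofReal_exp, ← Complex.ofReal_log hr.le]
  simp only [← Complex.exp_add]
  congr 1
  push_cast at key ⊢
  linear_combination (s : ℂ) * key

lemma evol_gauss_eq_kernel {a : ℝ} (ha : -1 < a) {t r : ℝ} (ht : t ≠ 0) (hr : 0 < r) (x : ℝ) :
    evol a t (hankel a (gauss r)) x = (2 * Complex.I * t) ^ (-(((a + 1) / 2 : ℝ) : ℂ)) *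
      (phase (-(1 / (4 * t))) x *
        hankel a (fun y => phase (-(1 / (4 * t))) y * gauss r y) ((1 / (2 * |t|)) * x)) := by
  have ht' : (t : ℂ) ≠ 0 := by exact_mod_cast ht
  have hr' : (r : ℂ) ≠ 0 := by exact_mod_cast hr.ne'
  have e0 : (fun y => phase (-(1 / (4 * t))) y * gauss r y) =
      gauss (r - Complex.I / (4 * t)) := by
    ext y
    rw [phase_mul_gauss]
    congr 1
    push_cast; ring
  have e1 : (r - Complex.I / (4 * t) : ℂ).re = r := by
    have : (Complex.I / (4 * t) : ℂ) = ((1 / (4 * t) : ℝ) : ℂ) * Complex.I := by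
      push_cast; field_simp
    rw [this]; simp
  have e2 : (1 / (4 * r) + Complex.I * t : ℂ).re = 1 / (4 * r) := by
    have : (1 / (4 * (r : ℂ))) = ((1 / (4 * r) : ℝ) : ℂ) := by push_cast; ring
    rw [this]; simp
  have h1 : (r - Complex.I / (4 * t) : ℂ) ≠ 0 := fun h => by
    rw [h] at e1; simp at e1; linarith
  have h2 : (1 / (4 * r) + Complex.I * t : ℂ) ≠ 0 := fun h => by
    rw [h] at e2; simp at e2; linarith
  have hexp : phase (-(1 / (4 * t))) x *
      Complex.exp (-(((1 / (2 * |t|)) * x : ℝ) : ℂ) ^ 2 / (4 * (r - Complex.I / (4 * t)))) =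
      Complex.exp (-(x : ℂ) ^ 2 / (4 * (1 / (4 * r) + Complex.I * t))) := by
    rw [phase, ← Complex.exp_add]
    congr 1
    have e3 : (((1 / (2 * |t|)) * x : ℝ) : ℂ) ^ 2 = (x : ℂ) ^ 2 / (4 * t ^ 2) := by
      rw [← Complex.ofReal_pow, mul_pow, div_pow, mul_pow, sq_abs]
      push_cast; ring
    rw [e3]
    have h1' : 4 * (t : ℂ) * r - Complex.I ≠ 0 := by
      intro h; apply h1; field_simp; linear_combination h
    have h2' : 1 + 4 * r * Complex.I * t ≠ 0 := by
      intro h; apply h2; field_simp; linear_combination h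
    have e4 : (r - Complex.I / (4 * t) : ℂ) = (4 * (t : ℂ) * r - Complex.I) / (4 * t) := by
      field_simp
    have e5 : (1 / (4 * r) + Complex.I * t : ℂ) = (1 + 4 * r * Complex.I * t) / (4 * r) := by
      field_simp
    have e6 : 1 + 4 * r * Complex.I * t = Complex.I * (4 * (t : ℂ) * r - Complex.I) := by
      ring_nf; simp; ring
    rw [e4, e5, e6]
    have hI := Complex.I_sq
    push_cast
    field_simp
    linear_combination ((x : ℂ) ^ 2 * (4 * t * r - Complex.I)) * hI
  rw [e0, hankel_gauss ha (by rw [e1]; exact hr), evol_gauss ha t hr, ← hexp]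
  have := kernel_const_eq ((a + 1) / 2) ht hr
  linear_combination -(phase (-(1 / (4 * t))) x * Complex.exp (-(((1 / (2 * |t|)) * x : ℝ) : ℂ) ^ 2 /
    (4 * (r - Complex.I / (4 * t))))) * this

/-- The free evolution is given by the kernel. -/
lemma integral_kernelS_mul {a : ℝ} (ha : -1 < a) {φ : ℝ → ℂ}
    (h : SchwartzFamily fun _ : Unit => φ) {x t : ℝ} (hx : 0 < x) (ht : t ≠ 0) :
    ∫ y, kernelS a x y t * φ y ∂(omega a) = evol a t (hankel a φ) x := by
  set c := (2 * Complex.I * t) ^ (-(((a + 1) / 2 : ℝ) : ℂ)) with hc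
  set τ := -(1 / (4 * t)) with hτ
  set l := 1 / (2 * |t|) with hl
  have hl0 : 0 < l := by have := abs_pos.2 ht; positivity
  have he : SchwartzFamily fun _ : Unit => evol a t (hankel a φ) :=
    ((h.hankel ha).phase_mul_single t).hankel ha
  have p := h.phase_mul_single τ
  have hkc : Continuous fun x => c * (phase τ x * hankel a (fun y => phase τ y * φ y) (l * x)) := by
    have h1 := p.rapidDecay.continuous_hankel_single ha () (p.continuousOn ())
    have h2 : Continuous (phase τ) := by unfold phase; fun_prop
    fun_prop
  -- Polynomial growth of the kernel side is all that testing against Gaussians requires.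
  have hbd : PolyBdd fun (_ : Unit) x =>
      c * (phase τ x * hankel a (fun y => phase τ y * φ y) (l * x)) := by
    obtain ⟨C, hC0, hC⟩ := p.rapidDecay.norm_hankel_le ha
    refine ⟨2, ‖c‖ * (C * (1 + |l|) ^ 2), fun _ x hx => ?_⟩
    rw [norm_mul, norm_mul, norm_phase, one_mul]
    calc _ ≤ ‖c‖ * (C * (1 + |l * x|) ^ 2) := by gcongr; exact hC () _
      _ ≤ ‖c‖ * (C * ((1 + |l|) * (1 + x)) ^ 2) := by gcongr; exact one_add_abs_mul_le hx
      _ = _ := by ring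
  have hki : ∀ {z : ℂ}, 0 < z.re → Integrable (fun x =>
      c * (phase τ x * hankel a (fun y => phase τ y * φ y) (l * x)) * gauss z x) (omega a) := by
    intro z hz
    have := ((rapidDecay_gauss hz).mul hbd).integrable ha ()
      ((continuous_gauss z).mul hkc).continuousOn
    simpa only [mul_comm] using this
  rw [integral_kernelS_mul_eq hx ht]
  -- Both operators are symmetric, so the comparison moves to Gaussians, where it is
  -- `evol_gauss_eq_kernel`.
  refine sub_eq_zero.1 (eq_zero_of_integral_gauss_eq_zero (a := a)
    (d := fun x => c * (phase τ x * hankel a (fun y => phase τ y * φ y) (l * x)) -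
      evol a t (hankel a φ) x) (hkc.continuousOn.sub (he.continuousOn ())) ?_ (fun n hn => ?_) hx)
  · simp only [sub_mul]
    exact (hki (by simp)).sub (he.integrable_mul_gauss ha (by simp))
  · have hn : (0:ℝ) < n := by exact_mod_cast hn
    have hz : 0 < ((n : ℂ)).re := by simpa using hn
    have pg := (schwartzFamily_gauss hz).phase_mul_single τ
    simp only [sub_mul]
    rw [integral_sub (hki hz) (he.integrable_mul_gauss ha hz),
      integral_evol_mul ha t h (schwartzFamily_gauss hz), sub_eq_zero]
    have e1 := integral_hankel_mul ha l p.rapidDecay pg.rapidDecay (p.continuousOn ())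
      (pg.continuousOn ())
    have e2 : ∀ y, evol a t (hankel a (gauss (n : ℂ))) y =
        c * (phase τ y * hankel a (fun y => phase τ y * gauss (n : ℂ) y) (l * y)) := fun y => by
      have := evol_gauss_eq_kernel ha ht hn y
      rwa [Complex.ofReal_natCast] at this
    calc _ = c * ∫ x, hankel a (fun y => phase τ y * φ y) (l * x) * (phase τ x * gauss n x)
          ∂(omega a) := by
          rw [← integral_const_mul]; congr 1; ext x; ring
      _ = _ := by
        rw [e1, ← integral_const_mul]
        congr 1; ext x
        rw [e2]; ring

/-! ### The solution on the Fourier–Hankel side -/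

/-- Hankel transforms `A` of an initial value and `G s` of a source at time `s`. -/
structure SourceData (A : ℝ → ℂ) (G : ℝ → ℝ → ℂ) : Prop where
  initial : SchwartzFamily fun _ : Unit => A
  source : SchwartzFamily G
  continuous_source : Continuous fun q : ℝ × ℝ => G q.1 q.2

lemma SourceData.sq_mul {A : ℝ → ℂ} {G : ℝ → ℝ → ℂ} (h : SourceData A G) :
    SourceData (fun ξ => ((ξ ^ 2 : ℝ) : ℂ) * A ξ) (fun s ξ => ((ξ ^ 2 : ℝ) : ℂ) * G s ξ) where
  initial := h.initial.sq_mul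
  source := h.source.sq_mul
  continuous_source := by have := h.continuous_source; fun_prop

/-- The solution of `∂ₜ v = -i ξ ^ 2 v + G t ξ`, `v 0 = A ξ`. -/
def duhamel (A : ℝ → ℂ) (G : ℝ → ℝ → ℂ) (t ξ : ℝ) : ℂ :=
  phase t ξ * (A ξ + ∫ s in (0:ℝ)..t, phase (-s) ξ * G s ξ)

lemma duhamel_sq_mul (A : ℝ → ℂ) (G : ℝ → ℝ → ℂ) (t ξ : ℝ) :
    duhamel (fun ξ => ((ξ ^ 2 : ℝ) : ℂ) * A ξ) (fun s ξ => ((ξ ^ 2 : ℝ) : ℂ) * G s ξ) t ξ =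
      ((ξ ^ 2 : ℝ) : ℂ) * duhamel A G t ξ := by
  have e : ∀ s, phase (-s) ξ * (((ξ ^ 2 : ℝ) : ℂ) * G s ξ) =
      ((ξ ^ 2 : ℝ) : ℂ) * (phase (-s) ξ * G s ξ) := fun s => by ring
  simp only [duhamel, e, intervalIntegral.integral_const_mul]
  ring

lemma phase_mul_phase (t s ξ : ℝ) : phase t ξ * phase s ξ = phase (t + s) ξ := by
  rw [phase, phase, phase, ← Complex.exp_add]; push_cast; ring_nf

lemma hasDerivAt_phase (t ξ : ℝ) :
    HasDerivAt (fun t => phase t ξ) (-(Complex.I * ((ξ ^ 2 : ℝ) : ℂ)) * phase t ξ) t := by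
  have h1 : HasDerivAt (fun x : ℝ => (x : ℂ)) 1 t := Complex.ofRealCLM.hasDerivAt
  have h2 : HasDerivAt (fun t : ℝ => -(Complex.I * (t : ℂ)) * (ξ : ℂ) ^ 2)
      (-(Complex.I * 1) * (ξ : ℂ) ^ 2) t := ((h1.const_mul Complex.I).neg).mul_const ((ξ : ℂ) ^ 2)
  refine h2.cexp.congr_deriv ?_
  rw [phase]; push_cast; ring

section

variable {A : ℝ → ℂ} {G : ℝ → ℝ → ℂ}

lemma SourceData.continuous_integrand (h : SourceData A G) :
    Continuous fun q : ℝ × ℝ => phase (-q.2) q.1 * G q.2 q.1 := by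
  have h1 := h.continuous_source
  have h2 := continuous_phase
  exact (h2.comp (by fun_prop : Continuous fun q : ℝ × ℝ => (-q.2, q.1))).mul
    (h1.comp (by fun_prop : Continuous fun q : ℝ × ℝ => (q.2, q.1)))

lemma SourceData.hasDerivAt_duhamel (h : SourceData A G) (t ξ : ℝ) :
    HasDerivAt (fun t => duhamel A G t ξ)
      (-Complex.I * (((ξ ^ 2 : ℝ) : ℂ) * duhamel A G t ξ) + G t ξ) t := by
  have hc : Continuous fun s => phase (-s) ξ * G s ξ :=
    h.continuous_integrand.comp (f := fun s : ℝ => (ξ, s)) (Continuous.prodMk_right ξ)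
  have h1 := (hc.integral_hasStrictDerivAt 0 t).hasDerivAt
  refine ((hasDerivAt_phase t ξ).mul (h1.const_add (A ξ))).congr_deriv ?_
  have e : phase t ξ * phase (-t) ξ = 1 := by
    rw [phase_mul_phase]; simp [phase]
  rw [duhamel]
  linear_combination G t ξ * e

lemma SourceData.continuousOn_duhamel (h : SourceData A G) (t : ℝ) :
    ContinuousOn (duhamel A G t) (Ioi 0) := by
  have h1 : Continuous fun ξ => ∫ s in (0:ℝ)..t, phase (-s) ξ * G s ξ :=
    intervalIntegral.continuous_parametric_intervalIntegral_of_continuous'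
      h.continuous_integrand 0 t
  have h2 : Continuous (phase t) := by unfold phase; fun_prop
  exact h2.continuousOn.mul ((h.initial.continuousOn ()).add h1.continuousOn)

lemma SourceData.rapidDecay_duhamel (h : SourceData A G) (T : ℝ) :
    RapidDecay fun t : {t : ℝ // |t| ≤ T} => duhamel A G t := by
  refine RapidDecay.of_bound fun m => ?_
  obtain ⟨C, hC0, hC⟩ := h.initial.rapidDecay.exists_bound m
  obtain ⟨C', hC0', hC'⟩ := h.source.rapidDecay.exists_bound m
  refine ⟨C + C' * T, fun ⟨t, ht⟩ ξ hξ => ?_⟩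
  have h1 : ‖∫ s in (0:ℝ)..t, phase (-s) ξ * G s ξ‖ ≤ C' * ((1 + ξ) ^ m)⁻¹ * |t - 0| :=
    intervalIntegral.norm_integral_le_of_norm_le_const fun s _ => by
      rw [norm_mul, norm_phase, one_mul]; exact hC' s ξ hξ
  rw [sub_zero] at h1
  rw [duhamel, norm_mul, norm_phase, one_mul]
  calc _ ≤ ‖A ξ‖ + ‖∫ s in (0:ℝ)..t, phase (-s) ξ * G s ξ‖ := norm_add_le _ _
    _ ≤ C * ((1 + ξ) ^ m)⁻¹ + C' * ((1 + ξ) ^ m)⁻¹ * T := by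
      refine add_le_add (hC () ξ hξ) (h1.trans ?_)
      gcongr
    _ = _ := by ring

/-- The solution of the Cauchy problem with data having Hankel transforms `A` and `G`. -/
def solution (a : ℝ) (A : ℝ → ℂ) (G : ℝ → ℝ → ℂ) (x t : ℝ) : ℂ := hankel a (duhamel A G t) x

lemma SourceData.rapidDecay_duhamel_single (h : SourceData A G) (t : ℝ) :
    RapidDecay fun _ : Unit => duhamel A G t :=
  (h.rapidDecay_duhamel |t|).comp fun _ => ⟨t, le_rfl⟩

/-- The factor `ξ ^ 2` produced by `∂ₜ` passes into the data, so the time derivative is again built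
from a function of the form `solution` and the lemma can be iterated. -/
lemma SourceData.hasDerivAt_solution (h : SourceData A G) {a : ℝ} (ha : -1 < a) (x t : ℝ) :
    HasDerivAt (fun t => solution a A G x t)
      (-Complex.I * solution a (fun ξ => ((ξ ^ 2 : ℝ) : ℂ) * A ξ)
        (fun s ξ => ((ξ ^ 2 : ℝ) : ℂ) * G s ξ) x t + hankel a (G t) x) t := by
  set T := |t| + 1 with hT
  have hconst : PolyBdd fun (_ : {t : ℝ // |t| ≤ T}) (_ : ℝ) => -Complex.I :=
    ⟨0, 1, fun _ _ _ => by simp⟩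
  have hR : RapidDecay fun (t : {t : ℝ // |t| ≤ T}) ξ =>
      ((ξ ^ 2 : ℝ) : ℂ) * duhamel A G t ξ * -Complex.I + G t ξ :=
    ((h.rapidDecay_duhamel T).sq_mul.mul hconst).add
      (h.source.rapidDecay.comp fun t : {t : ℝ // |t| ≤ T} => (t : ℝ))
  obtain ⟨C, hC0, hC⟩ := hR.norm_besselE_mul_le ha (decayExp a)
  have hsqc : ContinuousOn (fun ξ : ℝ => ((ξ ^ 2 : ℝ) : ℂ) * duhamel A G t ξ) (Ioi 0) :=
    (Continuous.continuousOn (by fun_prop)).mul (h.continuousOn_duhamel t)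
  have hcont : ContinuousOn (fun ξ : ℝ =>
      ((ξ ^ 2 : ℝ) : ℂ) * duhamel A G t ξ * -Complex.I + G t ξ) (Ioi 0) :=
    (hsqc.mul continuousOn_const).add (h.source.continuousOn t)
  have key := (hasDerivAt_integral_of_dominated_loc_of_deriv_le (μ := omega a) (𝕜 := ℝ)
    (F := fun t ξ => (besselE a (x * ξ) : ℂ) * duhamel A G t ξ)
    (F' := fun t ξ => (besselE a (x * ξ) : ℂ) *
      (((ξ ^ 2 : ℝ) : ℂ) * duhamel A G t ξ * -Complex.I + G t ξ))
    (bound := fun ξ => C * (1 + |x|) ^ 2 * ((1 + ξ) ^ decayExp a)⁻¹)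
    (x₀ := t) (Metric.ball_mem_nhds t one_pos)
    (Eventually.of_forall fun t => aestronglyMeasurable_omega
      (continuousOn_besselE_mul ha (h.continuousOn_duhamel t) x))
    ((h.rapidDecay_duhamel_single t).integrable_hankel ha ha () (h.continuousOn_duhamel t) x)
    (aestronglyMeasurable_omega (continuousOn_besselE_mul ha hcont x))
    (ae_omega_of_forall_pos a fun ξ hξ s hs => ?_)
    ((integrable_decay ha le_rfl).const_mul _)
    (ae_omega_of_forall_pos a fun ξ hξ s hs => ?_)).2
  · refine key.congr_deriv ?_
    have i1 := ((h.rapidDecay_duhamel_single t).sq_mul.integrable_hankel ha ha () hsqc x).const_mul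
      (-Complex.I)
    have i2 := h.source.rapidDecay.integrable_hankel ha ha t (h.source.continuousOn t) x
    have e : solution a (fun ξ => ((ξ ^ 2 : ℝ) : ℂ) * A ξ) (fun s ξ => ((ξ ^ 2 : ℝ) : ℂ) * G s ξ)
        x t = ∫ ξ : ℝ, (besselE a (x * ξ) : ℂ) * (((ξ ^ 2 : ℝ) : ℂ) * duhamel A G t ξ)
          ∂(omega a) := by
      simp only [solution, hankel, duhamel_sq_mul]
    rw [e, hankel, ← integral_const_mul, ← integral_add i1 i2]
    congr 1; ext ξ; ring
  · have hs' : |s| ≤ T := by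
      have : |s - t| < 1 := by simpa [Real.dist_eq] using hs
      have := abs_sub_abs_le_abs_sub s t
      linarith
    exact hC ⟨s, hs'⟩ x ξ hξ
  · refine ((h.hasDerivAt_duhamel s ξ).const_mul _).congr_deriv ?_
    ring

/-- Duhamel's formula pulled through the Hankel transform by Fubini. It yields the integral
representation, and also the decay in `x`. -/
lemma SourceData.solution_eq (h : SourceData A G) {a : ℝ} (ha : -1 < a) (x t : ℝ) :
    solution a A G x t = evol a t A x + ∫ s in (0:ℝ)..t, evol a (t - s) (G s) x := by
  have p := h.initial.phase_mul_single t
  have i1 := p.rapidDecay.integrable_hankel ha ha () (p.continuousOn ()) x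
  have e0 : ∀ ξ, duhamel A G t ξ = phase t ξ * A ξ + ∫ s in (0:ℝ)..t, phase (t - s) ξ * G s ξ := by
    intro ξ
    rw [duhamel, mul_add, ← intervalIntegral.integral_const_mul]
    congr 2; ext s
    rw [← mul_assoc, phase_mul_phase, sub_eq_add_neg]
  have hd := (h.rapidDecay_duhamel_single t).integrable_hankel ha ha () (h.continuousOn_duhamel t) x
  have e1 : ∀ ξ, (besselE a (x * ξ) : ℂ) * duhamel A G t ξ =
      (besselE a (x * ξ) : ℂ) * (phase t ξ * A ξ) +
        ∫ s in (0:ℝ)..t, (besselE a (x * ξ) : ℂ) * (phase (t - s) ξ * G s ξ) := fun ξ => by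
    rw [e0, mul_add, intervalIntegral.integral_const_mul]
  have i2 : Integrable (fun ξ => ∫ s in (0:ℝ)..t,
      (besselE a (x * ξ) : ℂ) * (phase (t - s) ξ * G s ξ)) (omega a) :=
    (hd.sub i1).congr (Eventually.of_forall fun ξ => by simp only [Pi.sub_apply, e1]; ring)
  rw [solution, hankel]
  simp_rw [e1]
  rw [integral_add i1 i2]
  congr 1
  obtain ⟨C, hC0, hC⟩ := h.source.rapidDecay.norm_besselE_mul_le ha (decayExp a)
  have hmeas : Continuous fun q : ℝ × ℝ =>
      (besselE a (x * q.1) : ℂ) * (phase (t - q.2) q.1 * G q.2 q.1) := by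
    have h1 := continuous_besselE ha
    have h2 := h.continuous_source.comp (by fun_prop : Continuous fun q : ℝ × ℝ => (q.2, q.1))
    have h3 := continuous_phase.comp (by fun_prop : Continuous fun q : ℝ × ℝ => (t - q.2, q.1))
    have h4 : Continuous fun q : ℝ × ℝ => (besselE a (x * q.1) : ℂ) := by fun_prop
    exact h4.mul (h3.mul h2)
  simp_rw [intervalIntegral.intervalIntegral_eq_integral_uIoc]
  rw [integral_smul]
  congr 1
  refine integral_integral_swap (μ := omega a) (ν := volume.restrict (uIoc 0 t))
    (f := fun ξ s => (besselE a (x * ξ) : ℂ) * (phase (t - s) ξ * G s ξ)) ?_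
  have : IsFiniteMeasure (volume.restrict (uIoc 0 t)) := ⟨by simp [uIoc]⟩
  have hI := ((integrable_decay ha le_rfl).const_mul (C * (1 + |x|) ^ 2)).mul_prod
    (integrable_const (μ := volume.restrict (uIoc 0 t)) (1:ℝ))
  refine Integrable.mono' hI hmeas.aestronglyMeasurable ?_
  have hp : ∀ᵐ q ∂((omega a).prod (volume.restrict (uIoc 0 t))), 0 < q.1 :=
    (Measure.ae_prod_iff_ae_ae (p := fun q : ℝ × ℝ => 0 < q.1)
      (measurableSet_lt measurable_const measurable_fst)).2
      (ae_omega_of_forall_pos a fun x hx => Eventually.of_forall fun y => hx)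
  filter_upwards [hp] with q hq
  have := hC q.2 x q.1 hq
  simp only [Function.uncurry, mul_one]
  rw [norm_mul] at this ⊢
  rwa [norm_mul, norm_phase, one_mul]

/-- Decay in `x` comes from smoothness in `ξ`, which is not established for `duhamel` itself. The
solution is instead a superposition of free evolutions of Schwartz data, whose transforms decay
uniformly. -/
lemma SourceData.rapidDecay_solution (h : SourceData A G) {a : ℝ} (ha : -1 < a) (T : ℝ) :
    RapidDecay fun (t : {t : ℝ // |t| ≤ T}) x => solution a A G x t := by
  have hA : SchwartzFamily fun t : {t : ℝ // |t| ≤ T} => evol a t A :=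
    ((h.initial.comp fun _ : {t : ℝ // |t| ≤ T} => ()).phase_mul
      (r := fun t => (t : ℝ)) (M := T) (fun t => t.2)).hankel ha
  -- Elapsed time and source time are independent indices; `|t - s| ≤ 2 T` keeps the phases in a
  -- bounded range.
  have hG : SchwartzFamily fun q : {q : ℝ × ℝ // |q.1| ≤ 2 * T} => evol a q.1.1 (G q.1.2) :=
    ((h.source.comp fun q : {q : ℝ × ℝ // |q.1| ≤ 2 * T} => q.1.2).phase_mul
      (r := fun q => q.1.1) (M := 2 * T) (fun q => q.2)).hankel ha
  refine RapidDecay.of_bound fun m => ?_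
  obtain ⟨C, hC0, hC⟩ := hA.rapidDecay.exists_bound m
  obtain ⟨C', hC0', hC'⟩ := hG.rapidDecay.exists_bound m
  refine ⟨C + C' * T, fun ⟨t, ht⟩ x hx => ?_⟩
  have h1 : ‖∫ s in (0:ℝ)..t, evol a (t - s) (G s) x‖ ≤ C' * ((1 + x) ^ m)⁻¹ * |t - 0| :=
    intervalIntegral.norm_integral_le_of_norm_le_const fun s hs => by
      have h2 : |t - s| ≤ 2 * T := by
        have := uIoc_subset_uIcc hs
        have h3 := Set.abs_sub_right_of_mem_uIcc this
        have : 0 ≤ |t| := abs_nonneg t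
        rw [sub_zero] at h3
        linarith
      exact hC' ⟨(t - s, s), h2⟩ x hx
  rw [sub_zero] at h1
  simp only
  rw [h.solution_eq ha]
  calc _ ≤ ‖evol a t A x‖ + ‖∫ s in (0:ℝ)..t, evol a (t - s) (G s) x‖ := norm_add_le _ _
    _ ≤ C * ((1 + x) ^ m)⁻¹ + C' * ((1 + x) ^ m)⁻¹ * T := by
      refine add_le_add (hC ⟨t, ht⟩ x hx) (h1.trans ?_)
      gcongr
    _ = _ := by ring

end

/-! ### The data of the Cauchy problem -/

lemma contDiffOn_radialDeriv {f : ℝ → ℂ} (hf : ContDiffOn ℝ ∞ f (Ioi 0)) :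
    ContDiffOn ℝ ∞ (radialDeriv f) (Ioi 0) := by
  have h1 : ContDiffOn ℝ ∞ (deriv f) (Ioi 0) := hf.deriv_of_isOpen isOpen_Ioi (by simp)
  have h2 : ContDiffOn ℝ ∞ (fun x : ℝ => 1 / x) (Ioi 0) :=
    contDiffOn_const.div contDiffOn_id fun x hx => ne_of_gt hx
  exact (Complex.ofRealCLM.contDiff.comp_contDiffOn h2).mul h1

lemma one_add_pow_le {x : ℝ} (hx : 0 < x) (m : ℕ) : (1 + x) ^ m ≤ 2 ^ m * (1 + x ^ m) := by
  rcases le_total x 1 with h | h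
  · calc (1 + x) ^ m ≤ 2 ^ m * 1 := by rw [mul_one]; gcongr; linarith
      _ ≤ _ := by gcongr; linarith [pow_pos hx m]
  · calc (1 + x) ^ m ≤ (2 * x) ^ m := by gcongr; linarith
      _ = 2 ^ m * x ^ m := mul_pow _ _ _
      _ ≤ _ := by gcongr; linarith

lemma rapidDecay_of_pow_mul_le {φ : ι → ℝ → ℂ}
    (h : ∀ m : ℕ, ∃ C, ∀ i x, 0 < x → x ^ m * ‖φ i x‖ ≤ C) : RapidDecay φ := by
  intro m
  obtain ⟨C, hC⟩ := h m
  obtain ⟨C₀, hC₀⟩ := h 0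
  refine ⟨2 ^ m * (C₀ + C), fun i x hx => ?_⟩
  have h1 := hC i x hx
  have h2 := hC₀ i x hx
  calc _ ≤ 2 ^ m * (1 + x ^ m) * ‖φ i x‖ := by gcongr; exact one_add_pow_le hx m
    _ = 2 ^ m * (x ^ 0 * ‖φ i x‖ + x ^ m * ‖φ i x‖) := by ring
    _ ≤ _ := by gcongr

lemma schwartzFamily_of_radialDeriv {φ : ι → ℝ → ℂ} (hs : ∀ i, ContDiffOn ℝ ∞ (φ i) (Ioi 0))
    (hb : ∀ m k : ℕ, ∃ C, ∀ i x, 0 < x → x ^ m * ‖(radialDeriv^[k] (φ i)) x‖ ≤ C) :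
    SchwartzFamily φ := by
  have hsk : ∀ k i, ContDiffOn ℝ ∞ (radialDeriv^[k] (φ i)) (Ioi 0) := fun k i => by
    induction k with
    | zero => exact hs i
    | succ k ih => rw [Function.iterate_succ_apply']; exact contDiffOn_radialDeriv ih
  have key : ∀ n k, Chain RapidDecay n (fun i => radialDeriv^[k] (φ i)) := fun n => by
    induction n with
    | zero =>
      exact fun k => ⟨rapidDecay_of_pow_mul_le fun m => hb m k, fun i => (hsk k i).continuousOn⟩
    | succ n ih =>
      refine fun k => ⟨rapidDecay_of_pow_mul_le fun m => hb m k, _, ih (k + 1), fun i x hx => ?_⟩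
      have h1 : DifferentiableAt ℝ (radialDeriv^[k] (φ i)) x :=
        ((hsk k i).differentiableOn (by simp)).differentiableAt (Ioi_mem_nhds hx)
      refine h1.hasDerivAt.congr_deriv ?_
      have hx' : (x : ℂ) ≠ 0 := by exact_mod_cast hx.ne'
      rw [Function.iterate_succ_apply', radialDeriv]
      push_cast
      field_simp
  exact fun n => key n 0

lemma IsSchwartzPlus.schwartzFamily {φ : ℝ → ℂ} (h : IsSchwartzPlus φ) :
    SchwartzFamily fun _ : Unit => φ := by
  refine schwartzFamily_of_radialDeriv (fun _ => h.smooth) fun m k => ?_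
  obtain ⟨C, hC⟩ := h.bounded m k
  refine ⟨C, fun _ x hx => ?_⟩
  have := hC x hx
  rwa [norm_mul, Complex.norm_real, Real.norm_of_nonneg (by positivity)] at this

lemma pow_le_weight (x t : ℝ) {m p : ℕ} (hx : 0 < x) (hm : m ≤ p) :
    x ^ m ≤ (1 + x ^ 2 + t ^ 2) ^ ((p : ℝ) / 2) := by
  have h1 : 1 ≤ 1 + x ^ 2 + t ^ 2 := by nlinarith [sq_nonneg x, sq_nonneg t]
  calc x ^ m = (x ^ 2) ^ ((m : ℝ) / 2) := by
        rw [← Real.rpow_natCast x 2, ← Real.rpow_mul hx.le, ← Real.rpow_natCast x m]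
        congr 1; push_cast; ring
    _ ≤ (1 + x ^ 2 + t ^ 2) ^ ((m : ℝ) / 2) := by
        gcongr; nlinarith [sq_nonneg t]
    _ ≤ _ := by
        refine Real.rpow_le_rpow_of_exponent_le h1 ?_
        have : (m : ℝ) ≤ p := by exact_mod_cast hm
        linarith

lemma IsSpaceTimeSchwartzPlus.contDiffOn_space {F : ℝ → ℝ → ℂ} (h : IsSpaceTimeSchwartzPlus F)
    (t : ℝ) : ContDiffOn ℝ ∞ (fun x => F x t) (Ioi 0) :=
  h.smooth.comp (f := fun x : ℝ => (x, t)) (by fun_prop) fun x hx => ⟨hx, mem_univ _⟩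

lemma IsSpaceTimeSchwartzPlus.contDiff_time {F : ℝ → ℝ → ℂ} (h : IsSpaceTimeSchwartzPlus F)
    {x : ℝ} (hx : 0 < x) : ContDiff ℝ ∞ (fun t => F x t) := by
  rw [← contDiffOn_univ]
  exact h.smooth.comp (f := fun t : ℝ => (x, t)) (by fun_prop) fun t _ => ⟨hx, mem_univ _⟩

lemma IsSpaceTimeSchwartzPlus.schwartzFamily {F : ℝ → ℝ → ℂ} (h : IsSpaceTimeSchwartzPlus F) :
    SchwartzFamily fun t x => F x t := by
  refine schwartzFamily_of_radialDeriv h.contDiffOn_space fun m k => ?_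
  obtain ⟨C, hC⟩ := h.bounded (m + k)
  refine ⟨C, fun t x hx => ?_⟩
  have := hC k 0 (by omega) x hx t
  simp only [iteratedDeriv_zero] at this
  refine le_trans ?_ this
  gcongr
  exact pow_le_weight x t hx (by omega)

/-- Enters the second time derivative of the solution, whose decay gives the `C¹` curve in `L²`. -/
lemma IsSpaceTimeSchwartzPlus.rapidDecay_deriv {F : ℝ → ℝ → ℂ} (h : IsSpaceTimeSchwartzPlus F) :
    RapidDecay fun t x => deriv (fun s => F x s) t := by
  refine rapidDecay_of_pow_mul_le fun m => ?_
  obtain ⟨C, hC⟩ := h.bounded (m + 1)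
  refine ⟨C, fun t x hx => ?_⟩
  have := hC 0 1 (by omega) x hx t
  simp only [iteratedDeriv_one, Function.iterate_zero, id] at this
  refine le_trans ?_ this
  gcongr
  exact pow_le_weight x t hx (by omega)

lemma sourceData {a : ℝ} (ha : -1 < a) {φ : ℝ → ℂ} {F : ℝ → ℝ → ℂ}
    (hφ : SchwartzFamily fun _ : Unit => φ) (hF : SchwartzFamily fun t x => F x t)
    (hc : ∀ x, 0 < x → Continuous fun t => F x t) :
    SourceData (hankel a φ) (fun t => hankel a fun x => F x t) where
  initial := hφ.hankel ha
  source := hF.hankel ha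
  continuous_source :=
    (hF.rapidDecay.continuous_hankel ha hF.continuousOn hc).comp
      (f := fun q : ℝ × ℝ => (q.2, q.1)) (by fun_prop)

/-! ### Curves in `L²` -/

lemma memLp_decay {a : ℝ} (ha : -1 < a) :
    MemLp (fun x : ℝ => ((1 + x) ^ decayExp a)⁻¹) 2 (omega a) := by
  have hm : AEStronglyMeasurable (fun x : ℝ => ((1 + x) ^ decayExp a)⁻¹) (omega a) := by
    have : Measurable (fun x : ℝ => ((1 + x) ^ decayExp a)⁻¹) := by fun_prop
    exact this.aestronglyMeasurable
  rw [memLp_two_iff_integrable_sq hm]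
  refine (integrable_decay ha (N := decayExp a * 2) (by omega)).congr ?_
  exact Eventually.of_forall fun x => by simp only [inv_pow, pow_mul]

lemma RapidDecay.memLp {a : ℝ} (ha : -1 < a) {φ : ι → ℝ → ℂ} (h : RapidDecay φ) (i : ι)
    (hc : ContinuousOn (φ i) (Ioi 0)) : MemLp (φ i) 2 (omega a) := by
  obtain ⟨C, hC0, hC⟩ := h.exists_bound (decayExp a)
  refine ((memLp_decay ha).const_mul C).mono' (aestronglyMeasurable_omega hc)
    (ae_omega_of_forall_pos a fun x hx => hC i x hx)

lemma norm_toLp_le {a : ℝ} (ha : -1 < a) {f : ℝ → ℂ} (hf : MemLp f 2 (omega a)) {C : ℝ}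
    (hC : ∀ x, 0 < x → ‖f x‖ ≤ C * ((1 + x) ^ decayExp a)⁻¹) :
    ‖hf.toLp f‖ ≤ C * ‖(memLp_decay ha).toLp _‖ := by
  refine Lp.norm_le_mul_norm_of_ae_le_mul ?_
  filter_upwards [hf.coeFn_toLp, (memLp_decay ha).coeFn_toLp, ae_omega_pos a] with x h1 h2 hx
  rw [h1, h2, Real.norm_of_nonneg (by positivity)]
  exact hC x hx

/-- A curve of functions whose time derivatives up to order two decay rapidly is a `C¹` curve in
`L²`. -/
lemma exists_hasDerivAt_Lp {a : ℝ} (ha : -1 < a) {u v w : ℝ → ℝ → ℂ}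
    (huv : ∀ x, 0 < x → ∀ t, HasDerivAt (fun t => u x t) (v x t) t)
    (hvw : ∀ x, 0 < x → ∀ t, HasDerivAt (fun t => v x t) (w x t) t)
    (hu : ∀ t, MemLp (fun x => u x t) 2 (omega a)) (hv : ∀ t, MemLp (fun x => v x t) 2 (omega a))
    (hw : ∀ T : ℝ, RapidDecay fun (t : {t : ℝ // |t| ≤ T}) x => w x t) :
    (∀ t, HasDerivAt (fun t => (hu t).toLp) ((hv t).toLp) t) ∧
      Continuous fun t => (hv t).toLp := by
  set ρ := ‖(memLp_decay ha).toLp _‖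
  have hbd : ∀ t : ℝ, ∃ C, 0 ≤ C ∧ ∀ s, |s - t| ≤ 1 → ∀ x, 0 < x →
      ‖w x s‖ ≤ C * ((1 + x) ^ decayExp a)⁻¹ := fun t => by
    obtain ⟨C, hC0, hC⟩ := (hw (|t| + 1)).exists_bound (decayExp a)
    refine ⟨C, hC0, fun s hs x hx => hC ⟨s, ?_⟩ x hx⟩
    have := abs_sub_abs_le_abs_sub s t
    linarith
  have hball : ∀ {t s r : ℝ}, |s - t| ≤ 1 → r ∈ uIcc t s → |r - t| ≤ |s - t| :=
    fun _ hr => Set.abs_sub_left_of_mem_uIcc hr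
  -- The bound on `w` is integrated once here, for the continuity of `v` in `L²`, and a second time
  -- in `htay` to get a quadratic Taylor remainder for `u`. The weight `(1 + x) ^ (-decayExp a)` is
  -- in `L²`, so both estimates pass to norms.
  have hlip : ∀ {t C : ℝ}, (∀ s, |s - t| ≤ 1 → ∀ x, 0 < x →
      ‖w x s‖ ≤ C * ((1 + x) ^ decayExp a)⁻¹) → ∀ s, |s - t| ≤ 1 → ∀ x, 0 < x →
      ‖v x s - v x t‖ ≤ C * ((1 + x) ^ decayExp a)⁻¹ * |s - t| := by
    intro t C hC s hs x hx
    refine Convex.norm_image_sub_le_of_norm_hasDerivWithin_le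
      (s := uIcc t s) (f := fun t => v x t) (f' := fun t => w x t)
      (fun r _ => (hvw x hx r).hasDerivWithinAt)
      (fun r hr => hC r ((hball hs hr).trans hs) x hx) (convex_uIcc t s) left_mem_uIcc
      right_mem_uIcc
  constructor
  · intro t
    obtain ⟨C, hC0, hC⟩ := hbd t
    have htay : ∀ s, |s - t| ≤ 1 → ∀ x, 0 < x → ‖u x s - u x t - (s - t) • v x t‖ ≤
        C * |s - t| ^ 2 * ((1 + x) ^ decayExp a)⁻¹ := by
      intro s hs x hx
      have := Convex.norm_image_sub_le_of_norm_hasDerivWithin_le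
        (s := uIcc t s) (f := fun r => u x r - (r - t) • v x t) (f' := fun r => v x r - v x t)
        (C := C * ((1 + x) ^ decayExp a)⁻¹ * |s - t|)
        (fun r _ => ((huv x hx r).sub ((((hasDerivAt_id r).sub_const t).smul_const
          (v x t)).congr_deriv (one_smul _ _))).hasDerivWithinAt)
        (fun r hr => (hlip hC r ((hball hs hr).trans hs) x hx).trans
          (mul_le_mul_of_nonneg_left (hball hs hr) (by positivity)))
        (convex_uIcc t s) left_mem_uIcc right_mem_uIcc
      simp only [sub_self, zero_smul, sub_zero] at this
      calc _ = ‖u x s - (s - t) • v x t - u x t‖ := by congr 1; abel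
        _ ≤ _ := this
        _ = _ := by rw [Real.norm_eq_abs]; ring
    rw [hasDerivAt_iff_tendsto]
    have hlim : Tendsto (fun s => C * ρ * |s - t|) (𝓝 t) (𝓝 0) := by
      have : Continuous fun s => C * ρ * |s - t| := by fun_prop
      simpa using this.tendsto t
    refine squeeze_zero' (Eventually.of_forall fun s => by positivity) ?_ hlim
    filter_upwards [Metric.closedBall_mem_nhds t one_pos] with s hs
    have hs : |s - t| ≤ 1 := by simpa [Real.dist_eq] using hs
    have e : (hu s).toLp - (hu t).toLp - (s - t) • (hv t).toLp =
        (((hu s).sub (hu t)).sub ((hv t).const_smul (s - t))).toLp := by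
      rw [MemLp.toLp_sub ((hu s).sub (hu t)) ((hv t).const_smul (s - t)),
        MemLp.toLp_sub (hu s) (hu t), MemLp.toLp_const_smul (s - t) (hv t)]
    rw [e]
    have h1 := norm_toLp_le ha (((hu s).sub (hu t)).sub ((hv t).const_smul (s - t)))
      (C := C * |s - t| ^ 2) (fun x hx => htay s hs x hx)
    rw [Real.norm_eq_abs]
    rcases eq_or_lt_of_le (abs_nonneg (s - t)) with h | h
    · rw [← h]; simp
    · rw [inv_mul_le_iff₀ h]
      calc _ ≤ _ := h1
        _ = _ := by ring
  · refine continuous_iff_continuousAt.2 fun t => ?_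
    obtain ⟨C, hC0, hC⟩ := hbd t
    rw [ContinuousAt, tendsto_iff_norm_sub_tendsto_zero]
    have hlim : Tendsto (fun s => C * |s - t| * ρ) (𝓝 t) (𝓝 0) := by
      have : Continuous fun s => C * |s - t| * ρ := by fun_prop
      simpa using this.tendsto t
    refine squeeze_zero' (Eventually.of_forall fun s => by positivity) ?_ hlim
    filter_upwards [Metric.closedBall_mem_nhds t one_pos] with s hs
    have hs : |s - t| ≤ 1 := by simpa [Real.dist_eq] using hs
    rw [← MemLp.toLp_sub]
    exact norm_toLp_le ha _ fun x hx => (hlip hC s hs x hx).trans (le_of_eq (by ring))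

/-! ### Existence -/

lemma RapidDecay.contDiff_hankel {a : ℝ} (ha : -1 < a) {φ : ι → ℝ → ℂ} (h : RapidDecay φ) (i : ι)
    (hc : ContinuousOn (φ i) (Ioi 0)) (n : ℕ) : ContDiff ℝ n (HalfLine.hankel a (φ i)) := by
  induction n generalizing a with
  | zero => exact contDiff_zero.2 (h.continuous_hankel_single ha i hc)
  | succ n ih =>
    have hd := h.hasDerivAt_hankel ha i hc
    push_cast
    refine contDiff_succ_iff_deriv.2 ⟨fun x => (hd x).differentiableAt, by simp, ?_⟩
    have e : deriv (HalfLine.hankel a (φ i)) =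
        fun x : ℝ => (x : ℂ) * -HalfLine.hankel (a + 2) (φ i) x := funext fun x => (hd x).deriv
    rw [e]
    exact Complex.ofRealCLM.contDiff.mul (ih (by linarith)).neg

/-- Dual to `Chain.exists_hankel_eq`: the operator acts on the output variable, so the recurrence
does the work and `φ` needs decay but no derivatives. -/
lemma besselOp_hankel {a : ℝ} (ha : -1 < a) {φ : ι → ℝ → ℂ} (h : RapidDecay φ) (i : ι)
    (hc : ContinuousOn (φ i) (Ioi 0)) {x : ℝ} (hx : 0 < x) :
    besselOp a (hankel a (φ i)) x = -hankel a (fun y => ((y ^ 2 : ℝ) : ℂ) * φ i y) x := by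
  have ha2 : -1 < a + 2 := by linarith
  have hd := h.hasDerivAt_hankel ha i hc
  have hd2 := h.hasDerivAt_hankel ha2 i hc x
  have e : deriv (hankel a (φ i)) = fun x : ℝ => (x : ℂ) * -hankel (a + 2) (φ i) x :=
    funext fun x => (hd x).deriv
  have h1 : HasDerivAt (fun x : ℝ => (x : ℂ)) 1 x := Complex.ofRealCLM.hasDerivAt
  have e2 := (h1.mul hd2.neg).deriv
  have hx' : (x : ℂ) ≠ 0 := by exact_mod_cast hx.ne'
  rw [besselOp, e, hankel_sq_mul ha h i hc]
  have e3 : deriv (fun x : ℝ => (x : ℂ) * -hankel (a + 2) (φ i) x) x =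
      1 * -hankel (a + 2) (φ i) x + (x : ℂ) * -((x : ℂ) * -hankel (a + 2 + 2) (φ i) x) := e2
  rw [e3]
  push_cast
  field_simp
  ring

lemma SourceData.continuous_solution {A : ℝ → ℂ} {G : ℝ → ℝ → ℂ} (h : SourceData A G) {a : ℝ}
    (ha : -1 < a) (t : ℝ) : Continuous fun x => solution a A G x t :=
  (h.rapidDecay_duhamel_single t).continuous_hankel_single ha () (h.continuousOn_duhamel t)

lemma SourceData.memLp_solution {A : ℝ → ℂ} {G : ℝ → ℝ → ℂ} (h : SourceData A G) {a : ℝ}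
    (ha : -1 < a) (t : ℝ) : MemLp (fun x => solution a A G x t) 2 (omega a) :=
  (h.rapidDecay_solution ha |t|).memLp ha ⟨t, le_rfl⟩ (h.continuous_solution ha t).continuousOn

lemma isSolution_solution {a : ℝ} (ha : -1 < a) {φ : ℝ → ℂ} {F F' : ℝ → ℝ → ℂ}
    (hφ : SchwartzFamily fun _ : Unit => φ) (hF : SchwartzFamily fun t x => F x t)
    (hd : ∀ x, 0 < x → ∀ t, HasDerivAt (fun t => F x t) (F' x t) t)
    (hF' : RapidDecay fun t x => F' x t) :
    IsSolution a φ F (solution a (hankel a φ) (fun t => hankel a fun x => F x t)) := by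
  have hS := sourceData ha hφ hF fun x hx =>
    continuous_iff_continuousAt.2 fun t => (hd x hx t).continuousAt
  set A := hankel a φ with hA
  set G : ℝ → ℝ → ℂ := fun t => hankel a fun x => F x t with hG
  have hinv : ∀ x, 0 < x → ∀ t, hankel a (G t) x = F x t := fun x hx t =>
    hankel_hankel ha (hF.comp fun _ : Unit => t) hx
  set A₂ : ℝ → ℂ := fun ξ => ((ξ ^ 2 : ℝ) : ℂ) * A ξ with hA₂
  set G₂ : ℝ → ℝ → ℂ := fun s ξ => ((ξ ^ 2 : ℝ) : ℂ) * G s ξ with hG₂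
  have hS₂ : SourceData A₂ G₂ := hS.sq_mul
  -- Two time derivatives bring down `ξ ^ 4`.
  have hS₄ := hS₂.sq_mul
  have hu : ∀ x, 0 < x → ∀ t, HasDerivAt (fun t => solution a A G x t)
      (-Complex.I * solution a A₂ G₂ x t + F x t) t := fun x hx t => by
    rw [← hinv x hx t]; exact hS.hasDerivAt_solution ha x t
  have hv : ∀ x, 0 < x → ∀ t, HasDerivAt (fun t => -Complex.I * solution a A₂ G₂ x t + F x t)
      (-Complex.I * (-Complex.I * solution a (fun ξ => ((ξ ^ 2 : ℝ) : ℂ) * A₂ ξ)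
        (fun s ξ => ((ξ ^ 2 : ℝ) : ℂ) * G₂ s ξ) x t + hankel a (G₂ t) x) + F' x t) t :=
    fun x hx t => ((hS₂.hasDerivAt_solution ha x t).const_mul _).add (hd x hx t)
  have hmu := fun t => hS.memLp_solution ha t
  have hmF : ∀ t, MemLp (fun x => F x t) 2 (omega a) := fun t =>
    hF.rapidDecay.memLp ha t (hF.continuousOn t)
  have hmv : ∀ t, MemLp (fun x => -Complex.I * solution a A₂ G₂ x t + F x t) 2 (omega a) :=
    fun t => ((hS₂.memLp_solution ha t).const_mul _).add (hmF t)
  have hw : ∀ T : ℝ, RapidDecay fun (t : {t : ℝ // |t| ≤ T}) x =>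
      -Complex.I * (-Complex.I * solution a (fun ξ => ((ξ ^ 2 : ℝ) : ℂ) * A₂ ξ)
        (fun s ξ => ((ξ ^ 2 : ℝ) : ℂ) * G₂ s ξ) x t + hankel a (G₂ t) x) + F' x t := by
    intro T
    have hconst : PolyBdd fun (_ : {t : ℝ // |t| ≤ T}) (_ : ℝ) => -Complex.I :=
      ⟨0, 1, fun _ _ _ => by simp⟩
    have h1 := hS₄.rapidDecay_solution ha T
    have h2 : RapidDecay fun (t : {t : ℝ // |t| ≤ T}) x => hankel a (G₂ t) x :=
      (hS₂.source.hankel ha).rapidDecay.comp _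
    have h3 : RapidDecay fun (t : {t : ℝ // |t| ≤ T}) x => F' x t := hF'.comp _
    have h4 := (((h1.mul hconst).add h2).mul hconst).add h3
    simpa only [mul_comm] using h4
  obtain ⟨hL, hLc⟩ := exists_hasDerivAt_Lp ha hu hv hmu hmv hw
  have hdec := fun t => hS.rapidDecay_duhamel_single t
  have hcon := fun t => hS.continuousOn_duhamel t
  refine ⟨fun t => ?_, fun x hx t => (hu x hx t).differentiableAt, ?_, ?_, ?_, ?_⟩
  · exact ((hdec t).contDiff_hankel ha () (hcon t) 2).contDiffOn
  · refine ⟨fun t => (hmu t).toLp, ?_, fun t => (hmu t).coeFn_toLp⟩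
    refine contDiff_one_iff_deriv.2 ⟨fun t => (hL t).differentiableAt, ?_⟩
    rw [show deriv (fun t => (hmu t).toLp) = fun t => (hmv t).toLp from
      funext fun t => (hL t).deriv]
    exact hLc
  · intro x hx t
    rw [(hu x hx t).deriv]
    have h1 : besselOp a (fun z => solution a A G z t) x = -solution a A₂ G₂ x t := by
      have := besselOp_hankel ha (hdec t) () (hcon t) hx
      simp only [solution] at *
      rw [this]
      congr 2
      ext ξ
      rw [hA₂, hG₂, duhamel_sq_mul]
    rw [h1]; ring
  · intro t
    -- Neumann condition: `x ^ a ∂ₓ u` is `-x ^ (a + 1)` times a transform continuous at `0`, and `a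
    -- + 1 > 0`.
    have h2 := (hdec t).continuous_hankel_single (a := a + 2) (by linarith) () (hcon t)
    have h3 : Tendsto (fun x : ℝ => ((x ^ (a + 1) : ℝ) : ℂ) * -hankel (a + 2) (duhamel A G t) x)
        (𝓝[>] 0) (𝓝 0) := by
      have h4 : ContinuousAt (fun x : ℝ => x ^ (a + 1)) 0 :=
        Real.continuousAt_rpow_const 0 (a + 1) (Or.inr (by linarith))
      have h5 : ContinuousAt (fun x : ℝ =>
          ((x ^ (a + 1) : ℝ) : ℂ) * -hankel (a + 2) (duhamel A G t) x) 0 := by fun_prop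
      have h6 := h5.tendsto
      rw [Real.zero_rpow (by linarith), Complex.ofReal_zero, zero_mul] at h6
      exact h6.mono_left nhdsWithin_le_nhds
    refine h3.congr' ?_
    filter_upwards [self_mem_nhdsWithin] with x hx
    have hx : 0 < x := hx
    have h7 : deriv (fun z => solution a A G z t) x = _ :=
      ((hdec t).hasDerivAt_hankel ha () (hcon t) x).deriv
    rw [h7, Real.rpow_add_one hx.ne']
    push_cast; ring
  · intro x hx
    have : duhamel A G 0 = A := by ext ξ; simp [duhamel, phase]
    rw [solution, this]
    exact hankel_hankel ha hφ hx

/-! ### Green's identity on the maximal domain -/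

/-- The hypothesis gives `‖w₁ y‖ ≤ y ^ (-a)` near `0`. Integrating from `x` to a fixed `d` gives
`w(x) = O(1 + x ^ (-a))`, so after multiplication by `x ^ (a + 1)` the bound is `O(x ^ (a + 1) +
x)`. -/
lemma tendsto_rpow_mul_zero {a : ℝ} (ha : -1 < a) {w w₁ : ℝ → ℂ}
    (hw : ∀ x, 0 < x → HasDerivAt w (w₁ x) x)
    (h0 : Tendsto (fun x : ℝ => ((x ^ a : ℝ) : ℂ) * w₁ x) (𝓝[>] 0) (𝓝 0)) :
    Tendsto (fun x : ℝ => ((x ^ (a + 1) : ℝ) : ℂ) * w x) (𝓝[>] 0) (𝓝 0) := by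
  have h1 : ∀ᶠ x in 𝓝[>] (0:ℝ), ‖((x ^ a : ℝ) : ℂ) * w₁ x‖ < 1 := by
    have := h0.norm
    rw [norm_zero] at this
    exact this.eventually_lt_const one_pos
  obtain ⟨δ, hδ, hsub⟩ := mem_nhdsGT_iff_exists_Ioo_subset.1 h1
  have hδ : 0 < δ := hδ
  set d := min (δ / 2) 1 with hd
  have hd0 : 0 < d := by positivity
  have hdδ : d < δ := (min_le_left _ _).trans_lt (by linarith)
  have hd1 : d ≤ 1 := min_le_right _ _
  have hbd : ∀ x, 0 < x → x ≤ d → ‖w x‖ ≤ ‖w d‖ + (1 + x ^ (-a)) := by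
    intro x hx hxd
    -- The bound serves both signs of `a`: for `a ≥ 0` the maximum of `y ^ (-a)` is at `y = x`, for
    -- `a ≤ 0` it is at most `1` because `d ≤ 1`.
    have hder : ∀ y ∈ Icc x d, ‖w₁ y‖ ≤ 1 + x ^ (-a) := by
      intro y hy
      have hy0 : 0 < y := hx.trans_le hy.1
      have h2 : ‖((y ^ a : ℝ) : ℂ) * w₁ y‖ < 1 := hsub ⟨hy0, hy.2.trans_lt hdδ⟩
      rw [norm_mul, Complex.norm_real, Real.norm_of_nonneg (Real.rpow_nonneg hy0.le a)] at h2
      have hya : 0 < y ^ a := Real.rpow_pos_of_pos hy0 a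
      have h3 : ‖w₁ y‖ ≤ y ^ (-a) := by
        rw [Real.rpow_neg hy0.le, ← one_div, le_div_iff₀ hya]; linarith
      refine h3.trans ?_
      rcases le_total 0 a with h | h
      · have := Real.rpow_le_rpow_of_nonpos hx hy.1 (neg_nonpos.2 h)
        linarith
      · have h4 : y ^ (-a) ≤ 1 := Real.rpow_le_one hy0.le (hy.2.trans hd1) (by linarith)
        have := Real.rpow_nonneg hx.le (-a)
        linarith
    have h5 := Convex.norm_image_sub_le_of_norm_hasDerivWithin_le (s := Icc x d) (f := w) (f' := w₁)
      (fun y hy => (hw y (hx.trans_le hy.1)).hasDerivWithinAt) hder (convex_Icc x d)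
      (right_mem_Icc.2 hxd) (left_mem_Icc.2 hxd)
    have h6 : ‖x - d‖ ≤ 1 := by
      rw [Real.norm_eq_abs, abs_le]; constructor <;> linarith
    have h7 : 0 ≤ 1 + x ^ (-a) := by have := Real.rpow_nonneg hx.le (-a); linarith
    have h8 : ‖w x‖ ≤ ‖w d‖ + ‖w x - w d‖ := by
      calc ‖w x‖ = ‖w d + (w x - w d)‖ := by congr 1; ring
        _ ≤ _ := norm_add_le _ _
    nlinarith
  have hlim : Tendsto (fun x : ℝ => x ^ (a + 1) * (‖w d‖ + 1) + x) (𝓝[>] 0) (𝓝 0) := by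
    have h4 : ContinuousAt (fun x : ℝ => x ^ (a + 1)) 0 :=
      Real.continuousAt_rpow_const 0 (a + 1) (Or.inr (by linarith))
    have h5 : ContinuousAt (fun x : ℝ => x ^ (a + 1) * (‖w d‖ + 1) + x) 0 := by fun_prop
    have h6 := h5.tendsto
    rw [Real.zero_rpow (by linarith), zero_mul, zero_add] at h6
    exact h6.mono_left nhdsWithin_le_nhds
  refine squeeze_zero_norm' ?_ hlim
  filter_upwards [Ioc_mem_nhdsGT hd0] with x hx
  have hx0 : 0 < x := hx.1
  have h1 := hbd x hx0 hx.2
  have hp : 0 ≤ x ^ (a + 1) := Real.rpow_nonneg hx0.le _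
  have e : x ^ (a + 1) * x ^ (-a) = x := by
    rw [← Real.rpow_add hx0]; ring_nf; simp
  rw [norm_mul, Complex.norm_real, Real.norm_of_nonneg hp]
  calc _ ≤ x ^ (a + 1) * (‖w d‖ + (1 + x ^ (-a))) := by gcongr
    _ = x ^ (a + 1) * (‖w d‖ + 1) + x ^ (a + 1) * x ^ (-a) := by ring
    _ = _ := by rw [e]

lemma rpow_le_one_add_pow {a x : ℝ} (hx : 1 ≤ x) : x ^ a ≤ (1 + x) ^ ⌈a⌉₊ :=
  calc x ^ a ≤ x ^ (⌈a⌉₊ : ℝ) := Real.rpow_le_rpow_of_exponent_le hx (Nat.le_ceil a)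
    _ = x ^ ⌈a⌉₊ := Real.rpow_natCast _ _
    _ ≤ _ := by gcongr; linarith

/-- `x ^ a g` is the derivative of `x ^ a w₁`, where `g` is the Bessel operator of `w`. Since `|g| ≤
1 + |g| ^ 2` and `g ∈ L²`, its integral over `[1, x]` grows polynomially; dividing by `x ^ a` and
integrating once more bounds `w`. -/
lemma exists_growth_bound {a : ℝ} (ha : -1 < a) {w w₁ w₂ : ℝ → ℂ}
    (hw : ∀ x, 0 < x → HasDerivAt w (w₁ x) x) (hw₁ : ∀ x, 0 < x → HasDerivAt w₁ (w₂ x) x)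
    (hc : ContinuousOn w₂ (Ioi 0))
    (hg : MemLp (fun x => w₂ x + ((a / x : ℝ) : ℂ) * w₁ x) 2 (omega a)) :
    ∃ (N : ℕ) (C : ℝ), 0 ≤ C ∧ ∀ x : ℝ, 1 ≤ x →
      ‖((x ^ a : ℝ) : ℂ) * w₁ x‖ ≤ C * (1 + x) ^ N ∧ ‖w x‖ ≤ C * (1 + x) ^ N := by
  set g : ℝ → ℂ := fun x => w₂ x + ((a / x : ℝ) : ℂ) * w₁ x with hgdef
  have cw₁ : ContinuousOn w₁ (Ioi 0) := fun x hx => (hw₁ x hx).continuousAt.continuousWithinAt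
  have cpow : ContinuousOn (fun y : ℝ => y ^ a) (Ioi 0) := fun y hy =>
    (Real.continuousAt_rpow_const y a (Or.inl (ne_of_gt hy))).continuousWithinAt
  have cg : ContinuousOn g (Ioi 0) := by
    refine hc.add (ContinuousOn.mul ?_ cw₁)
    refine Complex.continuous_ofReal.comp_continuousOn ?_
    exact continuousOn_const.div continuousOn_id fun x hx => ne_of_gt hx
  have hsq : IntegrableOn (fun x : ℝ => (x ^ a) • ‖g x‖ ^ 2) (Ioi 0) :=
    integrable_omega.1 hg.norm.integrable_sq
  set M := ∫ x in Ioi 0, (x ^ a) • ‖g x‖ ^ 2 with hM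
  have hM0 : 0 ≤ M := setIntegral_nonneg measurableSet_Ioi fun x hx => by
    have := Real.rpow_nonneg (le_of_lt hx : (0:ℝ) ≤ x) a
    simp only [smul_eq_mul]; positivity
  have hd : ∀ x : ℝ, 0 < x → HasDerivAt (fun x : ℝ => ((x ^ a : ℝ) : ℂ) * w₁ x)
      ((x ^ a : ℝ) * g x) x := fun x hx => by
    have h1 := (Real.hasDerivAt_rpow_const (x := x) (p := a) (Or.inl hx.ne')).ofReal_comp
    refine (h1.mul (hw₁ x hx)).congr_deriv ?_
    have : x ^ (a - 1) = x ^ a / x := by rw [Real.rpow_sub hx, Real.rpow_one]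
    have hx' : (x : ℂ) ≠ 0 := by exact_mod_cast hx.ne'
    rw [this, hgdef]
    push_cast
    field_simp
    ring
  set n := ⌈a⌉₊ with hn
  have hb1 : ∀ x : ℝ, 1 ≤ x →
      ‖((x ^ a : ℝ) : ℂ) * w₁ x‖ ≤ (‖w₁ 1‖ + 1 + M) * (1 + x) ^ (n + 1) := by
    intro x hx
    have hsub : uIcc 1 x ⊆ Ioi 0 := fun y hy => by
      rw [uIcc_of_le hx] at hy; exact lt_of_lt_of_le one_pos hy.1
    have hcont : ContinuousOn (fun y : ℝ => ((y ^ a : ℝ) : ℂ) * g y) (uIcc 1 x) :=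
      ((Complex.continuous_ofReal.comp_continuousOn cpow).mul cg).mono hsub
    have hftc := intervalIntegral.integral_eq_sub_of_hasDerivAt
      (fun y hy => hd y (hsub hy)) hcont.intervalIntegrable
    have hsqI : IntegrableOn (fun x : ℝ => (x ^ a) • ‖g x‖ ^ 2) (Ioc 1 x) :=
      hsq.mono_set fun y hy => (one_pos.trans hy.1 : (0:ℝ) < y)
    have hle : ‖∫ y in (1:ℝ)..x, ((y ^ a : ℝ) : ℂ) * g y‖ ≤ (1 + x) ^ n * x + M := by
      rw [intervalIntegral.integral_of_le hx]
      have hcst : Integrable (fun _ : ℝ => (1 + x) ^ n) (volume.restrict (Ioc 1 x)) :=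
        integrable_const _
      have hI : IntegrableOn (fun y : ℝ => (1 + x) ^ n + (y ^ a) • ‖g y‖ ^ 2) (Ioc 1 x) :=
        hcst.add hsqI
      refine (norm_integral_le_of_norm_le hI ?_).trans ?_
      · filter_upwards [ae_restrict_mem measurableSet_Ioc] with y hy
        have hy1 : 1 ≤ y := hy.1.le
        have hya : 0 ≤ y ^ a := Real.rpow_nonneg (by linarith) a
        have h1 : y ^ a ≤ (1 + x) ^ n :=
          (rpow_le_one_add_pow hy1).trans (by gcongr; exact hy.2)
        rw [norm_mul, Complex.norm_real, Real.norm_of_nonneg hya, smul_eq_mul]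
        nlinarith [sq_nonneg (‖g y‖ - 1), norm_nonneg (g y)]
      · rw [integral_add hcst hsqI]
        refine add_le_add ?_ ?_
        · rw [setIntegral_const]
          simp only [Measure.real, Real.volume_Ioc, smul_eq_mul]
          rw [ENNReal.toReal_ofReal (by linarith), mul_comm]
          gcongr; linarith
        · refine setIntegral_mono_set hsq ?_ ?_
          · filter_upwards [ae_restrict_mem measurableSet_Ioi] with y hy
            have := Real.rpow_nonneg (le_of_lt hy : (0:ℝ) ≤ y) a
            simp only [smul_eq_mul, Pi.zero_apply]; positivity
          · exact LE.le.eventuallyLE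
              fun y hy => (one_pos.trans hy.1 : (0:ℝ) < y)
    have e : ((x ^ a : ℝ) : ℂ) * w₁ x = w₁ 1 + ∫ y in (1:ℝ)..x, ((y ^ a : ℝ) : ℂ) * g y := by
      rw [hftc]; simp
    rw [e]
    have h1 : (1:ℝ) ≤ (1 + x) ^ n := one_le_pow₀ (by linarith)
    calc _ ≤ ‖w₁ 1‖ + ((1 + x) ^ n * x + M) := (norm_add_le _ _).trans (by gcongr)
      _ ≤ ‖w₁ 1‖ * (1 + x) ^ (n + 1) + (1 * (1 + x) ^ (n + 1) + M * (1 + x) ^ (n + 1)) := by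
        have h2 : (1:ℝ) ≤ (1 + x) ^ (n + 1) := one_le_pow₀ (by linarith)
        refine add_le_add (le_mul_of_one_le_right (norm_nonneg _) h2)
          (add_le_add ?_ (le_mul_of_one_le_right hM0 h2))
        rw [one_mul, pow_succ]; gcongr; linarith
      _ = _ := by ring
  set K := ‖w₁ 1‖ + 1 + M with hK
  have hK0 : 0 ≤ K := by positivity
  have hb2 : ∀ x : ℝ, 1 ≤ x → ‖w₁ x‖ ≤ K * (1 + x) ^ (n + 2) := by
    intro x hx
    have hx0 : 0 < x := by linarith
    have h1 := hb1 x hx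
    have hxa : 0 < x ^ a := Real.rpow_pos_of_pos hx0 a
    rw [norm_mul, Complex.norm_real, Real.norm_of_nonneg hxa.le] at h1
    have h2 : x ^ (-a) ≤ 1 + x :=
      (Real.rpow_le_rpow_of_exponent_le hx (by linarith : -a ≤ 1)).trans (by simp)
    calc ‖w₁ x‖ = x ^ (-a) * (x ^ a * ‖w₁ x‖) := by
          rw [← mul_assoc, ← Real.rpow_add hx0]; simp
      _ ≤ (1 + x) * (K * (1 + x) ^ (n + 1)) := by gcongr
      _ = _ := by ring
  refine ⟨n + 3, ‖w 1‖ + K, by positivity, fun x hx => ⟨?_, ?_⟩⟩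
  · refine (hb1 x hx).trans ?_
    have h1 : (1 + x) ^ (n + 1) ≤ (1 + x) ^ (n + 3) := pow_le_pow_right₀ (by linarith) (by omega)
    have := norm_nonneg (w 1)
    gcongr
    linarith
  · have h5 := Convex.norm_image_sub_le_of_norm_hasDerivWithin_le (s := Icc 1 x) (f := w)
      (f' := w₁) (C := K * (1 + x) ^ (n + 2))
      (fun y hy => (hw y (one_pos.trans_le hy.1)).hasDerivWithinAt)
      (fun y hy => (hb2 y hy.1).trans (by
        have : 0 ≤ y := by linarith [hy.1]
        gcongr; exact hy.2)) (convex_Icc 1 x)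
      (left_mem_Icc.2 hx) (right_mem_Icc.2 hx)
    have h8 : ‖w x‖ ≤ ‖w 1‖ + ‖w x - w 1‖ := by
      calc ‖w x‖ = ‖w 1 + (w x - w 1)‖ := by congr 1; ring
        _ ≤ _ := norm_add_le _ _
    have h6 : ‖x - 1‖ ≤ 1 + x := by
      rw [Real.norm_of_nonneg (by linarith)]; linarith
    have h2 : (1:ℝ) ≤ (1 + x) ^ (n + 3) := one_le_pow₀ (by linarith)
    calc _ ≤ ‖w 1‖ * 1 + K * (1 + x) ^ (n + 2) * (1 + x) := by
          rw [mul_one]; refine h8.trans (by gcongr; exact h5.trans (by gcongr))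
      _ ≤ ‖w 1‖ * (1 + x) ^ (n + 3) + K * (1 + x) ^ (n + 3) := by
          rw [mul_assoc, ← pow_succ]; gcongr
      _ = _ := by ring

/-- At `0` the Neumann condition kills both halves of the Wronskian, the second through
`tendsto_rpow_mul_zero`. At infinity the rapid decay of `f` and `f₁` beats the polynomial growth of
`w`. -/
lemma green_maximal {a : ℝ} (ha : -1 < a) {w w₁ w₂ f f₁ f₂ : ℝ → ℂ}
    (hw : ∀ x, 0 < x → HasDerivAt w (w₁ x) x) (hw₁ : ∀ x, 0 < x → HasDerivAt w₁ (w₂ x) x)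
    (hc : ContinuousOn w₂ (Ioi 0)) (hwL : MemLp w 2 (omega a))
    (hg : MemLp (fun x => w₂ x + ((a / x : ℝ) : ℂ) * w₁ x) 2 (omega a))
    (h0 : Tendsto (fun x : ℝ => ((x ^ a : ℝ) : ℂ) * w₁ x) (𝓝[>] 0) (𝓝 0))
    (hf : ∀ x : ℝ, 0 < x → HasDerivAt f (x * f₁ x) x)
    (hf₁ : ∀ x : ℝ, 0 < x → HasDerivAt f₁ (x * f₂ x) x)
    (hfd : RapidDecay fun _ : Unit => f) (hfd₁ : RapidDecay fun _ : Unit => f₁)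
    (hfd₂ : RapidDecay fun _ : Unit => f₂) (hfc : ContinuousOn f₂ (Ioi 0)) :
    ∫ x, (w₂ x + ((a / x : ℝ) : ℂ) * w₁ x) * f x ∂(omega a) =
      ∫ x : ℝ, w x * (((x ^ 2 : ℝ) : ℂ) * f₂ x + (1 + a) * f₁ x) ∂(omega a) := by
  have cf : ContinuousOn f (Ioi 0) := fun x hx => (hf x hx).continuousAt.continuousWithinAt
  have cf₁ : ContinuousOn f₁ (Ioi 0) := fun x hx => (hf₁ x hx).continuousAt.continuousWithinAt
  have e1 : ∀ x : ℝ, 0 < x → w x * (((x ^ 2 : ℝ) : ℂ) * f₂ x + (1 + a) * f₁ x) =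
      w x * ((f₁ x + (x : ℂ) * (x * f₂ x)) + ((a / x : ℝ) : ℂ) * (x * f₁ x)) := fun x hx => by
    have hx' : (x : ℂ) ≠ 0 := by exact_mod_cast hx.ne'
    push_cast; field_simp; ring
  have hder : ∀ x : ℝ, 0 < x → HasDerivAt (fun x : ℝ => (x : ℂ) * f₁ x)
      (f₁ x + (x : ℂ) * (x * f₂ x)) x := fun x hx => by
    have h1 : HasDerivAt (fun x : ℝ => (x : ℂ)) 1 x := Complex.ofRealCLM.hasDerivAt
    exact (h1.mul (hf₁ x hx)).congr_deriv (by ring)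
  have hfL : MemLp f 2 (omega a) := hfd.memLp ha () cf
  have hBd : RapidDecay fun (_ : Unit) (x : ℝ) => ((x ^ 2 : ℝ) : ℂ) * f₂ x + (1 + a) * f₁ x := by
    have hconst : PolyBdd fun (_ : Unit) (_ : ℝ) => (1 + a : ℂ) :=
      ⟨0, ‖(1 + a : ℂ)‖, fun _ _ _ => by simp⟩
    simpa only [mul_comm] using hfd₂.sq_mul.add (hfd₁.mul hconst)
  have hBL := hBd.memLp ha () (((Continuous.continuousOn (by fun_prop)).mul hfc).add
    (continuousOn_const.mul cf₁))
  have hi1 := hg.integrable_mul hfL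
  have hi2 := hwL.integrable_mul hBL
  have c2 : ∀ᵐ x ∂(omega a), w x * (((x ^ 2 : ℝ) : ℂ) * f₂ x + (1 + a) * f₁ x) =
      w x * ((f₁ x + (x : ℂ) * (x * f₂ x)) + ((a / x : ℝ) : ℂ) * (x * f₁ x)) :=
    ae_omega_of_forall_pos a e1
  rw [integral_congr_ae c2]
  refine green hw hw₁ hf hder hi1 (hi2.congr c2) ?_ ?_
  · have hb : ∀ {k : ℝ → ℂ}, RapidDecay (fun _ : Unit => k) →
        ∃ C, ∀ᶠ x in 𝓝[>] (0:ℝ), ‖k x‖ ≤ C := fun {k} hk => by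
      obtain ⟨C, -, hC⟩ := hk.exists_bound 0
      refine ⟨C, ?_⟩
      filter_upwards [self_mem_nhdsWithin] with x hx
      simpa using hC () x hx
    obtain ⟨C, hC⟩ := hb hfd
    obtain ⟨C₁, hC₁⟩ := hb hfd₁
    have t1 := h0.zero_mul_isBoundedUnder_le (g := f) ⟨C, by simpa using hC⟩
    have t2 := (tendsto_rpow_mul_zero ha hw h0).zero_mul_isBoundedUnder_le (g := f₁)
      ⟨C₁, by simpa using hC₁⟩
    have t3 := t1.sub t2
    rw [sub_zero] at t3
    refine t3.congr' ?_
    filter_upwards [self_mem_nhdsWithin] with x hx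
    have hx : 0 < x := hx
    rw [Real.rpow_add_one hx.ne']
    push_cast; ring
  · obtain ⟨N, K, hK0, hK⟩ := exists_growth_bound ha hw hw₁ hc hg
    obtain ⟨C, hC0, hC⟩ := hfd.exists_bound (N + 1)
    obtain ⟨C₁, hC₁0, hC₁⟩ := hfd₁.exists_bound (⌈a + 1⌉₊ + N + 1)
    have hlim : Tendsto (fun x : ℝ => (K * C + K * C₁) * (1 + x)⁻¹) atTop (𝓝 0) := by
      have : Tendsto (fun x : ℝ => (1 + x)⁻¹) atTop (𝓝 0) :=
        tendsto_inv_atTop_zero.comp (tendsto_atTop_add_const_left _ 1 tendsto_id)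
      simpa using this.const_mul (K * C + K * C₁)
    refine squeeze_zero_norm' ?_ hlim
    filter_upwards [eventually_ge_atTop 1] with x hx
    have hx0 : 0 < x := by linarith
    have e : ((x ^ a : ℝ) : ℂ) * (w₁ x * f x - w x * (x * f₁ x)) =
        (((x ^ a : ℝ) : ℂ) * w₁ x) * f x - ((x ^ (a + 1) : ℝ) : ℂ) * (w x * f₁ x) := by
      rw [Real.rpow_add_one hx0.ne']; push_cast; ring
    have hp : ‖((x ^ (a + 1) : ℝ) : ℂ)‖ ≤ (1 + x) ^ ⌈a + 1⌉₊ := by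
      rw [Complex.norm_real, Real.norm_of_nonneg (Real.rpow_nonneg hx0.le _)]
      exact rpow_le_one_add_pow hx
    rw [e]
    refine (norm_sub_le _ _).trans ?_
    rw [norm_mul _ (f x), norm_mul _ (w x * f₁ x), norm_mul (w x)]
    calc _ ≤ (K * (1 + x) ^ N) * (C * ((1 + x) ^ (N + 1))⁻¹) + (1 + x) ^ ⌈a + 1⌉₊ *
          ((K * (1 + x) ^ N) * (C₁ * ((1 + x) ^ (⌈a + 1⌉₊ + N + 1))⁻¹)) := by
          gcongr
          · exact (hK x hx).1
          · exact hC () x hx0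
          · exact (hK x hx).2
          · exact hC₁ () x hx0
      _ = _ := by
          rw [pow_succ (1 + x) N, pow_succ (1 + x) (⌈a + 1⌉₊ + N), pow_add (1 + x) ⌈a + 1⌉₊ N]
          field_simp

/-! ### Uniqueness -/

/-- Difference quotients along `1 / (n + 1)` converge in `L²`, hence almost everywhere along a
subsequence, and there the limit must be the pointwise derivative. -/
lemma ae_eq_of_hasDerivAt_Lp {a : ℝ} {U : ℝ → Lp ℂ 2 (omega a)} {V : Lp ℂ 2 (omega a)}
    {w : ℝ → ℝ → ℂ} {w' : ℝ → ℂ} {t : ℝ} (hU : HasDerivAt U V t)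
    (hw : ∀ s, (U s : ℝ → ℂ) =ᵐ[omega a] fun x => w x s)
    (hd : ∀ x, 0 < x → HasDerivAt (fun s => w x s) (w' x) t) : (V : ℝ → ℂ) =ᵐ[omega a] w' := by
  set h : ℕ → ℝ := fun n => 1 / ((n : ℝ) + 1) with hh
  have hlim : Tendsto h atTop (𝓝[≠] 0) := by
    refine tendsto_nhdsWithin_iff.2 ⟨tendsto_one_div_add_atTop_nhds_zero_nat,
      Eventually.of_forall fun n => ?_⟩
    have : (0:ℝ) < 1 / ((n : ℝ) + 1) := by positivity
    exact this.ne'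
  have h1 := (hasDerivAt_iff_tendsto_slope_zero.1 hU).comp hlim
  obtain ⟨ns, hns, hae⟩ := (tendstoInMeasure_of_tendsto_Lp h1).exists_seq_tendsto_ae
  have hall : ∀ᵐ x ∂(omega a), ∀ n : ℕ,
      (((fun r : ℝ => r⁻¹ • (U (t + r) - U t)) ∘ h) n : Lp ℂ 2 (omega a)) x =
        (h n)⁻¹ • (w x (t + h n) - w x t) := by
    refine ae_all_iff.2 fun n => ?_
    filter_upwards [Lp.coeFn_smul (h n)⁻¹ (U (t + h n) - U t), Lp.coeFn_sub (U (t + h n)) (U t),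
      hw (t + h n), hw t] with x h2 h3 h4 h5
    simp only [Function.comp]
    rw [h2, Pi.smul_apply, h3, Pi.sub_apply, h4, h5]
  filter_upwards [hae, hall, ae_omega_pos a] with x h2 h3 hx
  have h4 := ((hasDerivAt_iff_tendsto_slope_zero.1 (hd x hx)).comp hlim).comp hns.tendsto_atTop
  refine tendsto_nhds_unique h2 (h4.congr fun n => ?_)
  exact (h3 (ns n)).symm

lemma isSchwartzPlus_of_compactSupport {g : ℝ → ℝ} (hg : ContDiff ℝ ∞ g)
    (hs : HasCompactSupport g) (hsub : tsupport g ⊆ Ioi 0) :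
    IsSchwartzPlus fun x => (g x : ℂ) := by
  have hsm : ContDiffOn ℝ ∞ (fun x => (g x : ℂ)) (Ioi 0) :=
    (Complex.ofRealCLM.contDiff.comp hg).contDiffOn
  refine ⟨hsm, fun m k => ?_⟩
  have key : ∀ k : ℕ, ContDiffOn ℝ ∞ (radialDeriv^[k] fun x => (g x : ℂ)) (Ioi 0) ∧
      ∀ x ∉ tsupport g, (radialDeriv^[k] fun x => (g x : ℂ)) x = 0 := fun k => by
    induction k with
    | zero => exact ⟨hsm, fun x hx => by simp [image_eq_zero_of_notMem_tsupport hx]⟩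
    | succ k ih =>
      rw [Function.iterate_succ_apply']
      refine ⟨contDiffOn_radialDeriv ih.1, fun x hx => ?_⟩
      have : (radialDeriv^[k] fun x => (g x : ℂ)) =ᶠ[𝓝 x] fun _ => 0 := by
        filter_upwards [(isClosed_tsupport g).isOpen_compl.mem_nhds hx] with y hy using ih.2 y hy
      rw [radialDeriv, this.deriv_eq, deriv_const, mul_zero]
  obtain ⟨C, hC⟩ := hs.isCompact.exists_bound_of_continuousOn
    (f := fun x : ℝ => ((x ^ m : ℝ) : ℂ) * (radialDeriv^[k] fun x => (g x : ℂ)) x)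
    (ContinuousOn.mul (Continuous.continuousOn (by fun_prop))
      ((key k).1.continuousOn.mono hsub))
  refine ⟨|C|, fun x _ => ?_⟩
  by_cases hx : x ∈ tsupport g
  · exact (hC x hx).trans (le_abs_self C)
  · rw [(key k).2 x hx, mul_zero, norm_zero]; positivity

lemma besselOp_eq {a : ℝ} {f f₁ f₂ : ℝ → ℂ}
    (hf : ∀ x : ℝ, 0 < x → HasDerivAt f (x * f₁ x) x)
    (hf₁ : ∀ x : ℝ, 0 < x → HasDerivAt f₁ (x * f₂ x) x) {x : ℝ} (hx : 0 < x) :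
    besselOp a f x = ((x ^ 2 : ℝ) : ℂ) * f₂ x + (1 + a) * f₁ x := by
  have h1 : HasDerivAt (fun x : ℝ => (x : ℂ)) 1 x := Complex.ofRealCLM.hasDerivAt
  have e : deriv f =ᶠ[𝓝 x] fun x : ℝ => (x : ℂ) * f₁ x := by
    filter_upwards [Ioi_mem_nhds hx] with y hy using (hf y hy).deriv
  have e2 : deriv (fun x : ℝ => (x : ℂ) * f₁ x) x = 1 * f₁ x + (x : ℂ) * (x * f₂ x) :=
    (h1.mul (hf₁ x hx)).deriv
  have hx' : (x : ℂ) ≠ 0 := by exact_mod_cast hx.ne'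
  rw [besselOp, e.deriv_eq, e2, (hf x hx).deriv]
  push_cast; field_simp; ring

lemma IsSolution.hasDerivAt_space {a : ℝ} {φ : ℝ → ℂ} {F u : ℝ → ℝ → ℂ} (h : IsSolution a φ F u)
    (t : ℝ) {x : ℝ} (hx : 0 < x) :
    HasDerivAt (fun z => u z t) (deriv (fun z => u z t) x) x :=
  (((h.contDiff_space t).differentiableOn (by simp)).differentiableAt
    (Ioi_mem_nhds hx)).hasDerivAt

lemma IsSolution.contDiffOn_deriv {a : ℝ} {φ : ℝ → ℂ} {F u : ℝ → ℝ → ℂ} (h : IsSolution a φ F u)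
    (t : ℝ) : ContDiffOn ℝ 1 (deriv fun z => u z t) (Ioi 0) :=
  (h.contDiff_space t).deriv_of_isOpen isOpen_Ioi (by norm_num)

lemma IsSolution.hasDerivAt_deriv {a : ℝ} {φ : ℝ → ℂ} {F u : ℝ → ℝ → ℂ} (h : IsSolution a φ F u)
    (t : ℝ) {x : ℝ} (hx : 0 < x) :
    HasDerivAt (deriv fun z => u z t) (deriv (deriv fun z => u z t) x) x :=
  (((h.contDiffOn_deriv t).differentiableOn (by simp)).differentiableAt
    (Ioi_mem_nhds hx)).hasDerivAt

lemma IsSolution.sub {a : ℝ} {φ ψ : ℝ → ℂ} {F G u v : ℝ → ℝ → ℂ} (h : IsSolution a φ F u)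
    (h' : IsSolution a ψ G v) : IsSolution a (fun x => φ x - ψ x) (fun x t => F x t - G x t)
      (fun x t => u x t - v x t) where
  contDiff_space t := (h.contDiff_space t).sub (h'.contDiff_space t)
  differentiable_time x hx := (h.differentiable_time x hx).sub (h'.differentiable_time x hx)
  contDiff_L2 := by
    obtain ⟨U, hU, hUu⟩ := h.contDiff_L2
    obtain ⟨V, hV, hVv⟩ := h'.contDiff_L2
    refine ⟨fun t => U t - V t, hU.sub hV, fun t => ?_⟩
    filter_upwards [Lp.coeFn_sub (U t) (V t), hUu t, hVv t] with x h1 h2 h3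
    rw [h1, Pi.sub_apply, h2, h3]
  equation x hx t := by
    have e1 : deriv (fun s => u x s - v x s) t = deriv (fun s => u x s) t - deriv (fun s => v x s) t :=
      deriv_fun_sub (h.differentiable_time x hx t) (h'.differentiable_time x hx t)
    have e2 : ∀ y, 0 < y → deriv (fun z => u z t - v z t) y =
        deriv (fun z => u z t) y - deriv (fun z => v z t) y := fun y hy =>
      ((h.hasDerivAt_space t hy).sub (h'.hasDerivAt_space t hy)).deriv
    have e3 : deriv (deriv fun z => u z t - v z t) x =
        deriv (deriv fun z => u z t) x - deriv (deriv fun z => v z t) x := by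
      have : (deriv fun z => u z t - v z t) =ᶠ[𝓝 x]
          fun y => deriv (fun z => u z t) y - deriv (fun z => v z t) y := by
        filter_upwards [Ioi_mem_nhds hx] with y hy using e2 y hy
      rw [this.deriv_eq]
      exact ((h.hasDerivAt_deriv t hx).sub (h'.hasDerivAt_deriv t hx)).deriv
    rw [← h.equation x hx t, ← h'.equation x hx t, besselOp, besselOp, besselOp, e1, e2 x hx, e3]
    ring
  neumann t := by
    have := (h.neumann t).sub (h'.neumann t)
    rw [sub_zero] at this
    refine this.congr' ?_
    filter_upwards [self_mem_nhdsWithin] with x hx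
    have e : deriv (fun z => u z t - v z t) x = _ :=
      ((h.hasDerivAt_space t hx).sub (h'.hasDerivAt_space t hx)).deriv
    rw [e]; ring
  initial x hx := by rw [h.initial x hx, h'.initial x hx]

lemma IsSolution.hasDerivAt_time {a : ℝ} {φ : ℝ → ℂ} {w : ℝ → ℝ → ℂ}
    (h : IsSolution a φ (fun _ _ => 0) w) (t : ℝ) {x : ℝ} (hx : 0 < x) :
    HasDerivAt (fun s => w x s) (Complex.I * besselOp a (fun z => w z t) x) t := by
  refine (h.differentiable_time x hx t).hasDerivAt.congr_deriv ?_
  linear_combination h.equation x hx t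

lemma IsSolution.exists_curve {a : ℝ} {φ : ℝ → ℂ} {w : ℝ → ℝ → ℂ}
    (h : IsSolution a φ (fun _ _ => 0) w) :
    ∃ W W' : ℝ → Lp ℂ 2 (omega a), (∀ t, HasDerivAt W (W' t) t) ∧
      (∀ t, (W t : ℝ → ℂ) =ᵐ[omega a] fun x => w x t) ∧
      ∀ t, (W' t : ℝ → ℂ) =ᵐ[omega a] fun x => Complex.I * besselOp a (fun z => w z t) x := by
  obtain ⟨W, hW, hWw⟩ := h.contDiff_L2
  have hWd : ∀ t, HasDerivAt W (deriv W t) t := fun t =>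
    (hW.differentiable (by simp) t).hasDerivAt
  exact ⟨W, deriv W, hWd, hWw, fun t =>
    ae_eq_of_hasDerivAt_Lp (hWd t) hWw fun x hx => h.hasDerivAt_time t hx⟩

lemma IsSolution.integral_besselOp_mul {a : ℝ} (ha : -1 < a) {φ : ℝ → ℂ} {w : ℝ → ℝ → ℂ}
    (h : IsSolution a φ (fun _ _ => 0) w) {Ψ : ℝ → ℂ} (hΨ : SchwartzFamily fun _ : Unit => Ψ)
    (t : ℝ) : ∫ x, besselOp a (fun z => w z t) x * (starRingEnd ℂ) (Ψ x) ∂(omega a) =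
      ∫ x, w x t * (starRingEnd ℂ) (besselOp a Ψ x) ∂(omega a) := by
  obtain ⟨W, W', -, hWw, hW'⟩ := h.exists_curve
  obtain ⟨d0, f₁, ⟨d1, f₂, hf₂, hd₁⟩, hd⟩ := hΨ 2
  -- Square integrability of the Bessel operator is not part of the notion of solution. It follows
  -- from the equation, since `W' t` represents `i` times it.
  have hBL : MemLp (fun x => besselOp a (fun z => w z t) x) 2 (omega a) := by
    refine ((Lp.memLp (W' t)).const_mul (-Complex.I)).ae_eq ?_
    filter_upwards [hW' t] with x hx
    rw [hx, ← mul_assoc]; simp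
  have hwL : MemLp (fun x => w x t) 2 (omega a) := (Lp.memLp (W t)).ae_eq (hWw t)
  have hstar : ∀ {k : Unit → ℝ → ℂ}, RapidDecay k →
      RapidDecay fun _ : Unit => fun x => (starRingEnd ℂ) (k () x) := fun {k} hk m => by
    obtain ⟨C, hC⟩ := hk m
    exact ⟨C, fun _ x hx => by rw [RCLike.norm_conj]; exact hC () x hx⟩
  have key := green_maximal ha (fun x hx => h.hasDerivAt_space t hx)
    (fun x hx => h.hasDerivAt_deriv t hx)
    ((h.contDiffOn_deriv t).continuousOn_deriv_of_isOpen isOpen_Ioi (by simp)) hwL hBL (h.neumann t)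
    (f := fun x => (starRingEnd ℂ) (Ψ x)) (f₁ := fun x => (starRingEnd ℂ) (f₁ () x))
    (f₂ := fun x => (starRingEnd ℂ) (f₂ () x))
    (fun x hx => (hd () x hx).star.congr_deriv (by simp))
    (fun x hx => (hd₁ () x hx).star.congr_deriv (by simp))
    (hstar d0) (hstar d1) (hstar hf₂.prop)
    (Complex.continuous_conj.comp_continuousOn (hf₂.continuousOn ()))
  refine key.trans (integral_congr_ae (ae_omega_of_forall_pos a fun x hx => ?_))
  simp only [besselOp_eq (a := a) (hd ()) (hd₁ ()) hx]
  simp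

/-- The pairing of two homogeneous solutions is conserved. -/
lemma IsSolution.integral_mul_conj {a : ℝ} (ha : -1 < a) {ψ : ℝ → ℂ} {w Ψ : ℝ → ℝ → ℂ}
    (h : IsSolution a (fun _ => 0) (fun _ _ => 0) w)
    (hsol : IsSolution a ψ (fun _ _ => 0) Ψ)
    (hΨS : ∀ t, SchwartzFamily fun _ : Unit => fun x => Ψ x t) (τ : ℝ) :
    ∫ x, w x τ * (starRingEnd ℂ) (ψ x) ∂(omega a) = 0 := by
  obtain ⟨W, W', hWd, hWw, hW'⟩ := h.exists_curve
  obtain ⟨P, P', hPd, hPΨ, hP'⟩ := hsol.exists_curve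
  -- The inner product is conjugate linear in its first slot, so the two derivatives carry `-i` and
  -- `i` and cancel by the symmetry of the Bessel operator.
  have hJ : ∀ t, HasDerivAt (fun t => inner ℂ (P (t - τ)) (W t)) (0 : ℂ) t := by
    intro t
    have h1 := ((hPd (t - τ)).comp_sub_const t τ).inner ℂ (hWd t)
    refine h1.congr_deriv ?_
    rw [L2.inner_def, L2.inner_def]
    have e1 : ∫ x, inner ℂ (P (t - τ) x) (W' t x) ∂(omega a) = Complex.I *
        ∫ x, besselOp a (fun z => w z t) x * (starRingEnd ℂ) (Ψ x (t - τ)) ∂(omega a) := by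
      rw [← integral_const_mul]
      refine integral_congr_ae ?_
      filter_upwards [hPΨ (t - τ), hW' t] with x h2 h3
      rw [h2, h3, RCLike.inner_apply]; ring
    have e2 : ∫ x, inner ℂ (P' (t - τ) x) (W t x) ∂(omega a) = -Complex.I *
        ∫ x, w x t * (starRingEnd ℂ) (besselOp a (fun z => Ψ z (t - τ)) x) ∂(omega a) := by
      rw [← integral_const_mul]
      refine integral_congr_ae ?_
      filter_upwards [hP' (t - τ), hWw t] with x h2 h3
      rw [h2, h3, RCLike.inner_apply, map_mul, Complex.conj_I]; ring
    rw [e1, e2, h.integral_besselOp_mul ha (hΨS (t - τ))]; ring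
  have hconst := is_const_of_deriv_eq_zero (fun t => (hJ t).differentiableAt)
    (fun t => (hJ t).deriv) τ 0
  have hW0 : W 0 = 0 := by
    refine Lp.eq_zero_iff_ae_eq_zero.2 ?_
    filter_upwards [hWw 0, ae_omega_pos a] with x h1 hx
    rw [h1, h.initial x hx]; rfl
  rw [hW0, inner_zero_right, sub_self, L2.inner_def] at hconst
  rw [← hconst]
  refine integral_congr_ae ?_
  filter_upwards [hPΨ 0, hWw τ, ae_omega_pos a] with x h1 h2 hx
  rw [h1, h2, RCLike.inner_apply, hsol.initial x hx]

lemma IsSolution.integral_smul_eq_zero {a : ℝ} (ha : -1 < a) {w : ℝ → ℝ → ℂ}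
    (h : IsSolution a (fun _ => 0) (fun _ _ => 0) w) {ψ : ℝ → ℂ}
    (hψ : SchwartzFamily fun _ : Unit => ψ) (τ : ℝ) :
    ∫ x, w x τ * (starRingEnd ℂ) (ψ x) ∂(omega a) = 0 := by
  have hz : SchwartzFamily fun (_ : ℝ) (_ : ℝ) => (0 : ℂ) := fun n => by
    simpa using ((hψ n).comp fun _ : ℝ => ()).const_mul 0
  have hzd : RapidDecay fun (_ : ℝ) (_ : ℝ) => (0 : ℂ) := hz.rapidDecay
  have hsol := isSolution_solution ha (φ := ψ) (F := fun _ _ => 0) (F' := fun _ _ => 0) hψ hz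
    (fun x _ t => hasDerivAt_const t 0) hzd
  set Ψ := solution a (hankel a ψ) (fun _ => hankel a fun _ => 0) with hΨ
  have hΨS : ∀ t, SchwartzFamily fun _ : Unit => fun x => Ψ x t := fun t => by
    have e : (fun x => Ψ x t) = evol a t (hankel a ψ) := by
      ext x
      rw [hΨ, solution, evol]
      congr 1
      ext ξ
      simp [duhamel, hankel]
    rw [e]
    exact ((hψ.hankel ha).phase_mul_single t).hankel ha
  exact h.integral_mul_conj ha hsol hΨS τ

lemma IsSolution.eq_zero {a : ℝ} (ha : -1 < a) {w : ℝ → ℝ → ℂ}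
    (h : IsSolution a (fun _ => 0) (fun _ _ => 0) w) {x : ℝ} (hx : 0 < x) (t : ℝ) : w x t = 0 := by
  refine eq_zero_of_integral_smul_eq_zero (a := a) (d := fun x => w x t)
    (h.contDiff_space t).continuousOn (fun g hg hs hsub => ?_) hx
  rw [← h.integral_smul_eq_zero ha
    (isSchwartzPlus_of_compactSupport hg hs hsub).schwartzFamily t]
  congr 1; ext y
  rw [Complex.conj_ofReal, Complex.real_smul, mul_comm]

lemma IsSolution.unique {a : ℝ} (ha : -1 < a) {φ : ℝ → ℂ} {F u v : ℝ → ℝ → ℂ}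
    (h : IsSolution a φ F u) (h' : IsSolution a φ F v) {x : ℝ} (hx : 0 < x) (t : ℝ) :
    u x t = v x t := by
  have := h.sub h'
  simp only [sub_self] at this
  exact sub_eq_zero.1 (this.eq_zero ha hx t)

end

end HalfLine

theorem proposition1p1 (a : ℝ) (ha : -1 < a) (φ : ℝ → ℂ) (hφ : HalfLine.IsSchwartzPlus φ)
    (F : ℝ → ℝ → ℂ) (hF : HalfLine.IsSpaceTimeSchwartzPlus F) :
    (∃ u : ℝ → ℝ → ℂ, HalfLine.IsSolution a φ F u) ∧
    ∀ u : ℝ → ℝ → ℂ, HalfLine.IsSolution a φ F u →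
      ∀ x : ℝ, 0 < x → ∀ t : ℝ, t ≠ 0 →
        Integrable (fun y => HalfLine.kernelS a x y t * φ y) (HalfLine.omega a) ∧
        (∀ s : ℝ, s ≠ t →
          Integrable (fun y => HalfLine.kernelS a x y (t - s) * F y s) (HalfLine.omega a)) ∧
        IntervalIntegrable
          (fun s => ∫ y, HalfLine.kernelS a x y (t - s) * F y s ∂(HalfLine.omega a))
          volume 0 t ∧
        u x t = (∫ y, HalfLine.kernelS a x y t * φ y ∂(HalfLine.omega a)) +
          ∫ s in (0 : ℝ)..t,
            ∫ y, HalfLine.kernelS a x y (t - s) * F y s ∂(HalfLine.omega a) := by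
  have hS := hφ.schwartzFamily
  have hFS := hF.schwartzFamily
  have hd : ∀ x, 0 < x → ∀ t, HasDerivAt (fun t => F x t) (deriv (fun s => F x s) t) t :=
    fun x hx t => ((hF.contDiff_time hx).differentiable (by simp) t).hasDerivAt
  have hsol := HalfLine.isSolution_solution ha hS hFS hd hF.rapidDecay_deriv
  have hdata := HalfLine.sourceData ha hS hFS fun x hx => (hF.contDiff_time hx).continuous
  refine ⟨⟨_, hsol⟩, fun u hu x hx t ht => ?_⟩
  have hker : ∀ s, s ≠ t → ∫ y, HalfLine.kernelS a x y (t - s) * F y s ∂(HalfLine.omega a) =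
      HalfLine.evol a (t - s) (HalfLine.hankel a fun y => F y s) x := fun s hs =>
    HalfLine.integral_kernelS_mul ha (hFS.comp fun _ : Unit => s) hx (sub_ne_zero.2 hs.symm)
  -- At `s = t` the kernel takes the default value `0`, so the two functions are compared only away
  -- from that point.
  have hae : (fun s => HalfLine.evol a (t - s) (HalfLine.hankel a fun y => F y s) x) =ᵐ[volume]
      fun s => ∫ y, HalfLine.kernelS a x y (t - s) * F y s ∂(HalfLine.omega a) := by
    have : ∀ᵐ s : ℝ, s ≠ t := by simp [ae_iff]
    filter_upwards [this] with s hs using (hker s hs).symm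
  -- The evolution is continuous even across `s = t`, where the kernel is singular; this yields the
  -- absolute convergence of the integral in `s`.
  have hcont : Continuous fun s =>
      HalfLine.evol a (t - s) (HalfLine.hankel a fun y => F y s) x := by
    have h1 : HalfLine.RapidDecay fun (s : ℝ) ξ => HalfLine.hankel a (fun y => F y s) ξ * HalfLine.phase (t - s) ξ :=
      (hFS.hankel ha).rapidDecay.mul ⟨0, 1, fun s ξ _ => by simp [HalfLine.norm_phase]⟩
    have h2 := h1.continuous_hankel ha
      (fun s => ((hFS.hankel ha).continuousOn s).mul
        (HalfLine.continuous_phase.comp (Continuous.prodMk_right (t - s))).continuousOn)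
      (fun ξ _ => (hdata.continuous_source.comp (f := fun s : ℝ => (s, ξ)) (by fun_prop)).mul
        (HalfLine.continuous_phase.comp (f := fun s : ℝ => (t - s, ξ)) (by fun_prop)))
    have h3 := h2.comp (f := fun s : ℝ => (x, s)) (by fun_prop)
    simpa only [HalfLine.evol, Function.comp_def, mul_comm] using h3
  refine ⟨HalfLine.integrable_kernelS_mul ha hS hx ht, fun s hs =>
    HalfLine.integrable_kernelS_mul ha (hFS.comp fun _ : Unit => s) hx (sub_ne_zero.2 hs.symm),
    (hcont.intervalIntegrable 0 t).congr_ae (ae_restrict_of_ae hae), ?_⟩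
  rw [hu.unique ha hsol hx t, hdata.solution_eq ha,
    HalfLine.integral_kernelS_mul ha hS hx ht]
  congr 1
  exact intervalIntegral.integral_congr_ae (hae.mono fun s hs _ => hs)
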